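/- Let $G=(V,E,w,\ell)$ be a finite simple undirected graph with $m$ edges, edge weights $w:E\to\mathbb N$ and a vertex labeling $\ell:V\to\{1,\dots,L\}$, where the number $L$ of labels is fixed. A copy of the $k$-cycle $C_k$ in $G$ (a subgraph isomorphic to $C_k$) is *colorful* if no two of its vertices have the same label. The weighted count of colorful $k$-cycles is $$\mathrm{WSub}_{C_k}(G)=\sum_{H}\ \prod_{e\in E(H)}w(e),$$ the sum being over all colorful copies $H$ of $C_k$ in $G$. The model of computation is the deterministic word RAM with words of $\kappa\log_2 N$ bits or more, where the constant $\kappa$ depends only on the program. For a graph, $N\ge 2$ bounds $|V|$ and the weights, and the graph is given by the list of its weighted edges and an array of vertex labels. For a pair of $n\times n$ matrices of non-negative integers, $N\ge 2$ bounds $n$ and the entries. Let $\omega$ be a real number such that two $n\times n$ matrices of non-negative integers can be multiplied in time $O(n^\omega)$ in this model (for instance the least such number, if there is one). Then for every $L$, $\mathrm{WSub}_{C_k}(G)$ can be computed * for $k=3$ in time $O\big(m^{2\omega/(\omega+1)}\big)$, * for $k=4$ in time $O\big(m^{(4\omega-1)/(2\omega+1)}\big)$, * for $k=5$ in time $O\big(m^{3\omega/(\omega+2)}\big)$,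 where the program and the implied constant depend only on $k$, $L$ and $\omega$ (for $m=0$ the time is $O(1)$). Moreover, if $\omega$ denotes the infimum of all exponents $\tau$ such that matrices can be multiplied in time $O(n^\tau)$, then for every $\varepsilon>0$ the same holds for this $\omega$ with $\varepsilon$ added to each of the three exponents of $m$. -/

import Mathlib

/-! ### The word RAM

The machine has registers and arrays, both named by natural numbers (a program mentions only
finitely many of them); every register and every array cell holds a word of `b` bits, and every
array is addressed by words.  Programs are structured (assignments, conditionals, loops); each
constant, register access, array access, word operation, assignment and test costs one step.
A program does not depend on `b`. -/

namespace WordRAM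

/-- The memory of a machine with words of `b` bits. -/
structure State (b : ℕ) where
  reg : ℕ → BitVec b
  arr : ℕ → BitVec b → BitVec b

/-- The word operations. -/
inductive Op
  | add | sub | mul | div | mod | and | or | xor | shl | shr | lt | eq

/-- Arithmetic is unsigned, modulo `2 ^ b`; comparisons return `0` or `1`. -/
def Op.eval {b : ℕ} : Op → BitVec b → BitVec b → BitVec b
  | .add, x, y => x + y
  | .sub, x, y => x - y
  | .mul, x, y => x * y
  | .div, x, y => x / y
  | .mod, x, y => x % y
  | .and, x, y => x &&& y
  | .or, x, y => x ||| y
  | .xor, x, y => x ^^^ y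
  | .shl, x, y => x <<< y
  | .shr, x, y => x >>> y
  | .lt, x, y => if x < y then 1 else 0
  | .eq, x, y => if x = y then 1 else 0

inductive Expr
  | const (c : ℕ)
  | reg (r : ℕ)
  | read (a : ℕ) (i : Expr)
  | op (o : Op) (x y : Expr)

def Expr.eval {b : ℕ} (s : State b) : Expr → BitVec b
  | .const c => BitVec.ofNat b c
  | .reg r => s.reg r
  | .read a i => s.arr a (i.eval s)
  | .op o x y => o.eval (x.eval s) (y.eval s)

/-- The number of steps needed to evaluate an expression. -/
def Expr.cost : Expr → ℕ
  | .const _ => 1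
  | .reg _ => 1
  | .read _ i => i.cost + 1
  | .op _ x y => x.cost + y.cost + 1

inductive Program
  | skip
  | assign (r : ℕ) (e : Expr)
  | write (a : ℕ) (i e : Expr)
  | seq (p q : Program)
  | cond (e : Expr) (p q : Program)
  | loop (e : Expr) (p : Program)

def State.setReg {b : ℕ} (s : State b) (r : ℕ) (x : BitVec b) : State b :=
  { s with reg := Function.update s.reg r x }

def State.setArr {b : ℕ} (s : State b) (a : ℕ) (i x : BitVec b) : State b :=
  { s with arr := Function.update s.arr a (Function.update (s.arr a) i x) }

/-- `Exec p s s₁ t`: started in the memory `s`, the program `p` halts after exactly `t` steps, with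
memory `s₁`.  `cond e p q` runs `p` if `e ≠ 0` and `q` otherwise; `loop e p` repeats `p` as long as
`e ≠ 0`. -/
inductive Exec {b : ℕ} : Program → State b → State b → ℕ → Prop
  | skip (s : State b) : Exec .skip s s 1
  | assign (s : State b) (r : ℕ) (e : Expr) :
      Exec (.assign r e) s (s.setReg r (e.eval s)) (e.cost + 1)
  | write (s : State b) (a : ℕ) (i e : Expr) :
      Exec (.write a i e) s (s.setArr a (i.eval s) (e.eval s)) (i.cost + e.cost + 1)
  | seq {p q : Program} {s₀ s₁ s₂ : State b} {t₁ t₂ : ℕ} :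
      Exec p s₀ s₁ t₁ → Exec q s₁ s₂ t₂ → Exec (.seq p q) s₀ s₂ (t₁ + t₂)
  | condTrue {e : Expr} {p q : Program} {s s₁ : State b} {t : ℕ} :
      e.eval s ≠ 0 → Exec p s s₁ t → Exec (.cond e p q) s s₁ (e.cost + 1 + t)
  | condFalse {e : Expr} {p q : Program} {s s₁ : State b} {t : ℕ} :
      e.eval s = 0 → Exec q s s₁ t → Exec (.cond e p q) s s₁ (e.cost + 1 + t)
  | loopDone {e : Expr} {p : Program} {s : State b} :
      e.eval s = 0 → Exec (.loop e p) s s (e.cost + 1)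
  | loopStep {e : Expr} {p : Program} {s₀ s₁ s₂ : State b} {t₁ t₂ : ℕ} :
      e.eval s₀ ≠ 0 → Exec p s₀ s₁ t₁ → Exec (.loop e p) s₁ s₂ t₂ →
      Exec (.loop e p) s₀ s₂ (e.cost + 1 + t₁ + t₂)

/-- Array `a` stores, row by row from address `0` on, the `n × n` matrix `A`. -/
def State.HoldsMatrix {b : ℕ} (s : State b) (a : ℕ) {n : ℕ} (A : Matrix (Fin n) (Fin n) ℕ) : Prop :=
  ∀ i j : Fin n, (s.arr a (BitVec.ofNat b (i * n + j))).toNat = A i j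

end WordRAM

/-! ### The matrix multiplication exponent -/

open WordRAM in
/-- `n × n` matrices of non-negative integers can be multiplied in time `O(n ^ τ)` by a word RAM
with words of `κ log N` bits, `κ` a constant, where `N` bounds `n` and the entries.  Memory other
than the input has arbitrary initial contents. -/
def MatMulInTime (τ : ℝ) : Prop :=
  ∃ (P : Program) (κ : ℕ) (C : ℝ), ∀ (n N b : ℕ) (A B : Matrix (Fin n) (Fin n) ℕ),
    2 ≤ N → n ≤ N → (∀ i j, A i j ≤ N) → (∀ i j, B i j ≤ N) → N ^ κ ≤ 2 ^ b →
    ∀ s : State b, (s.reg 0).toNat = n → s.HoldsMatrix 0 A → s.HoldsMatrix 1 B →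
      ∃ (s₁ : State b) (t : ℕ), Exec P s s₁ t ∧ s₁.HoldsMatrix 2 (A * B) ∧
        (t : ℝ) ≤ C * ((n : ℝ) + 1) ^ τ

/-- The exponent of matrix multiplication, as an infimum. -/
noncomputable def matMulExponent : ℝ := sInf {τ : ℝ | MatMulInTime τ}

/-! ### Weighted labeled graphs and colorful copies -/

/-- A weighted graph with vertices labeled by `L` labels.  Only the weights of edges matter: the
weight of an edge is the number of parallel edges that it stands for. -/
structure WeightedLabeledGraph (L : ℕ) where
  n : ℕ
  graph : SimpleGraph (Fin n)
  weight : Sym2 (Fin n) → ℕ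
  label : Fin n → Fin L

namespace WeightedLabeledGraph

variable {L : ℕ}

/-- The number of edges. -/
noncomputable def m (G : WeightedLabeledGraph L) : ℕ := G.graph.edgeSet.ncard

/-- The subgraph `T` is a copy of `H`, and no two of its vertices have the same label. -/
def IsColorfulCopy {W : Type} (G : WeightedLabeledGraph L) (H : SimpleGraph W)
    (T : G.graph.Subgraph) : Prop :=
  Nonempty (H ≃g T.coe) ∧ Set.InjOn G.label T.verts

open Classical in
/-- The sum, over all colorful copies of `H` in `G`, of the product of the edge weights. -/
noncomputable def wSub {W : Type} (G : WeightedLabeledGraph L) (H : SimpleGraph W) : ℕ :=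
  ∑ T : G.graph.Subgraph with G.IsColorfulCopy H T, ∏ e ∈ T.edgeSet.toFinset, G.weight e

/-- The memory `s` holds `G`: the numbers of vertices and edges are in registers `0` and `1`; arrays
`0`, `1` and `2` list, in some order and each edge once, the two ends and the weight of the edges;
array `3` lists the labels of the vertices. -/
def HeldBy {b : ℕ} (G : WeightedLabeledGraph L) (s : WordRAM.State b) : Prop :=
  (s.reg 0).toNat = G.n ∧ (s.reg 1).toNat = G.m ∧
  (∃ u v : Fin G.m → Fin G.n,
    Set.BijOn (fun i => s(u i, v i)) Set.univ G.graph.edgeSet ∧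
    ∀ i : Fin G.m,
      (s.arr 0 (BitVec.ofNat b i)).toNat = u i ∧
      (s.arr 1 (BitVec.ofNat b i)).toNat = v i ∧
      (s.arr 2 (BitVec.ofNat b i)).toNat = G.weight s(u i, v i)) ∧
  ∀ x : Fin G.n, (s.arr 3 (BitVec.ofNat b x)).toNat = G.label x

end WeightedLabeledGraph

open WordRAM in
/-- For graphs with `L` labels, the weighted number of colorful `k`-cycles can be computed in time
`O(m ^ c)` by a word RAM with words of `κ log N` bits, `κ` a constant, where `N` bounds the number
of vertices and the weights.  The result is left in register `0`.  Memory other than the input has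
arbitrary initial contents. -/
def ColorfulCyclesInTime (k L : ℕ) (c : ℝ) : Prop :=
  ∃ (P : Program) (κ : ℕ) (C : ℝ), ∀ (G : WeightedLabeledGraph L) (N b : ℕ),
    2 ≤ N → G.n ≤ N → (∀ e ∈ G.graph.edgeSet, G.weight e ≤ N) → N ^ κ ≤ 2 ^ b →
    ∀ s : State b, G.HeldBy s →
      ∃ (s₁ : State b) (t : ℕ), Exec P s s₁ t ∧
        (s₁.reg 0).toNat = G.wSub (SimpleGraph.cycleGraph k) ∧
        (t : ℝ) ≤ C * ((G.m : ℝ) + 1) ^ c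

/-!
Colorful `k`-cycles are counted as closed walks of `k` steps with distinct labels: every colorful
copy of the cycle is traversed by as many of these walks as the cycle has automorphisms
(`sum_colorfulWalk`), so the sum over walks is divided by that number at the end.  With a label
prescribed for every step the labels are automatically distinct, and the sum over walks is the trace
of a product of matrices `sel * adj`, where `sel` selects the vertices with the prescribed label.
There are only boundedly many ways to prescribe labels.

Let `M` be the number of edges plus a large constant.  The vertices are sorted by decreasing degree
(`prepProg_spec`; isolated vertices are dropped, so that the time does not depend on their number)
and split into three classes by a parameter `δ`: about `M / δ ^ 2` vertices of high degree, about
`M / δ` vertices of high or medium degree, and the rest; the vertices of medium degree have at most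
`δ ^ 2` neighbors, those of low degree at most `δ`.  Besides the labels, the class of every step is
prescribed.  For each pattern of classes there is a way to evaluate the trace in time `O(M * δ ^ 2)`:

* either the cycle is cut into two walks such that walks of both kinds can be enumerated in this time,
  because their inner vertices have small degrees; the two kinds are joined in an associative array
  (`hashJoin_spec`);
* or the cycle is cut into at least three walks between vertices of high degree (or, for `k = 5`, of
  high or medium degree), whose matrices are filled by enumeration and multiplied by the given
  program; one of the ends may run through a larger class, which is then split into blocks of the
  size of the matrices (`blockProg_spec`).

That one of the two ways works for each pattern is a finite check (`plan_three`, `plan_four`,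
`plan_five`).  The cost of the multiplications is controlled by a number `β`, which is `2`, `1` and
`0` for `k = 3`, `4` and `5`: matrices of the size `M / δ ^ 2` have to be multiplied in time
`M * δ ^ β`, and for `k = 5` matrices of the size `M / δ` in time `M * δ ^ 2`.  If multiplication
takes time `O(n ^ ω)`, this holds as soon as `δ` is a large multiple of `M ^ θ`, where `θ` is
`(ω - 1) / (2 * ω + 2)`, `(ω - 1) / (2 * ω + 1)` and `(ω - 1) / (ω + 2)` respectively
(`exists_parameter`), and `M * δ ^ 2` is then of the order `M ^ (1 + 2 * θ)`, which is the time
claimed.  With this `δ` there is also time to fill the matrices; this uses `2 ≤ ω`, which holds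
because all entries of a product have to be written (`two_le_of_matMulInTime`).

A program cannot compute `M ^ θ`, as `ω` is an arbitrary real number.  It tries the powers of two
for `δ` instead, and stops the multiplications when they exceed their time limit
(`Program.clocked_spec`); the first `δ` for which none is stopped gives the result, and the times of
the rounds form a geometric series (`search_spec`).

For the infimum of the exponents, exponents close to it are used; the set of exponents is not empty
since it contains `3` (`matMulInTime_three`), and the three exponents of `M` grow with `ω` at most at
unit rate.
-/

namespace WordRAM

variable {b : ℕ}

/-! ### Words as residues of natural numbers -/

theorem ofNat_inj_of_lt {x y : ℕ} (hx : x < 2 ^ b) (hy : y < 2 ^ b) :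
    BitVec.ofNat b x = BitVec.ofNat b y ↔ x = y := by
  rw [← BitVec.toNat_inj, BitVec.toNat_ofNat, BitVec.toNat_ofNat, Nat.mod_eq_of_lt hx,
    Nat.mod_eq_of_lt hy]

theorem ofNat_lt_of_lt {x y : ℕ} (hx : x < 2 ^ b) (hy : y < 2 ^ b) :
    BitVec.ofNat b x < BitVec.ofNat b y ↔ x < y := by
  rw [BitVec.ofNat_lt_ofNat, Nat.mod_eq_of_lt hx, Nat.mod_eq_of_lt hy]

theorem ofNat_div_of_lt {x y : ℕ} (hx : x < 2 ^ b) (hy : y < 2 ^ b) :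
    BitVec.ofNat b x / BitVec.ofNat b y = BitVec.ofNat b (x / y) := by
  apply BitVec.eq_of_toNat_eq
  rw [BitVec.toNat_udiv, BitVec.toNat_ofNat, BitVec.toNat_ofNat, BitVec.toNat_ofNat,
    Nat.mod_eq_of_lt hx, Nat.mod_eq_of_lt hy,
    Nat.mod_eq_of_lt (lt_of_le_of_lt (Nat.div_le_self _ _) hx)]

theorem eq_ofNat_of_toNat_eq {x : BitVec b} {k : ℕ} (h : x.toNat = k) : x = BitVec.ofNat b k := by
  subst h; simp

theorem one_ne_zero_word {k : ℕ} (hk : 0 < k) (h : k < 2 ^ b) : (1 : BitVec b) ≠ 0 := by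
  have : (1 : ℕ) < 2 ^ b := by omega
  intro h0
  have := (ofNat_inj_of_lt (b := b) this (Nat.two_pow_pos b)).1 h0
  omega

/-! ### Total correctness with a time bound -/

/-- `p.wr r`: some assignment in `p` targets register `r`. -/
def Program.wr : Program → ℕ → Prop
  | .skip, _ => False
  | .assign r' _, r => r = r'
  | .write _ _ _, _ => False
  | .seq p q, r => p.wr r ∨ q.wr r
  | .cond _ p q, r => p.wr r ∨ q.wr r
  | .loop _ p, r => p.wr r

/-- `p.wa a`: some write in `p` targets array `a`. -/
def Program.wa : Program → ℕ → Prop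
  | .skip, _ => False
  | .assign _ _, _ => False
  | .write a' _ _, a => a = a'
  | .seq p q, a => p.wa a ∨ q.wa a
  | .cond _ p q, a => p.wa a ∨ q.wa a
  | .loop _ p, a => p.wa a

/-- The memories `s` and `s'` agree on all registers and arrays that `p` does not mention as a
target. -/
def Frame (p : Program) (s s' : State b) : Prop :=
  (∀ r, ¬ p.wr r → s'.reg r = s.reg r) ∧ (∀ a, ¬ p.wa a → s'.arr a = s.arr a)

theorem Frame.refl (p : Program) (s : State b) : Frame p s s := ⟨fun _ _ => rfl, fun _ _ => rfl⟩

theorem Frame.trans {p : Program} {s s' s'' : State b} (h : Frame p s s') (h' : Frame p s' s'') :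
    Frame p s s'' :=
  ⟨fun r hr => (h'.1 r hr).trans (h.1 r hr), fun a ha => (h'.2 a ha).trans (h.2 a ha)⟩

theorem Frame.mono {p q : Program} {s s' : State b} (h : Frame p s s')
    (hr : ∀ r, p.wr r → q.wr r) (ha : ∀ a, p.wa a → q.wa a) : Frame q s s' :=
  ⟨fun r h' => h.1 r fun h'' => h' (hr r h''), fun a h' => h.2 a fun h'' => h' (ha a h'')⟩

theorem Exec.frame {p : Program} {s s' : State b} {t : ℕ} (h : Exec p s s' t) : Frame p s s' := by
  induction h with
  | skip s => exact Frame.refl _ _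
  | assign s r e =>
    refine ⟨fun r' hr => ?_, fun _ _ => rfl⟩
    exact Function.update_of_ne hr _ _
  | write s a i e =>
    refine ⟨fun _ _ => rfl, fun a' ha => ?_⟩
    exact Function.update_of_ne ha _ _
  | seq _ _ h1 h2 =>
    exact (h1.mono (fun _ => Or.inl) (fun _ => Or.inl)).trans
      (h2.mono (fun _ => Or.inr) (fun _ => Or.inr))
  | condTrue _ _ h => exact h.mono (fun _ => Or.inl) (fun _ => Or.inl)
  | condFalse _ _ h => exact h.mono (fun _ => Or.inr) (fun _ => Or.inr)
  | loopDone _ => exact Frame.refl _ _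
  | loopStep _ _ _ h1 h2 => exact Frame.trans (h1.mono (fun _ h => h) (fun _ h => h)) h2

/-- Started in `s`, the program `p` halts after at most `T` steps in a memory that satisfies `Q`. -/
def Tri (p : Program) (s : State b) (T : ℕ) (Q : State b → Prop) : Prop :=
  ∃ s' t, Exec p s s' t ∧ t ≤ T ∧ Q s'

theorem Tri.mono {p : Program} {s : State b} {T T' : ℕ} {Q Q' : State b → Prop}
    (h : Tri p s T Q) (hT : T ≤ T') (hQ : ∀ s', Frame p s s' → Q s' → Q' s') : Tri p s T' Q' := by
  obtain ⟨s', t, he, ht, hq⟩ := h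
  exact ⟨s', t, he, ht.trans hT, hQ s' he.frame hq⟩

theorem Tri.skip {s : State b} {T : ℕ} {Q : State b → Prop} (hT : 1 ≤ T) (h : Q s) :
    Tri .skip s T Q := ⟨s, 1, .skip s, hT, h⟩

theorem Tri.assign {r : ℕ} {e : Expr} {s : State b} {T : ℕ} {Q : State b → Prop}
    (hT : e.cost + 1 ≤ T) (h : Q (s.setReg r (e.eval s))) : Tri (.assign r e) s T Q :=
  ⟨_, _, .assign s r e, hT, h⟩

theorem Tri.write {a : ℕ} {i e : Expr} {s : State b} {T : ℕ} {Q : State b → Prop}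
    (hT : i.cost + e.cost + 1 ≤ T) (h : Q (s.setArr a (i.eval s) (e.eval s))) :
    Tri (.write a i e) s T Q :=
  ⟨_, _, .write s a i e, hT, h⟩

theorem Tri.seq {p q : Program} {s : State b} {T₁ T₂ : ℕ} {Q : State b → Prop}
    (h : Tri p s T₁ (fun s' => Frame p s s' → Tri q s' T₂ Q)) :
    Tri (.seq p q) s (T₁ + T₂) Q := by
  obtain ⟨s', t, he, ht, hq⟩ := h
  obtain ⟨s'', t', he', ht', hq'⟩ := hq he.frame
  exact ⟨s'', t + t', .seq he he', by omega, hq'⟩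

theorem Tri.seq' {p q : Program} {s : State b} {T T₁ T₂ : ℕ} {P Q : State b → Prop}
    (h : Tri p s T₁ P) (h' : ∀ s', Frame p s s' → P s' → Tri q s' T₂ Q) (hT : T₁ + T₂ ≤ T) :
    Tri (.seq p q) s T Q :=
  (Tri.seq (h.mono le_rfl fun s' hf hp _ => h' s' hf hp)).mono hT fun _ _ h => h

theorem Tri.cond {e : Expr} {p q : Program} {s : State b} {T : ℕ} {Q : State b → Prop}
    (hp : e.eval s ≠ 0 → Tri p s T Q) (hq : e.eval s = 0 → Tri q s T Q) :
    Tri (.cond e p q) s (e.cost + 1 + T) Q := by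
  by_cases h : e.eval s = 0
  · obtain ⟨s', t, he, ht, hQ⟩ := hq h
    exact ⟨s', _, .condFalse h he, by omega, hQ⟩
  · obtain ⟨s', t, he, ht, hQ⟩ := hp h
    exact ⟨s', _, .condTrue h he, by omega, hQ⟩

theorem Tri.assign_seq {r : ℕ} {e : Expr} {q : Program} {s : State b} {T T₂ : ℕ}
    {Q : State b → Prop} (h : Tri q (s.setReg r (e.eval s)) T₂ Q) (hT : e.cost + 1 + T₂ ≤ T) :
    Tri (.seq (.assign r e) q) s T Q :=
  (Tri.seq (T₁ := e.cost + 1) (Tri.assign le_rfl fun _ => h)).mono hT fun _ _ h => h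

theorem Tri.write_seq {a : ℕ} {i e : Expr} {q : Program} {s : State b} {T T₂ : ℕ}
    {Q : State b → Prop} (h : Tri q (s.setArr a (i.eval s) (e.eval s)) T₂ Q)
    (hT : i.cost + e.cost + 1 + T₂ ≤ T) : Tri (.seq (.write a i e) q) s T Q :=
  (Tri.seq (T₁ := i.cost + e.cost + 1) (Tri.write le_rfl fun _ => h)).mono hT fun _ _ h => h

theorem Tri.cond' {e : Expr} {p q : Program} {s : State b} {T : ℕ} (T' : ℕ) {Q : State b → Prop}
    (hp : e.eval s ≠ 0 → Tri p s T' Q) (hq : e.eval s = 0 → Tri q s T' Q)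
    (hT : e.cost + 1 + T' ≤ T) : Tri (.cond e p q) s T Q :=
  (Tri.cond hp hq).mono hT fun _ _ h => h

/-- The rule for loops: `I k` is the invariant before the `k`-th round, and there are at most `n`
rounds. -/
theorem Tri.loop {e : Expr} {p : Program} {s : State b} {Q : State b → Prop}
    (I : ℕ → State b → Prop) (T : ℕ → ℕ) (k₀ n : ℕ) (hk : k₀ ≤ n) (h0 : I k₀ s)
    (hstep : ∀ k s', k₀ ≤ k → k ≤ n → Frame p s s' → I k s' →
      (e.eval s' = 0 ∧ Q s') ∨ (k < n ∧ e.eval s' ≠ 0 ∧ Tri p s' (T k) (I (k + 1)))) :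
    Tri (.loop e p) s ((∑ k ∈ Finset.Ico k₀ n, (T k + (e.cost + 1))) + (e.cost + 1)) Q := by
  obtain ⟨d, hd⟩ : ∃ d, d = n - k₀ := ⟨_, rfl⟩
  induction d generalizing s k₀ with
  | zero =>
    rcases hstep k₀ s le_rfl hk (Frame.refl _ _) h0 with ⟨h, hq⟩ | ⟨h, -⟩
    · exact ⟨s, _, .loopDone h, by omega, hq⟩
    · omega
  | succ d ih =>
    rcases hstep k₀ s le_rfl hk (Frame.refl _ _) h0 with ⟨h, hq⟩ | ⟨hlt, h, s₁, t₁, he, ht, hi⟩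
    · exact ⟨s, _, .loopDone h, by omega, hq⟩
    · obtain ⟨s₂, t₂, he2, ht2, hq⟩ := ih (s := s₁) (k₀ + 1) hlt hi
        (fun k s' h1 h2 hf hI => hstep k s' (by omega) h2 (he.frame.trans hf) hI) (by omega)
      refine ⟨s₂, _, .loopStep h he he2, ?_, hq⟩
      rw [Finset.sum_eq_sum_Ico_succ_bot hlt]
      omega

/-- Count register `i` up until it reaches the value of `hi`, running `p` each time. -/
def forTo (i : ℕ) (hi : Expr) (p : Program) : Program :=
  .loop (.op .lt (.reg i) hi) (.seq p (.assign i (.op .add (.reg i) (.const 1))))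

theorem Tri.forTo {i : ℕ} {e : Expr} {p : Program} {s : State b} {lo hi : ℕ} {T : ℕ → ℕ}
    {I : ℕ → State b → Prop} (hw : ¬ p.wr i) (hhi : hi < 2 ^ b) (hle : lo ≤ hi)
    (hlo : s.reg i = BitVec.ofNat b lo) (h0 : I lo s)
    (he : ∀ k s', lo ≤ k → k ≤ hi → Frame (WordRAM.forTo i e p) s s' → I k s' →
      e.eval s' = BitVec.ofNat b hi)
    (hp : ∀ k s', lo ≤ k → k < hi → Frame (WordRAM.forTo i e p) s s' →
      s'.reg i = BitVec.ofNat b k → I k s' →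
      Tri p s' (T k) (fun s'' => I (k + 1) (s''.setReg i (BitVec.ofNat b (k + 1))))) :
    Tri (WordRAM.forTo i e p) s
      ((∑ k ∈ Finset.Ico lo hi, (T k + (e.cost + 7))) + (e.cost + 3))
      (fun s' => s'.reg i = BitVec.ofNat b hi ∧ I hi s') := by
  have key := Tri.loop (e := .op .lt (.reg i) e)
    (p := .seq p (.assign i (.op .add (.reg i) (.const 1)))) (s := s)
    (Q := fun s' => s'.reg i = BitVec.ofNat b hi ∧ I hi s')
    (fun k s' => s'.reg i = BitVec.ofNat b k ∧ I k s') (fun k => T k + 4) lo hi hle ⟨hlo, h0⟩ ?_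
  · refine key.mono ?_ (fun _ _ h => h)
    have : (Expr.op .lt (.reg i) e).cost + 1 = e.cost + 3 := by simp [Expr.cost]; omega
    rw [this]
    apply Nat.add_le_add_right
    apply Finset.sum_le_sum
    intro k _
    omega
  · rintro k s' hk1 hk2 hf ⟨hk, hI⟩
    have hev := he k s' hk1 hk2 hf hI
    have hval : (Expr.op .lt (.reg i) e).eval s' = if k < hi then 1 else 0 := by
      simp only [Expr.eval, Op.eval, hk, hev]
      simp only [ofNat_lt_of_lt (lt_of_le_of_lt hk2 hhi) hhi]
    rcases hk2.lt_or_eq with hlt | rfl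
    · right
      refine ⟨hlt, ?_, ?_⟩
      · rw [hval, if_pos hlt]
        exact one_ne_zero_word (by omega) hhi
      · refine (hp k s' hk1 hlt hf hk hI).seq' (T₂ := 4) ?_ le_rfl
        intro s'' hf' h''
        refine Tri.assign (by simp [Expr.cost]) ?_
        have : (Expr.op .add (.reg i) (.const 1)).eval s'' = BitVec.ofNat b (k + 1) := by
          simp only [Expr.eval, Op.eval, hf'.1 i hw, hk, BitVec.ofNat_add]
        rw [this]
        exact ⟨by simp [State.setReg], h''⟩
    · left
      exact ⟨by rw [hval, if_neg (lt_irrefl _)], hk, hI⟩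

theorem Tri.forTo_const {i : ℕ} {e : Expr} {p : Program} {s : State b} {lo hi : ℕ} {T T' : ℕ}
    {I : ℕ → State b → Prop} (hw : ¬ p.wr i) (hhi : hi < 2 ^ b) (hle : lo ≤ hi)
    (hlo : s.reg i = BitVec.ofNat b lo) (h0 : I lo s)
    (he : ∀ k s', lo ≤ k → k ≤ hi → Frame (WordRAM.forTo i e p) s s' → I k s' →
      e.eval s' = BitVec.ofNat b hi)
    (hp : ∀ k s', lo ≤ k → k < hi → Frame (WordRAM.forTo i e p) s s' →
      s'.reg i = BitVec.ofNat b k → I k s' →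
      Tri p s' T (fun s'' => I (k + 1) (s''.setReg i (BitVec.ofNat b (k + 1)))))
    (hT : (hi - lo) * (T + (e.cost + 7)) + (e.cost + 3) ≤ T') :
    Tri (WordRAM.forTo i e p) s T' (fun s' => s'.reg i = BitVec.ofNat b hi ∧ I hi s') := by
  refine (Tri.forTo (T := fun _ => T) hw hhi hle hlo h0 he hp).mono ?_ (fun _ _ h => h)
  simpa using hT

@[simp] theorem State.setReg_reg (s : State b) (r r' : ℕ) (x : BitVec b) :
    (s.setReg r x).reg r' = if r' = r then x else s.reg r' := by
  simp [State.setReg, Function.update_apply]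

@[simp] theorem State.setReg_arr (s : State b) (r : ℕ) (x : BitVec b) :
    (s.setReg r x).arr = s.arr := rfl

@[simp] theorem State.setArr_reg (s : State b) (a : ℕ) (i x : BitVec b) :
    (s.setArr a i x).reg = s.reg := rfl

@[simp] theorem State.setArr_arr (s : State b) (a a' : ℕ) (i x : BitVec b) :
    (s.setArr a i x).arr a' = if a' = a then Function.update (s.arr a) i x else s.arr a' := by
  simp only [State.setArr, Function.update_apply]

/-! ### Cubic matrix multiplication -/

/-- The schoolbook algorithm, with the counters in registers `1`, `2`, `3` and the accumulator in
register `4`. -/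
def schoolbook : Program :=
  .seq (.assign 1 (.const 0)) <| forTo 1 (.reg 0) <|
    .seq (.assign 2 (.const 0)) <| forTo 2 (.reg 0) <|
      .seq (.assign 4 (.const 0)) <| .seq (.assign 3 (.const 0)) <| .seq
        (forTo 3 (.reg 0) <| .assign 4 <| .op .add (.reg 4) <| .op .mul
          (.read 0 (.op .add (.op .mul (.reg 1) (.reg 0)) (.reg 3)))
          (.read 1 (.op .add (.op .mul (.reg 3) (.reg 0)) (.reg 2))))
        (.write 2 (.op .add (.op .mul (.reg 1) (.reg 0)) (.reg 2)) (.reg 4))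

/-- A matrix as a function of two natural numbers, zero outside of the index range. -/
def natEntry {n : ℕ} (A : Matrix (Fin n) (Fin n) ℕ) (i j : ℕ) : ℕ :=
  if h : i < n ∧ j < n then A ⟨i, h.1⟩ ⟨j, h.2⟩ else 0

theorem natEntry_coe {n : ℕ} (A : Matrix (Fin n) (Fin n) ℕ) (i j : Fin n) :
    natEntry A i j = A i j := by
  simp [natEntry]

theorem natEntry_of_lt {n : ℕ} (A : Matrix (Fin n) (Fin n) ℕ) {i j : ℕ} (hi : i < n) (hj : j < n) :
    natEntry A i j = A ⟨i, hi⟩ ⟨j, hj⟩ := by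
  simp [natEntry, hi, hj]

theorem natEntry_mul {n : ℕ} (A B : Matrix (Fin n) (Fin n) ℕ) {i j : ℕ} (hi : i < n) (hj : j < n) :
    natEntry (A * B) i j = ∑ k ∈ Finset.range n, natEntry A i k * natEntry B k j := by
  rw [natEntry_of_lt _ hi hj, Matrix.mul_apply, Finset.sum_range]
  refine Finset.sum_congr rfl fun k _ => ?_
  rw [natEntry_of_lt _ hi k.2, natEntry_of_lt _ k.2 hj]

theorem mul_add_lt_mul {n i j : ℕ} (hi : i < n) (hj : j < n) : i * n + j < n * n := by
  calc i * n + j < i * n + n := by omega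
    _ = (i + 1) * n := by ring
    _ ≤ n * n := Nat.mul_le_mul_right _ hi

theorem mul_add_inj {n i j i' j' : ℕ} (hj : j < n) (hj' : j' < n)
    (h : i * n + j = i' * n + j') : i = i' ∧ j = j' := by
  have hn : 0 < n := by omega
  have h1 : (j + n * i) / n = (j' + n * i') / n := by
    rw [show j + n * i = i * n + j by ring, h]; congr 1; ring
  rw [Nat.add_mul_div_left _ _ hn, Nat.add_mul_div_left _ _ hn, Nat.div_eq_of_lt hj,
    Nat.div_eq_of_lt hj'] at h1
  have : i = i' := by omega
  subst this
  exact ⟨rfl, by omega⟩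

theorem State.HoldsMatrix.eq_natEntry {s : State b} {a n : ℕ} {A : Matrix (Fin n) (Fin n) ℕ}
    (h : s.HoldsMatrix a A) {i j : ℕ} (hi : i < n) (hj : j < n) :
    s.arr a (BitVec.ofNat b (i * n + j)) = BitVec.ofNat b (natEntry A i j) := by
  rw [natEntry_of_lt _ hi hj]
  exact eq_ofNat_of_toNat_eq (h ⟨i, hi⟩ ⟨j, hj⟩)

theorem schoolbook_spec {n : ℕ} {A B : Matrix (Fin n) (Fin n) ℕ} (hn : n < 2 ^ b)
    (hnn : n * n ≤ 2 ^ b) (s : State b) (h0 : s.reg 0 = BitVec.ofNat b n)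
    (hA : s.HoldsMatrix 0 A) (hB : s.HoldsMatrix 1 B) :
    Tri schoolbook s (200 * (n + 1) ^ 3) (fun s' => ∀ i < n, ∀ j < n,
      s'.arr 2 (BitVec.ofNat b (i * n + j)) = BitVec.ofNat b (natEntry (A * B) i j)) := by
  unfold schoolbook
  refine Tri.assign_seq (T₂ := 99 * (n + 1) ^ 3) ?_ ?_
  swap
  · have := Nat.one_le_pow 3 (n + 1) (by omega)
    simp only [Expr.cost]; omega
  refine (Tri.forTo_const (lo := 0) (hi := n) (T := 60 * (n + 1) ^ 2)
    (I := fun k s' => ∀ i < k, ∀ j < n,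
      s'.arr 2 (BitVec.ofNat b (i * n + j)) = BitVec.ofNat b (natEntry (A * B) i j))
    ?_ hn (Nat.zero_le _) ?_ ?_ ?_ ?_ ?_).mono le_rfl (fun s' _ h => h.2)
  · simp [Program.wr, forTo]
  · simp [Expr.eval]
  · intro i hi; omega
  · intro k s' _ _ hf _
    have := hf.1 0 (by simp [Program.wr, forTo])
    simp [Expr.eval, this, h0]
  swap
  · simp only [Expr.cost, Nat.sub_zero]; nlinarith
  intro i s₁ _ hi hf₁ hri hI
  have hr₁ := hf₁.1 0 (by simp [Program.wr, forTo])
  have ha₁ := hf₁.2 0 (by simp [Program.wa, forTo])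
  have hb₁ := hf₁.2 1 (by simp [Program.wa, forTo])
  simp [h0] at hr₁ ha₁ hb₁
  refine Tri.assign_seq (T₂ := 55 * (n + 1) ^ 2) ?_ ?_
  swap
  · simp only [Expr.cost]; nlinarith
  refine (Tri.forTo_const (lo := 0) (hi := n) (T := 40 * (n + 1))
    (I := fun k s' => (∀ i' < i, ∀ j < n,
      s'.arr 2 (BitVec.ofNat b (i' * n + j)) = BitVec.ofNat b (natEntry (A * B) i' j)) ∧
      ∀ j < k, s'.arr 2 (BitVec.ofNat b (i * n + j)) = BitVec.ofNat b (natEntry (A * B) i j))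
    ?_ hn (Nat.zero_le _) ?_ ?_ ?_ ?_ ?_).mono le_rfl ?_
  · simp [Program.wr, forTo]
  · simp [Expr.eval]
  · exact ⟨fun i' hi' j hj => hI i' hi' j hj, fun j hj => by omega⟩
  · intro k s' _ _ hf _
    have := hf.1 0 (by simp [Program.wr, forTo])
    simp [Expr.eval, this, hr₁]
  rotate_left
  · simp only [Expr.cost, Nat.sub_zero]; nlinarith
  · rintro s' - ⟨-, h1, h2⟩ i' hi' j hj
    rcases Nat.lt_succ_iff_lt_or_eq.1 hi' with h | rfl
    · exact h1 i' h j hj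
    · exact h2 j hj
  intro j s₂ _ hj hf₂ hrj hJ
  have hr₂ := hf₂.1 0 (by simp [Program.wr, forTo])
  have hi₂ := hf₂.1 1 (by simp [Program.wr, forTo])
  have ha₂ := hf₂.2 0 (by simp [Program.wa, forTo])
  have hb₂ := hf₂.2 1 (by simp [Program.wa, forTo])
  simp [hr₁, ha₁, hb₁, hri] at hr₂ hi₂ ha₂ hb₂
  refine Tri.assign_seq (T₂ := 38 * (n + 1)) (Tri.assign_seq (T₂ := 36 * (n + 1)) ?_ ?_) ?_
  rotate_left
  · simp only [Expr.cost]; omega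
  · simp only [Expr.cost]; omega
  refine Tri.seq' (T₁ := 25 * (n + 1)) (T₂ := 8) (P := fun s' => s'.reg 4 =
    BitVec.ofNat b (∑ x ∈ Finset.range n, natEntry A i x * natEntry B x j)) ?_ ?_ (by omega)
  · refine (Tri.forTo_const (lo := 0) (hi := n) (T := 16)
      (I := fun k s' => s'.reg 4 =
        BitVec.ofNat b (∑ x ∈ Finset.range k, natEntry A i x * natEntry B x j))
      ?_ hn (Nat.zero_le _) ?_ ?_ ?_ ?_ ?_).mono le_rfl (fun s' _ h => h.2)
    · simp [Program.wr]
    · simp [Expr.eval]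
    · simp [Expr.eval]
    · intro k s' _ _ hf _
      have := hf.1 0 (by simp [Program.wr, forTo])
      simp [Expr.eval, this, hr₂]
    swap
    · simp only [Expr.cost, Nat.sub_zero]; omega
    intro k s₃ _ hk hf₃ hrk hK
    have hr₃ := hf₃.1 0 (by simp [Program.wr, forTo])
    have hi₃ := hf₃.1 1 (by simp [Program.wr, forTo])
    have hj₃ := hf₃.1 2 (by simp [Program.wr, forTo])
    have ha₃ := hf₃.2 0 (by simp [Program.wa, forTo])
    have hb₃ := hf₃.2 1 (by simp [Program.wa, forTo])
    simp [hr₂, hi₂, ha₂, hb₂, hrj] at hr₃ hi₃ hj₃ ha₃ hb₃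
    refine Tri.assign (by simp [Expr.cost]) ?_
    simp only [Expr.eval, Op.eval, State.setReg_reg, hr₃, hi₃, hj₃, ha₃, hb₃, hrk, hK,
      ← BitVec.ofNat_add, ← BitVec.ofNat_mul, hA.eq_natEntry hi hk, hB.eq_natEntry hk hj,
      Finset.sum_range_succ, Nat.reduceEqDiff, if_true, if_false]
  · intro s₃ hf₃ h₃
    have hr₃ := hf₃.1 0 (by simp [Program.wr, forTo])
    have hi₃ := hf₃.1 1 (by simp [Program.wr, forTo])
    have hj₃ := hf₃.1 2 (by simp [Program.wr, forTo])
    have hc₃ := hf₃.2 2 (by simp [Program.wa, forTo])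
    simp [hr₂, hi₂, hrj] at hr₃ hi₃ hj₃ hc₃
    refine Tri.write (by simp [Expr.cost]) ?_
    simp only [Expr.eval, Op.eval, hr₃, hi₃, hj₃, hc₃, h₃, ← BitVec.ofNat_add, ← BitVec.ofNat_mul,
      State.setReg_arr, State.setArr_arr, if_true]
    have hlt : ∀ i' < n, ∀ j' < n, i' * n + j' < 2 ^ b := fun i' hi' j' hj' =>
      (mul_add_lt_mul hi' hj').trans_le hnn
    refine ⟨fun i' hi' j' hj' => ?_, fun j' hj' => ?_⟩
    · rw [Function.update_of_ne, hJ.1 i' hi' j' hj']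
      rw [Ne, ofNat_inj_of_lt (hlt _ (by omega) _ hj') (hlt _ hi _ hj)]
      intro h
      have := (mul_add_inj hj' hj h).1
      omega
    · rcases Nat.lt_succ_iff_lt_or_eq.1 hj' with h | rfl
      · rw [Function.update_of_ne, hJ.2 j' h]
        rw [Ne, ofNat_inj_of_lt (hlt _ hi _ (by omega)) (hlt _ hi _ hj)]
        omega
      · rw [Function.update_self, natEntry_mul _ _ hi hj]

/-- The schoolbook algorithm shows that the set of exponents is not empty. -/
theorem matMulInTime_three : MatMulInTime 3 := by
  refine ⟨schoolbook, 4, 200, fun n N b A B hN hn hA hB hb s h0 h1 h2 => ?_⟩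
  have hNN : N * N * 4 ≤ N ^ 4 := by
    calc N * N * 4 ≤ N * N * (N * N) := Nat.mul_le_mul_left _ (Nat.mul_le_mul hN hN)
      _ = N ^ 4 := by ring
  have hnn : n * n ≤ N * N := Nat.mul_le_mul hn hn
  have hn' : n < 2 ^ b := by nlinarith
  obtain ⟨s', t, he, ht, hQ⟩ := schoolbook_spec (A := A) (B := B) hn' (by omega) s
    (eq_ofNat_of_toNat_eq h0) h1 h2
  refine ⟨s', t, he, fun i j => ?_, ?_⟩
  · rw [hQ i i.2 j j.2, natEntry_coe, BitVec.toNat_ofNat, Nat.mod_eq_of_lt]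
    have : (A * B) i j ≤ n * (N * N) := by
      rw [Matrix.mul_apply]
      refine (Finset.sum_le_card_nsmul _ _ (N * N) fun k _ => Nat.mul_le_mul (hA i k) (hB k j)).trans ?_
      simp
    have h3 : n * (N * N) ≤ N * (N * N) := Nat.mul_le_mul_right _ hn
    have h4 : N * (N * N) * 2 ≤ N ^ 4 := by
      calc N * (N * N) * 2 ≤ N * (N * N) * N := Nat.mul_le_mul_left _ hN
        _ = N ^ 4 := by ring
    have h5 : 0 < N * (N * N) := by positivity
    omega
  · have : ((200 * (n + 1) ^ 3 : ℕ) : ℝ) = 200 * ((n : ℝ) + 1) ^ (3 : ℝ) := by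
      push_cast
      norm_cast
    rw [← this]
    exact_mod_cast ht

/-! ### The exponent of matrix multiplication is at least two -/

/-- A program that runs for `t` steps changes at most `t` cells of an array. -/
theorem Exec.card_changed_le {p : Program} {s s' : State b} {t : ℕ} (h : Exec p s s' t)
    (a : ℕ) : ∃ F : Finset (BitVec b), F.card ≤ t ∧ ∀ x ∉ F, s'.arr a x = s.arr a x := by
  induction h with
  | skip s => exact ⟨∅, by simp, fun _ _ => rfl⟩
  | assign s r e => exact ⟨∅, by simp, fun _ _ => rfl⟩
  | write s a' i e =>
    refine ⟨{i.eval s}, by simp, fun x hx => ?_⟩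
    rw [State.setArr_arr]
    split_ifs with h
    · subst h
      exact Function.update_of_ne (by simpa using hx) _ _
    · rfl
  | seq _ _ h1 h2 =>
    obtain ⟨F, hF, h1⟩ := h1
    obtain ⟨F', hF', h2⟩ := h2
    refine ⟨F ∪ F', (Finset.card_union_le _ _).trans (by omega), fun x hx => ?_⟩
    simp only [Finset.mem_union, not_or] at hx
    rw [h2 x hx.2, h1 x hx.1]
  | condTrue _ _ h => obtain ⟨F, hF, h⟩ := h; exact ⟨F, by omega, h⟩
  | condFalse _ _ h => obtain ⟨F, hF, h⟩ := h; exact ⟨F, by omega, h⟩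
  | loopDone _ => exact ⟨∅, by simp, fun _ _ => rfl⟩
  | loopStep _ _ _ h1 h2 =>
    obtain ⟨F, hF, h1⟩ := h1
    obtain ⟨F', hF', h2⟩ := h2
    refine ⟨F ∪ F', (Finset.card_union_le _ _).trans (by omega), fun x hx => ?_⟩
    simp only [Finset.mem_union, not_or] at hx
    rw [h2 x hx.2, h1 x hx.1]

/-- All `n ^ 2` cells of the output may hold a wrong value at the start, hence must be written. -/
theorem two_le_of_matMulInTime {τ : ℝ} (h : MatMulInTime τ) : 2 ≤ τ := by
  obtain ⟨P, κ, C, h⟩ := h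
  have key : ∀ n : ℕ, 2 ≤ n → ((n : ℝ) + 1) ^ (2 - τ) ≤ 4 * C := by
    intro n hn
    set b := n * (κ + 2) with hb
    have hnb : n ^ (κ + 2) ≤ 2 ^ b := by
      rw [hb, pow_mul]; exact Nat.pow_le_pow_left Nat.lt_two_pow_self.le _
    have hnk : n ^ κ ≤ 2 ^ b := (Nat.pow_le_pow_right (by omega) (by omega)).trans hnb
    have hnn : n * n ≤ 2 ^ b := by
      refine le_trans ?_ hnb
      rw [← sq]; exact Nat.pow_le_pow_right (by omega) (by omega)
    have hn1 : n < 2 ^ b := by nlinarith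
    let s : State b := ⟨fun _ => BitVec.ofNat b n, fun a _ => if a = 2 then 1 else 0⟩
    obtain ⟨s', t, he, hs', ht⟩ := h n n b 0 0 hn le_rfl (by simp) (by simp) hnk s
      (by simp [s, Nat.mod_eq_of_lt hn1]) (by intro i j; simp [s]) (by intro i j; simp [s])
    obtain ⟨F, hF, hF'⟩ := he.card_changed_le 2
    have hcard : n * n ≤ F.card := by
      have hmap : ∀ q ∈ (Finset.range (n * n)), BitVec.ofNat b q ∈ F := by
        intro q hq
        by_contra hqF
        have h1 := hF' _ hqF
        have hq' := Finset.mem_range.1 hq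
        have hn0 : 0 < n := by omega
        have h2 := hs' ⟨q / n, Nat.div_lt_of_lt_mul hq'⟩ ⟨q % n, Nat.mod_lt _ hn0⟩
        simp only [Nat.div_add_mod', mul_zero, Matrix.zero_apply] at h2
        rw [h1] at h2
        have h3 := eq_ofNat_of_toNat_eq h2
        exact one_ne_zero_word hn0 hn1 (by simpa [s] using h3)
      have := Finset.card_le_card_of_injOn _ hmap (by
        intro x hx y hy hxy
        simp only [Finset.coe_range, Set.mem_Iio] at hx hy
        exact (ofNat_inj_of_lt (by omega) (by omega)).1 hxy)
      simpa using this
    have h1 : ((n : ℝ) * n) ≤ C * ((n : ℝ) + 1) ^ τ := by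
      refine le_trans ?_ ht
      exact_mod_cast hcard.trans hF
    have hpos : (0 : ℝ) < (n : ℝ) + 1 := by positivity
    have hn' : (2 : ℝ) ≤ n := by exact_mod_cast hn
    rw [Real.rpow_sub hpos, div_le_iff₀ (Real.rpow_pos_of_pos hpos _)]
    have : ((n : ℝ) + 1) ^ (2 : ℝ) = ((n : ℝ) + 1) ^ (2 : ℕ) := by norm_cast
    rw [this]
    nlinarith
  by_contra hlt
  push Not at hlt
  have htend : Filter.Tendsto (fun n : ℕ => ((n : ℝ) + 1) ^ (2 - τ)) Filter.atTop Filter.atTop :=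
    (tendsto_rpow_atTop (by linarith)).comp
      (Filter.tendsto_atTop_add_const_right _ _ tendsto_natCast_atTop_atTop)
  obtain ⟨n, hn, hn2⟩ := ((htend.eventually_gt_atTop (4 * C)).and
    (Filter.eventually_ge_atTop 2)).exists
  exact absurd (key n hn2) (not_le.2 hn)

/-! ### Running a program with a bound on its time -/

/-- The expression with all registers and arrays renamed, to make room for others. -/
def Expr.shift : Expr → Expr
  | .const c => .const c
  | .reg r => .reg (r + 100)
  | .read a i => .read (a + 100) i.shift
  | .op o x y => .op o x.shift y.shift

/-- The program `p`, working in registers and arrays from `100` on.  Register `99` is a clock: every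
round of a loop takes one from it, and no round is begun when it is `0`.  The guard of a loop uses
that `x < y` holds for `x, y ∈ {0, 1}` only if `x = 0` and `y = 1`. -/
def Program.clocked : Program → Program
  | .skip => .skip
  | .assign r e => .assign (r + 100) e.shift
  | .write a i e => .write (a + 100) i.shift e.shift
  | .seq p q => .seq p.clocked q.clocked
  | .cond e p q => .cond e.shift p.clocked q.clocked
  | .loop e p => .loop
      (.op .lt (.op .eq e.shift (.const 0)) (.op .lt (.const 0) (.reg 99)))
      (.seq (.assign 99 (.op .sub (.reg 99) (.const 1))) p.clocked)

/-- The part of the memory in which a clocked program works. -/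
def State.upper (s : State b) : State b := ⟨fun r => s.reg (r + 100), fun a => s.arr (a + 100)⟩

/-- The clock. -/
def State.clock (s : State b) : ℕ := (s.reg 99).toNat

theorem Expr.shift_eval (e : Expr) (s : State b) : e.shift.eval s = e.eval s.upper := by
  induction e with
  | const c => rfl
  | reg r => rfl
  | read a i ih => simp [Expr.shift, Expr.eval, ih, State.upper]
  | op o x y hx hy => simp [Expr.shift, Expr.eval, hx, hy]

theorem State.setReg_upper (s : State b) (r : ℕ) (x : BitVec b) :
    (s.setReg (r + 100) x).upper = s.upper.setReg r x := by
  simp only [State.upper, State.setReg, State.mk.injEq, and_true]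
  funext r'
  simp [Function.update_apply]

theorem State.setArr_upper (s : State b) (a : ℕ) (i x : BitVec b) :
    (s.setArr (a + 100) i x).upper = s.upper.setArr a i x := by
  simp only [State.upper, State.setArr, State.mk.injEq, true_and]
  funext a'
  simp [Function.update_apply]

theorem State.setReg_clock (s : State b) (r : ℕ) (x : BitVec b) :
    (s.setReg (r + 100) x).clock = s.clock := by
  simp only [State.clock, State.setReg_reg]
  rw [if_neg (by omega)]

theorem clocked_guard (e : Expr) (s : State b) :
    (Expr.op .lt (.op .eq e.shift (.const 0)) (.op .lt (.const 0) (.reg 99))).eval s =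
      if e.eval s.upper ≠ 0 ∧ s.clock ≠ 0 then 1 else 0 := by
  have h0 : (0#b < s.reg 99) ↔ s.clock ≠ 0 := by
    rw [BitVec.lt_def, State.clock]
    simp [Nat.pos_iff_ne_zero]
  simp only [Expr.eval, Op.eval, Expr.shift_eval, h0]
  by_cases h1 : e.eval s.upper = 0#b <;> by_cases h2 : s.clock = 0 <;>
    simp [h1, h2]

/-- A clocked program always halts, within a time proportional to the ticks of the clock.  If the
clock has not run out at the end, the program has done what the original one does; the clock cannot
run out if the original program needs less time. -/
theorem Program.clocked_spec (p : Program) : ∃ a : ℕ, ∀ {b : ℕ}, 0 < b → ∀ s : State b,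
    ∃ s' t, Exec p.clocked s s' t ∧ s'.clock ≤ s.clock ∧ t + a * s'.clock ≤ a + a * s.clock ∧
      ∀ s₁ t₁, Exec p s.upper s₁ t₁ →
        (s'.clock ≠ 0 → s'.upper = s₁) ∧ s.clock ≤ s'.clock + t₁ := by
  induction p with
  | skip =>
    refine ⟨1, fun _ s => ⟨s, 1, .skip s, le_rfl, by omega, fun s₁ t₁ h => ?_⟩⟩
    cases h
    exact ⟨fun _ => rfl, by omega⟩
  | assign r e =>
    refine ⟨e.shift.cost + 1, fun _ s => ⟨_, _, .assign s _ _, ?_, ?_, fun s₁ t₁ h => ?_⟩⟩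
    · rw [State.setReg_clock]
    · rw [State.setReg_clock]
    · cases h
      refine ⟨fun _ => ?_, ?_⟩
      · rw [State.setReg_upper, Expr.shift_eval]
      · rw [State.setReg_clock]; omega
  | write a i e =>
    refine ⟨i.shift.cost + e.shift.cost + 1,
      fun _ s => ⟨_, _, .write s _ _ _, le_rfl, le_rfl, fun s₁ t₁ h => ?_⟩⟩
    cases h
    refine ⟨fun _ => ?_, ?_⟩
    · rw [State.setArr_upper, Expr.shift_eval, Expr.shift_eval]
    · exact Nat.le_add_right _ _
  | seq p q hp hq =>
    obtain ⟨a, hp⟩ := hp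
    obtain ⟨c, hq⟩ := hq
    refine ⟨a + c, fun hb s => ?_⟩
    obtain ⟨s', t, he, hc, ht, hs⟩ := hp hb s
    obtain ⟨s'', t', he', hc', ht', hs'⟩ := hq hb s'
    refine ⟨s'', t + t', .seq he he', hc'.trans hc, ?_, fun s₁ t₁ h => ?_⟩
    · nlinarith [Nat.mul_le_mul_left a hc', Nat.mul_le_mul_left c hc]
    · cases h with
      | @seq _ _ _ s₂ _ t₂ t₃ h1 h2 =>
        obtain ⟨h3, h4⟩ := hs _ _ h1
        by_cases h0 : s'.clock = 0
        · exact ⟨fun h => absurd h (by omega), by omega⟩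
        · rw [← h3 h0] at h2
          obtain ⟨h5, h6⟩ := hs' _ _ h2
          exact ⟨h5, by omega⟩
  | cond e p q hp hq =>
    obtain ⟨a, hp⟩ := hp
    obtain ⟨c, hq⟩ := hq
    refine ⟨a + c + (e.shift.cost + 1), fun hb s => ?_⟩
    by_cases h0 : e.eval s.upper = 0
    · obtain ⟨s', t, he, hc, ht, hs⟩ := hq hb s
      refine ⟨s', _, .condFalse (by rwa [Expr.shift_eval]) he, hc, ?_, fun s₁ t₁ h => ?_⟩
      · nlinarith [Nat.mul_le_mul_left a hc, Nat.mul_le_mul_left (e.shift.cost + 1) hc]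
      · cases h with
        | condTrue h1 => exact absurd h0 h1
        | condFalse _ h2 => exact ⟨(hs _ _ h2).1, by have := (hs _ _ h2).2; omega⟩
    · obtain ⟨s', t, he, hc, ht, hs⟩ := hp hb s
      refine ⟨s', _, .condTrue (by rwa [Expr.shift_eval]) he, hc, ?_, fun s₁ t₁ h => ?_⟩
      · nlinarith [Nat.mul_le_mul_left c hc, Nat.mul_le_mul_left (e.shift.cost + 1) hc]
      · cases h with
        | condTrue _ h2 => exact ⟨(hs _ _ h2).1, by have := (hs _ _ h2).2; omega⟩
        | condFalse h1 => exact absurd h1 h0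
  | loop e p hp =>
    obtain ⟨a, hp⟩ := hp
    set g := (Expr.op .lt (.op .eq e.shift (.const 0)) (.op .lt (.const 0) (.reg 99))).cost with hg
    refine ⟨a + (g + 5), fun {b} hb s => ?_⟩
    obtain ⟨n, hn⟩ : ∃ n, s.clock = n := ⟨_, rfl⟩
    induction n using Nat.strong_induction_on generalizing s with
    | _ n ih =>
      by_cases hgd : e.eval s.upper ≠ 0 ∧ s.clock ≠ 0
      · have hev := clocked_guard e s
        rw [if_pos hgd] at hev
        have hev' := hev ▸ one_ne_zero_word one_pos (Nat.one_lt_two_pow hb.ne')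
        set s₀ := s.setReg 99 ((Expr.op .sub (.reg 99) (.const 1)).eval s) with hs₀
        have hu : s₀.upper = s.upper := by
          rw [hs₀, State.upper, State.upper, State.mk.injEq]
          refine ⟨funext fun r => ?_, rfl⟩
          rw [State.setReg_reg, if_neg (by omega)]
        have hc₀ : s₀.clock + 1 = s.clock := by
          have h1 : s₀.clock = (s.reg 99 - 1).toNat := by
            simp [hs₀, State.clock, Expr.eval, Op.eval]
          have h2 := hgd.2
          rw [h1]
          unfold State.clock at h2 ⊢
          have h3 : (1 : BitVec b) ≤ s.reg 99 := by
            rw [BitVec.le_def]; simp [Nat.mod_eq_of_lt (Nat.one_lt_two_pow hb.ne')]; omega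
          rw [BitVec.toNat_sub_of_le h3]
          simp [Nat.mod_eq_of_lt (Nat.one_lt_two_pow hb.ne')]
          omega
        obtain ⟨s', t, he, hc, ht, hs⟩ := hp hb s₀
        obtain ⟨s'', t', he', hc', ht', hs'⟩ := ih s'.clock (by omega) s' rfl
        refine ⟨s'', _, .loopStep hev' (.seq (.assign s _ _) he) he', by omega, ?_,
          fun s₁ t₁ h => ?_⟩
        · rw [← hg]
          have h1 : (Expr.op .sub (.reg 99) (.const 1)).cost + 1 = 4 := rfl
          rw [h1, ← hc₀]
          nlinarith [Nat.mul_le_mul_left (g + 5) hc]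
        · cases h with
          | loopDone h0 => exact absurd h0 hgd.1
          | @loopStep _ _ _ s₂ _ t₂ t₃ h0 h1 h2 =>
            rw [← hu] at h1
            obtain ⟨h3, h4⟩ := hs _ _ h1
            by_cases h0 : s'.clock = 0
            · exact ⟨fun h => absurd h (by omega), by omega⟩
            · rw [← h3 h0] at h2
              obtain ⟨h5, h6⟩ := hs' _ _ h2
              exact ⟨h5, by omega⟩
      · have hev := clocked_guard e s
        rw [if_neg hgd] at hev
        refine ⟨s, _, .loopDone hev, le_rfl, by omega, fun s₁ t₁ h => ?_⟩
        by_cases h0 : s.clock = 0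
        · exact ⟨fun h => absurd h0 h, by omega⟩
        · have h2 : e.eval s.upper = 0 := by
            by_contra h1; exact hgd ⟨h1, h0⟩
          cases h with
          | loopDone _ => exact ⟨fun _ => rfl, by omega⟩
          | loopStep h1 => exact absurd h2 h1

theorem Program.clocked_wr (p : Program) {r : ℕ} (h : p.clocked.wr r) : 99 ≤ r := by
  induction p with
  | skip => exact h.elim
  | assign r' e => have : r = r' + 100 := h; omega
  | write a i e => exact h.elim
  | seq p q hp hq => exact h.elim hp hq
  | cond e p q hp hq => exact h.elim hp hq
  | loop e p hp =>
    rcases h with h | h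
    · have : r = 99 := h; omega
    · exact hp h

theorem Program.clocked_wa (p : Program) {a : ℕ} (h : p.clocked.wa a) : 100 ≤ a := by
  induction p with
  | skip => exact h.elim
  | assign r' e => exact h.elim
  | write a' i e => have : a = a' + 100 := h; omega
  | seq p q hp hq => exact h.elim hp hq
  | cond e p q hp hq => exact h.elim hp hq
  | loop e p hp =>
    rcases h with h | h
    · exact h.elim
    · exact hp h

/-! ### Enumerating walks in a graph given by its sorted list of arcs -/

/-- A directed multigraph with `S` vertices and `S` arcs, in compressed form: the arcs that leave
the vertex `v` are those from `off v` to `off (v + 1) - 1`; arc `j` ends in `tgt j` and has the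
weight `wt j`.  The vertices have labels. -/
structure Csr where
  S : ℕ
  off : ℕ → ℕ
  tgt : ℕ → ℕ
  wt : ℕ → ℕ
  lab : ℕ → ℕ

/-- The out-degree. -/
def Csr.deg (g : Csr) (v : ℕ) : ℕ := g.off (v + 1) - g.off v

/-- The offsets are consistent, and the degree of the vertex `v` is at most `S / (v + 1)`, as it is
when the vertices are sorted by decreasing degree. -/
structure Csr.Valid (g : Csr) : Prop where
  off_zero : g.off 0 = 0
  off_le : ∀ v < g.S, g.off v ≤ g.off (v + 1)
  off_last : g.off g.S = g.S
  tgt_lt : ∀ j < g.S, g.tgt j < g.S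
  deg_mul_le : ∀ v < g.S, g.deg v * (v + 1) ≤ g.S

theorem Csr.Valid.off_mono {g : Csr} (hg : g.Valid) {u v : ℕ} (huv : u ≤ v) (hv : v ≤ g.S) :
    g.off u ≤ g.off v := by
  induction v, huv using Nat.le_induction with
  | base => exact le_rfl
  | succ v _ ih => exact (ih (by omega)).trans (hg.off_le v (by omega))

theorem Csr.Valid.off_le_S {g : Csr} (hg : g.Valid) {v : ℕ} (hv : v ≤ g.S) : g.off v ≤ g.S :=
  (hg.off_mono hv le_rfl).trans_eq hg.off_last

/-- A graph together with the values of the registers `2` to `11`, which hold its size and the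
parameters of the algorithm. -/
structure Env where
  g : Csr
  ρ : ℕ → ℕ

/-- The memory holds the graph (offsets, targets, weights and labels in the arrays `4` to `7`) and
the parameters. -/
structure Env.HeldBy (E : Env) (s : State b) : Prop where
  reg : ∀ r, 2 ≤ r → r ≤ 11 → s.reg r = BitVec.ofNat b (E.ρ r)
  off : ∀ v ≤ E.g.S, s.arr 4 (BitVec.ofNat b v) = BitVec.ofNat b (E.g.off v)
  tgt : ∀ j < E.g.S, s.arr 5 (BitVec.ofNat b j) = BitVec.ofNat b (E.g.tgt j)
  wt : ∀ j < E.g.S, s.arr 6 (BitVec.ofNat b j) = BitVec.ofNat b (E.g.wt j)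
  lab : ∀ v < E.g.S, s.arr 7 (BitVec.ofNat b v) = BitVec.ofNat b (E.g.lab v)

theorem Env.HeldBy.congr {E : Env} {s s' : State b} (h : E.HeldBy s)
    (hr : ∀ r, 2 ≤ r → r ≤ 11 → s'.reg r = s.reg r)
    (ha : ∀ a, 4 ≤ a → a ≤ 7 → s'.arr a = s.arr a) : E.HeldBy s' where
  reg r h1 h2 := by rw [hr r h1 h2, h.reg r h1 h2]
  off v hv := by rw [ha 4 (by omega) (by omega), h.off v hv]
  tgt v hv := by rw [ha 5 (by omega) (by omega), h.tgt v hv]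
  wt v hv := by rw [ha 6 (by omega) (by omega), h.wt v hv]
  lab v hv := by rw [ha 7 (by omega) (by omega), h.lab v hv]

theorem Env.HeldBy.frame {E : Env} {s s' : State b} {p : Program} (h : E.HeldBy s)
    (hf : Frame p s s') (hr : ∀ r, p.wr r → 12 ≤ r) (ha : ∀ a, p.wa a → 8 ≤ a) : E.HeldBy s' :=
  h.congr (fun r _ h2 => hf.1 r fun h' => by have := hr r h'; omega)
    (fun a _ h2 => hf.2 a fun h' => by have := ha a h'; omega)

theorem Env.HeldBy.setReg {E : Env} {s : State b} (h : E.HeldBy s) {r : ℕ} (hr : 12 ≤ r)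
    (x : BitVec b) : E.HeldBy (s.setReg r x) :=
  h.congr (fun r' _ _ => by rw [State.setReg_reg, if_neg (by omega)]) (fun _ _ _ => rfl)

/-- The words are long enough for the graph, and the parameters are at most its size. -/
structure Env.Fits (E : Env) (b : ℕ) : Prop where
  S_lt : E.g.S + 1 < 2 ^ b
  lab_lt : ∀ v < E.g.S, E.g.lab v < 2 ^ b

/-- A constraint on a vertex: it lies in the interval from the value of register `lo` to that of
register `hi`, the latter excluded, and it has the label `lab`. -/
structure Con where
  lo : ℕ
  hi : ℕ
  lab : ℕ

/-- The vertex `v` satisfies the constraint `c`. -/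
def Env.Ok (E : Env) (c : Con) (v : ℕ) : Prop :=
  E.ρ c.lo ≤ v ∧ v < E.ρ c.hi ∧ E.g.lab v = c.lab

instance (E : Env) (c : Con) (v : ℕ) : Decidable (E.Ok c v) :=
  inferInstanceAs (Decidable (_ ∧ _ ∧ _))

/-- The constraint mentions parameter registers with sensible values. -/
structure Con.Fits (c : Con) (E : Env) (b : ℕ) : Prop where
  lo : 2 ≤ c.lo ∧ c.lo ≤ 11
  hi : 2 ≤ c.hi ∧ c.hi ≤ 11
  le : E.ρ c.lo ≤ E.ρ c.hi
  le_S : E.ρ c.hi ≤ E.g.S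
  lab : c.lab < 2 ^ b

/-- Run `p` if the vertex in register `r` satisfies the constraint `c`. -/
def ifOk (c : Con) (r : ℕ) (p : Program) : Program :=
  .cond (.op .lt (.reg r) (.reg c.lo)) .skip <| .cond (.op .lt (.reg r) (.reg c.hi))
    (.cond (.op .eq (.read 7 (.reg r)) (.const c.lab)) p .skip) .skip

theorem lt_eval_ne_zero {x y : ℕ} (hx : x < 2 ^ b) (hy : y < 2 ^ b) {e f : Expr} {s : State b}
    (he : e.eval s = BitVec.ofNat b x) (hf : f.eval s = BitVec.ofNat b y) :
    (Expr.op .lt e f).eval s ≠ 0 ↔ x < y := by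
  simp only [Expr.eval, Op.eval, he, hf, ofNat_lt_of_lt hx hy]
  split_ifs with h
  · exact ⟨fun _ => h, fun _ => one_ne_zero_word (by omega) hy⟩
  · exact ⟨fun h' => absurd rfl h', fun h' => absurd h' h⟩

theorem eq_eval_ne_zero {x y : ℕ} (hb : 1 < 2 ^ b) (hx : x < 2 ^ b) (hy : y < 2 ^ b) {e f : Expr}
    {s : State b} (he : e.eval s = BitVec.ofNat b x) (hf : f.eval s = BitVec.ofNat b y) :
    (Expr.op .eq e f).eval s ≠ 0 ↔ x = y := by
  simp only [Expr.eval, Op.eval, he, hf, ofNat_inj_of_lt hx hy]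
  split_ifs with h
  · exact ⟨fun _ => h, fun _ => one_ne_zero_word one_pos hb⟩
  · exact ⟨fun h' => absurd rfl h', fun h' => absurd h' h⟩

theorem Tri.ifOk {E : Env} {c : Con} {r v : ℕ} {p : Program} {s : State b} {T : ℕ}
    {Q : State b → Prop} (hE : E.HeldBy s) (hF : E.Fits b) (hc : c.Fits E b)
    (hr : s.reg r = BitVec.ofNat b v) (hv : v < E.g.S) (hT : 1 ≤ T)
    (hp : E.Ok c v → Tri p s T Q) (hq : ¬ E.Ok c v → Q s) :
    Tri (WordRAM.ifOk c r p) s (T + 13) Q := by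
  have hS := hF.S_lt
  have h1 := hc.le
  have h2 := hc.le_S
  have e1 := hE.reg c.lo hc.lo.1 hc.lo.2
  have e2 := hE.reg c.hi hc.hi.1 hc.hi.2
  have i1 := lt_eval_ne_zero (e := .reg r) (f := .reg c.lo) (x := v) (y := E.ρ c.lo)
    (by omega) (by omega) hr e1
  have i2 := lt_eval_ne_zero (e := .reg r) (f := .reg c.hi) (x := v) (y := E.ρ c.hi)
    (by omega) (by omega) hr e2
  have i3 := eq_eval_ne_zero (e := .read 7 (.reg r)) (f := .const c.lab) (x := E.g.lab v)
    (s := s) (by omega) (hF.lab_lt v hv) hc.lab (by simp [Expr.eval, hr, hE.lab v hv]) rfl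
  refine Tri.cond' (T + 9) (fun h => Tri.skip (by omega) (hq fun h' => ?_)) (fun h => ?_)
    (by simp [Expr.cost]; omega)
  · have := i1.1 h; have := h'.1; omega
  have n1 : ¬ v < E.ρ c.lo := fun h' => i1.2 h' h
  refine Tri.cond' (T + 5) (fun h2 => ?_)
    (fun h2 => Tri.skip (by omega) (hq fun h' => i2.2 h'.2.1 h2)) (by simp [Expr.cost]; omega)
  refine Tri.cond' T (fun h3 => ?_)
    (fun h3 => Tri.skip (by omega) (hq fun h' => i3.2 h'.2.2 h3)) (by simp [Expr.cost]; omega)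
  exact hp ⟨by omega, i2.1 h2, i3.1 h3⟩

/-- Run `body` for every walk that continues the current one, from its `d`-th vertex, through
vertices with the constraints `cs`.  The `d`-th vertex and the product of the first `d` weights are
in the registers `20 + 3 * d` and `21 + 3 * d`; the body finds the start of the walk in register
`20`, its end in register `16` and its weight in register `17`. -/
def extend (body : Program) : ℕ → List Con → Program
  | d, [] => .seq (.assign 16 (.reg (20 + 3 * d))) <|
      .seq (.assign 17 (.reg (21 + 3 * d))) body
  | d, c :: cs => .seq (.assign (22 + 3 * d) (.read 4 (.reg (20 + 3 * d)))) <|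
      forTo (22 + 3 * d) (.read 4 (.op .add (.reg (20 + 3 * d)) (.const 1))) <|
        .seq (.assign (23 + 3 * d) (.read 5 (.reg (22 + 3 * d)))) <|
          ifOk c (23 + 3 * d) <|
            .seq (.assign (24 + 3 * d)
              (.op .mul (.reg (21 + 3 * d)) (.read 6 (.reg (22 + 3 * d))))) <|
              extend body (d + 1) cs

/-- The ends and the weights (times `w`) of the walks from `v` through vertices with the constraints
`cs`. -/
def Env.walks (E : Env) : ℕ → ℕ → List Con → List (ℕ × ℕ)
  | v, w, [] => [(v, w)]
  | v, w, c :: cs => (List.range' (E.g.off v) (E.g.deg v)).flatMap fun j =>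
      if E.Ok c (E.g.tgt j) then E.walks (E.g.tgt j) (w * E.g.wt j) cs else []

/-- A bound for the time that `extend` needs from the vertex `v` on. -/
def Env.extendCost (E : Env) (T : ℕ) : ℕ → List Con → ℕ
  | _, [] => T + 4
  | v, c :: cs => (∑ j ∈ Finset.Ico (E.g.off v) (E.g.off (v + 1)),
      ((if E.Ok c (E.g.tgt j) then E.extendCost T (E.g.tgt j) cs else 0) + 33)) + 10

/-- The body of an enumeration changes no register but the total, and no array of the graph. -/
def IsBody (body : Program) : Prop :=
  (∀ r, body.wr r → r = 13) ∧ (∀ a, body.wa a → 8 ≤ a)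

theorem extend_wr {body : Program} (cs : List Con) (d : ℕ) {r : ℕ}
    (h : (extend body d cs).wr r) : body.wr r ∨ r = 16 ∨ r = 17 ∨ 22 + 3 * d ≤ r := by
  induction cs generalizing d with
  | nil =>
    simp only [extend, Program.wr] at h
    rcases h with h | h | h
    · exact Or.inr (Or.inl h)
    · exact Or.inr (Or.inr (Or.inl h))
    · exact Or.inl h
  | cons c cs ih =>
    simp only [extend, Program.wr, forTo, ifOk] at h
    rcases h with h | ((h | h | (h | h | h) | h) | h)
    all_goals first
      | exact h.elim
      | omega
      | (rcases h with h | h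
         · omega
         · exact (ih _ h).imp_right (by omega))

theorem extend_wa {body : Program} (cs : List Con) (d : ℕ) {a : ℕ}
    (h : (extend body d cs).wa a) : body.wa a := by
  induction cs generalizing d with
  | nil =>
    simp only [extend, Program.wa, false_or] at h
    exact h
  | cons c cs ih =>
    simp only [extend, Program.wa, forTo, ifOk, false_or, or_false] at h
    exact ih _ h

/-- The predicate `J l` on memories, to be read as "the walks in `l` have been dealt with", does not
depend on the working registers of the enumeration. -/
def Stable (J : List (ℕ × ℕ × ℕ) → State b → Prop) : Prop :=
  ∀ l s s', (∀ r ≤ 15, s'.reg r = s.reg r) → s'.arr = s.arr → J l s → J l s'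

theorem Stable.setReg {J : List (ℕ × ℕ × ℕ) → State b → Prop} (hJ : Stable J) {l : List (ℕ × ℕ × ℕ)}
    {s : State b} (h : J l s) {r : ℕ} (hr : 16 ≤ r) (x : BitVec b) : J l (s.setReg r x) :=
  hJ l s _ (fun r' _ => by rw [State.setReg_reg, if_neg (by omega)]) rfl h

/-- If the body maintains `J`, with the walk that it is run for appended to the list of walks, then
`extend` does so with all continuations of the current walk. -/
theorem extend_spec {E : Env} (hg : E.g.Valid) (hF : E.Fits b) {body : Program} (hB : IsBody body)
    {T : ℕ} {J : List (ℕ × ℕ × ℕ) → State b → Prop} (hJ : Stable J) {L : List (ℕ × ℕ × ℕ)} {x : ℕ}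
    (hbody : ∀ l p s, p ∈ L → E.HeldBy s → s.reg 20 = BitVec.ofNat b p.1 →
      s.reg 16 = BitVec.ofNat b p.2.1 → s.reg 17 = BitVec.ofNat b p.2.2 → J l s →
      Tri body s T (J (l ++ [p])))
    (cs : List Con) : ∀ (d v w : ℕ) (l : List (ℕ × ℕ × ℕ)) (s : State b),
    (∀ c ∈ cs, c.Fits E b) → (∀ q ∈ E.walks v w cs, (x, q) ∈ L) → v < E.g.S → E.HeldBy s →
    s.reg 20 = BitVec.ofNat b x → s.reg (20 + 3 * d) = BitVec.ofNat b v →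
    s.reg (21 + 3 * d) = BitVec.ofNat b w → J l s →
    Tri (extend body d cs) s (E.extendCost T v cs)
      (J (l ++ (E.walks v w cs).map (Prod.mk x))) := by
  induction cs with
  | nil =>
    intro d v w l s _ hL hv hE hx hrv hrw hl
    refine Tri.assign_seq (T₂ := T + 2) (Tri.assign_seq (T₂ := T) ?_ ?_) ?_
    · refine hbody l (x, v, w) _ (hL _ (by simp [Env.walks]))
        ((hE.setReg (by omega) _).setReg (by omega) _) ?_ ?_ ?_ ?_
      · simpa using hx
      · simpa [Expr.eval] using hrv
      · simp only [Expr.eval, State.setReg_reg, if_true]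
        rw [if_neg (by omega), hrw]
      · exact hJ.setReg (hJ.setReg hl (by omega) _) (by omega) _
    · simp only [Expr.cost]; omega
    · simp only [Expr.cost, Env.extendCost]; omega
  | cons c cs ih =>
    intro d v w l s hcs hL hv hE hx hrv hrw hl
    have hS := hF.S_lt
    have hoff1 := hg.off_le_S (v := v) (by omega)
    have hoff2 := hg.off_le_S (v := v + 1) (by omega)
    have hoff3 := hg.off_le v hv
    set f := fun j => if E.Ok c (E.g.tgt j) then E.walks (E.g.tgt j) (w * E.g.wt j) cs else []
      with hf
    have hwalks : E.walks v w (c :: cs) =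
        (List.range' (E.g.off v) (E.g.off (v + 1) - E.g.off v)).flatMap f := rfl
    simp only [extend]
    refine Tri.assign_seq (T₂ := (∑ j ∈ Finset.Ico (E.g.off v) (E.g.off (v + 1)),
      (((if E.Ok c (E.g.tgt j) then E.extendCost T (E.g.tgt j) cs else 0) + 22) +
        ((Expr.read 4 (.op .add (.reg (20 + 3 * d)) (.const 1))).cost + 7))) +
        ((Expr.read 4 (.op .add (.reg (20 + 3 * d)) (.const 1))).cost + 3)) ?_ ?_
    swap
    · simp only [Expr.cost, Env.extendCost]
      have : ∑ j ∈ Finset.Ico (E.g.off v) (E.g.off (v + 1)),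
          (((if E.Ok c (E.g.tgt j) then E.extendCost T (E.g.tgt j) cs else 0) + 22) +
            (1 + 1 + 1 + 1 + 7)) = ∑ j ∈ Finset.Ico (E.g.off v) (E.g.off (v + 1)),
          ((if E.Ok c (E.g.tgt j) then E.extendCost T (E.g.tgt j) cs else 0) + 33) :=
        Finset.sum_congr rfl fun _ _ => by omega
      omega
    set P := extend body d (c :: cs) with hP
    -- the frame of the loop is that of the whole program
    have hfr : ∀ {s₁ s₂ : State b}, Frame (forTo (22 + 3 * d)
        (.read 4 (.op .add (.reg (20 + 3 * d)) (.const 1)))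
        (.seq (.assign (23 + 3 * d) (.read 5 (.reg (22 + 3 * d)))) <|
          ifOk c (23 + 3 * d) <|
            .seq (.assign (24 + 3 * d)
              (.op .mul (.reg (21 + 3 * d)) (.read 6 (.reg (22 + 3 * d))))) <|
              extend body (d + 1) cs)) s₁ s₂ → Frame P s₁ s₂ := fun h =>
      h.mono (fun r hr => Or.inr hr) (fun a ha => Or.inr ha)
    have hwr : ∀ r, P.wr r → r = 13 ∨ r = 16 ∨ r = 17 ∨ 22 + 3 * d ≤ r :=
      fun r hr => (extend_wr _ d hr).imp_left (hB.1 r)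
    have hwa : ∀ a, P.wa a → 8 ≤ a := fun a ha => hB.2 a (extend_wa _ d ha)
    set s₀ := s.setReg (22 + 3 * d) ((Expr.read 4 (.reg (20 + 3 * d))).eval s) with hs₀
    have hE₀ : E.HeldBy s₀ := hE.setReg (by omega) _
    have hreg₀ : ∀ r < 22 + 3 * d, s₀.reg r = s.reg r := fun r hr => by
      rw [hs₀, State.setReg_reg, if_neg (by omega)]
    have hfacts : ∀ s₁, Frame P s₀ s₁ → E.HeldBy s₁ ∧ s₁.reg 20 = BitVec.ofNat b x ∧
        s₁.reg (20 + 3 * d) = BitVec.ofNat b v ∧ s₁.reg (21 + 3 * d) = BitVec.ofNat b w := by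
      intro s₁ h
      refine ⟨hE₀.frame h (fun r hr => by have := hwr r hr; omega) hwa, ?_, ?_, ?_⟩
      · rw [h.1 _ fun hr => by have := hwr _ hr; omega, hreg₀ _ (by omega), hx]
      · rw [h.1 _ fun hr => by have := hwr _ hr; omega, hreg₀ _ (by omega), hrv]
      · rw [h.1 _ fun hr => by have := hwr _ hr; omega, hreg₀ _ (by omega), hrw]
    refine (Tri.forTo (lo := E.g.off v) (hi := E.g.off (v + 1))
      (T := fun j => (if E.Ok c (E.g.tgt j) then E.extendCost T (E.g.tgt j) cs else 0) + 22)
      (I := fun j s' => J (l ++ ((List.range' (E.g.off v) (j - E.g.off v)).flatMap f).map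
        (Prod.mk x)) s') ?_ (by omega) hoff3 ?_ ?_ ?_ ?_).mono le_rfl
      (fun s' _ h => by rw [hwalks]; exact h.2)
    · simp only [Program.wr, ifOk, false_or, or_false]
      rintro (h | h | h)
      · omega
      · omega
      · have := (extend_wr _ _ h).imp_left (hB.1 _); omega
    · rw [hs₀, State.setReg_reg, if_pos rfl, Expr.eval, Expr.eval, hrv, hE.off v (by omega)]
    · simpa using hJ.setReg hl (by omega) _
    · intro k s₁ _ _ h _
      obtain ⟨h1, -, h2, -⟩ := hfacts s₁ (hfr h)
      simp only [Expr.eval, Op.eval, h2, ← BitVec.ofNat_add]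
      exact h1.off (v + 1) (by omega)
    · intro j s₁ hj1 hj2 h hrj hl₁
      obtain ⟨hE₁, hx₁, hv₁, hw₁⟩ := hfacts s₁ (hfr h)
      have htj := hg.tgt_lt j (by omega)
      have hrange : List.range' (E.g.off v) (j + 1 - E.g.off v) =
          List.range' (E.g.off v) (j - E.g.off v) ++ [j] := by
        rw [show j + 1 - E.g.off v = (j - E.g.off v) + 1 by omega, List.range'_1_concat,
          show E.g.off v + (j - E.g.off v) = j by omega]
      refine Tri.assign_seq (T₂ := ((if E.Ok c (E.g.tgt j) then E.extendCost T (E.g.tgt j) cs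
        else 0) + 6) + 13) ?_ (by simp only [Expr.cost]; omega)
      have hval : (Expr.read 5 (.reg (22 + 3 * d))).eval s₁ = BitVec.ofNat b (E.g.tgt j) := by
        rw [Expr.eval, Expr.eval, hrj, hE₁.tgt j (by omega)]
      rw [hval]
      have hE₂ := hE₁.setReg (r := 23 + 3 * d) (by omega) (BitVec.ofNat b (E.g.tgt j))
      have hl₂ := hJ.setReg hl₁ (r := 23 + 3 * d) (by omega) (BitVec.ofNat b (E.g.tgt j))
      refine Tri.ifOk hE₂ hF (hcs c (by simp)) (by rw [State.setReg_reg, if_pos rfl]) htj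
        (by omega) (fun hok => ?_) (fun hok => ?_)
      · rw [if_pos hok]
        refine Tri.assign_seq (T₂ := E.extendCost T (E.g.tgt j) cs) ?_
          (by simp only [Expr.cost]; omega)
        refine (ih (d + 1) (E.g.tgt j) (w * E.g.wt j) _ _ (fun c' hc' => hcs c' (by simp [hc'])) ?_
          htj (hE₂.setReg (by omega) _) ?_ ?_ ?_ (hJ.setReg hl₂ (by omega) _)).mono le_rfl ?_
        · intro q hq
          refine hL q ?_
          rw [hwalks, List.mem_flatMap]
          refine ⟨j, ?_, ?_⟩
          · rw [List.mem_range'_1]; omega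
          · rw [hf]; simpa [hok] using hq
        · rw [State.setReg_reg, if_neg (by omega), State.setReg_reg, if_neg (by omega), hx₁]
        · rw [State.setReg_reg, if_neg (by omega), State.setReg_reg, if_pos (by omega)]
        · rw [State.setReg_reg, if_pos (by omega)]
          simp only [Expr.eval, Op.eval]
          rw [State.setReg_reg, if_neg (by omega), State.setReg_reg, if_neg (by omega), hw₁, hrj,
            State.setReg_arr, hE₁.wt j (by omega), ← BitVec.ofNat_mul]
        · intro s₂ _ h₂
          refine hJ.setReg ?_ (by omega) _
          rw [hrange, List.flatMap_append, List.map_append, ← List.append_assoc]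
          have : [j].flatMap f = E.walks (E.g.tgt j) (w * E.g.wt j) cs := by simp [hf, hok]
          rw [this]
          exact h₂
      · refine hJ.setReg ?_ (by omega) _
        rw [hrange, List.flatMap_append]
        have : [j].flatMap f = [] := by simp [hf, hok]
        rw [this, List.append_nil]
        exact hl₂

/-- Run `body` for every walk that starts in a vertex with the constraint `c` and continues through
vertices with the constraints `cs`. -/
def enumerate (body : Program) (c : Con) (cs : List Con) : Program :=
  .seq (.assign 20 (.reg c.lo)) <| forTo 20 (.reg c.hi) <|
    ifOk c 20 <| .seq (.assign 21 (.const 1)) (extend body 0 cs)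

/-- The starts, ends and weights of the walks that start in a vertex with the constraint `c` and
continue through vertices with the constraints `cs`. -/
def Env.allWalks (E : Env) (c : Con) (cs : List Con) : List (ℕ × ℕ × ℕ) :=
  (List.range' (E.ρ c.lo) (E.ρ c.hi - E.ρ c.lo)).flatMap fun v =>
    if E.Ok c v then (E.walks v 1 cs).map (Prod.mk v) else []

/-- A bound for the time of an enumeration. -/
def Env.enumCost (E : Env) (T : ℕ) (c : Con) (cs : List Con) : ℕ :=
  (∑ v ∈ Finset.Ico (E.ρ c.lo) (E.ρ c.hi), (E.extendCost T v cs + 24)) + 6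

theorem enumerate_wr {body : Program} (c : Con) (cs : List Con) {r : ℕ}
    (h : (enumerate body c cs).wr r) : body.wr r ∨ 16 ≤ r := by
  simp only [enumerate, Program.wr, forTo, ifOk, false_or, or_false] at h
  rcases h with h | (h | h) | h
  · omega
  · omega
  · exact (extend_wr _ _ h).imp_right (by omega)
  · omega

theorem enumerate_wa {body : Program} (c : Con) (cs : List Con) {a : ℕ}
    (h : (enumerate body c cs).wa a) : body.wa a := by
  simp only [enumerate, Program.wa, forTo, ifOk, false_or, or_false] at h
  exact extend_wa _ _ h

theorem one_le_extendCost (E : Env) (T v : ℕ) (cs : List Con) : 1 ≤ E.extendCost T v cs := by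
  cases cs <;> simp only [Env.extendCost] <;> omega

/-- The rule for enumerations: if the body maintains `J` for every single walk, then all walks have
been dealt with at the end. -/
theorem enumerate_spec {E : Env} (hg : E.g.Valid) (hF : E.Fits b) {body : Program}
    (hB : IsBody body) {T : ℕ} {J : List (ℕ × ℕ × ℕ) → State b → Prop} (hJ : Stable J) {c : Con}
    {cs : List Con} (hc : c.Fits E b) (hcs : ∀ c ∈ cs, c.Fits E b)
    (hbody : ∀ l p s, p ∈ E.allWalks c cs → E.HeldBy s → s.reg 20 = BitVec.ofNat b p.1 →
      s.reg 16 = BitVec.ofNat b p.2.1 → s.reg 17 = BitVec.ofNat b p.2.2 → J l s →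
      Tri body s T (J (l ++ [p])))
    (s : State b) (hE : E.HeldBy s) (h0 : J [] s) :
    Tri (enumerate body c cs) s (E.enumCost T c cs) (J (E.allWalks c cs)) := by
  have hS := hF.S_lt
  have hle := hc.le
  have hle2 := hc.le_S
  set f := fun v => if E.Ok c v then (E.walks v 1 cs).map (Prod.mk v) else [] with hf
  have hall : E.allWalks c cs = (List.range' (E.ρ c.lo) (E.ρ c.hi - E.ρ c.lo)).flatMap f := rfl
  refine Tri.assign_seq (T₂ := (∑ v ∈ Finset.Ico (E.ρ c.lo) (E.ρ c.hi),
    ((E.extendCost T v cs + 2 + 13) + ((Expr.reg c.hi).cost + 7))) + ((Expr.reg c.hi).cost + 3)) ?_ ?_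
  swap
  · simp only [Expr.cost, Env.enumCost]
    have : ∑ v ∈ Finset.Ico (E.ρ c.lo) (E.ρ c.hi), ((E.extendCost T v cs + 2 + 13) + (1 + 7)) ≤
        ∑ v ∈ Finset.Ico (E.ρ c.lo) (E.ρ c.hi), (E.extendCost T v cs + 24) :=
      Finset.sum_le_sum fun _ _ => by omega
    omega
  set s₀ := s.setReg 20 ((Expr.reg c.lo).eval s) with hs₀
  have hE₀ : E.HeldBy s₀ := hE.setReg (by omega) _
  have hfacts : ∀ s₁, Frame (forTo 20 (.reg c.hi) <|
      ifOk c 20 <| .seq (.assign 21 (.const 1)) (extend body 0 cs)) s₀ s₁ → E.HeldBy s₁ := by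
    intro s₁ h
    refine hE₀.frame h (fun r hr => ?_) (fun a ha => ?_)
    · have := (enumerate_wr c cs (r := r) (Or.inr hr)).imp_left (hB.1 _); omega
    · exact hB.2 a (enumerate_wa c cs (Or.inr ha))
  refine (Tri.forTo (lo := E.ρ c.lo) (hi := E.ρ c.hi)
    (T := fun v => E.extendCost T v cs + 2 + 13)
    (I := fun v s' => J ((List.range' (E.ρ c.lo) (v - E.ρ c.lo)).flatMap f) s')
    ?_ (by omega) hle ?_ ?_ ?_ ?_).mono le_rfl (fun s' _ h => by rw [hall]; exact h.2)
  · simp only [Program.wr, ifOk, false_or, or_false]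
    rintro (h | h)
    · omega
    · have := (extend_wr _ _ h).imp_left (hB.1 _); omega
  · rw [hs₀, State.setReg_reg, if_pos rfl, Expr.eval, hE.reg _ hc.lo.1 hc.lo.2]
  · simpa using hJ.setReg h0 (by omega) _
  · intro k s₁ _ _ h _
    rw [Expr.eval, (hfacts s₁ h).reg _ hc.hi.1 hc.hi.2]
  · intro v s₁ hv1 hv2 h hrv hl₁
    have hE₁ := hfacts s₁ h
    have hrange : List.range' (E.ρ c.lo) (v + 1 - E.ρ c.lo) =
        List.range' (E.ρ c.lo) (v - E.ρ c.lo) ++ [v] := by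
      rw [show v + 1 - E.ρ c.lo = (v - E.ρ c.lo) + 1 by omega, List.range'_1_concat,
        show E.ρ c.lo + (v - E.ρ c.lo) = v by omega]
    have h1 := one_le_extendCost E T v cs
    refine Tri.ifOk hE₁ hF hc hrv (by omega) (by omega) (fun hok => ?_) (fun hok => ?_)
    · refine Tri.assign_seq (T₂ := E.extendCost T v cs) ?_ (by simp only [Expr.cost]; omega)
      refine (extend_spec hg hF hB hJ (x := v) hbody cs 0 v 1 _ _ hcs ?_ (by omega)
        (hE₁.setReg (by omega) _) ?_ ?_ ?_ (hJ.setReg hl₁ (by omega) _)).mono le_rfl ?_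
      · intro q hq
        rw [hall, List.mem_flatMap]
        refine ⟨v, ?_, ?_⟩
        · rw [List.mem_range'_1]; omega
        · rw [hf]; simpa [hok] using hq
      · rw [State.setReg_reg, if_neg (by omega), hrv]
      · rw [State.setReg_reg, if_neg (by omega), hrv]
      · rw [State.setReg_reg, if_pos (by omega)]; rfl
      · intro s₂ _ h₂
        refine hJ.setReg ?_ (by omega) _
        rw [hrange, List.flatMap_append]
        have : [v].flatMap f = (E.walks v 1 cs).map (Prod.mk v) := by simp [hf, hok]
        rw [this]
        exact h₂
    · refine hJ.setReg ?_ (by omega) _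
      rw [hrange, List.flatMap_append]
      have : [v].flatMap f = [] := by simp [hf, hok]
      rw [this, List.append_nil]
      exact hl₁

/-! ### Sums over walks as products of matrices -/

/-- The weighted adjacency matrix. -/
def Env.adj (E : Env) : Matrix (Fin E.g.S) (Fin E.g.S) ℕ := .of fun u v =>
  ∑ j ∈ Finset.Ico (E.g.off u) (E.g.off (u + 1)), if E.g.tgt j = v then E.g.wt j else 0

/-- The diagonal matrix that selects the vertices with the constraint `c`. -/
def Env.sel (E : Env) (c : Con) : Matrix (Fin E.g.S) (Fin E.g.S) ℕ :=
  .diagonal fun v => if E.Ok c v then 1 else 0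

theorem Env.sel_mul_self (E : Env) (c : Con) : E.sel c * E.sel c = E.sel c := by
  rw [Env.sel, Matrix.diagonal_mul_diagonal]
  congr 1
  funext v
  split_ifs <;> rfl

theorem Env.sel_mul_apply (E : Env) (c : Con) (M : Matrix (Fin E.g.S) (Fin E.g.S) ℕ)
    (u v : Fin E.g.S) : (E.sel c * M) u v = if E.Ok c u then M u v else 0 := by
  rw [Env.sel, Matrix.diagonal_mul]
  split_ifs <;> simp

theorem Env.mul_sel_apply (E : Env) (c : Con) (M : Matrix (Fin E.g.S) (Fin E.g.S) ℕ)
    (u v : Fin E.g.S) : (M * E.sel c) u v = if E.Ok c v then M u v else 0 := by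
  rw [Env.sel, Matrix.mul_diagonal]
  split_ifs <;> simp

/-- The weighted number of walks that continue through vertices with the given constraints. -/
def Env.walkMat (E : Env) : List Con → Matrix (Fin E.g.S) (Fin E.g.S) ℕ
  | [] => 1
  | c :: cs => E.adj * (E.sel c * E.walkMat cs)

theorem sum_map_flatMap {α β : Type*} (l : List α) (f : α → List β) (h : β → ℕ) :
    ((l.flatMap f).map h).sum = (l.map fun a => ((f a).map h).sum).sum := by
  induction l with
  | nil => rfl
  | cons a l ih => simp [ih]

theorem sum_map_range' (h : ℕ → ℕ) (a n : ℕ) :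
    ((List.range' a n).map h).sum = ∑ i ∈ Finset.Ico a (a + n), h i := by
  induction n with
  | zero => simp
  | succ n ih =>
    rw [List.range'_1_concat, List.map_append, List.sum_append, ih, ← add_assoc,
      Finset.sum_Ico_succ_top (by omega)]
    simp

theorem Csr.Valid.off_add_deg {g : Csr} (hg : g.Valid) {v : ℕ} (hv : v < g.S) :
    g.off v + g.deg v = g.off (v + 1) := by
  have := hg.off_le v hv
  rw [Csr.deg]; omega

theorem sum_mul_apply_mul {n : ℕ} (A B : Matrix (Fin n) (Fin n) ℕ) (φ : ℕ → ℕ) (v : Fin n) :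
    ∑ t : Fin n, (A * B) v t * φ t = ∑ y : Fin n, A v y * ∑ t : Fin n, B y t * φ t := by
  simp only [Matrix.mul_apply, Finset.sum_mul, Finset.mul_sum]
  rw [Finset.sum_comm]
  simp only [mul_assoc]

/-- A sum over the continuations of a walk as an entry of a product of matrices. -/
theorem Env.sum_walks {E : Env} (hg : E.g.Valid) (φ : ℕ → ℕ) (cs : List Con) :
    ∀ (v : Fin E.g.S) (w : ℕ), ((E.walks v w cs).map fun q => q.2 * φ q.1).sum =
      w * ∑ t : Fin E.g.S, E.walkMat cs v t * φ t := by
  induction cs with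
  | nil =>
    intro v w
    simp [Env.walks, Env.walkMat, Matrix.one_apply]
  | cons c cs ih =>
    intro v w
    rw [Env.walks, sum_map_flatMap, sum_map_range', hg.off_add_deg v.2]
    have h1 : ∀ j ∈ Finset.Ico (E.g.off v) (E.g.off (v + 1)),
        ((if E.Ok c (E.g.tgt j) then E.walks (E.g.tgt j) (w * E.g.wt j) cs else []).map
          fun q => q.2 * φ q.1).sum = ∑ y : Fin E.g.S, w * ((if E.g.tgt j = y then E.g.wt j else 0) *
            ∑ t : Fin E.g.S, (E.sel c * E.walkMat cs) y t * φ t) := by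
      intro j hj
      rw [Finset.mem_Ico] at hj
      have htj := hg.tgt_lt j (hj.2.trans_le (hg.off_le_S (v := v + 1) (by omega)))
      rw [Finset.sum_eq_single ⟨E.g.tgt j, htj⟩]
      · rw [if_pos rfl]
        simp only [Env.sel_mul_apply]
        by_cases hok : E.Ok c (E.g.tgt j)
        · simp only [if_pos hok]
          rw [ih ⟨E.g.tgt j, htj⟩, mul_assoc]
        · simp [if_neg hok]
      · intro y _ hy
        rw [if_neg fun h => hy (Fin.ext h.symm)]
        simp
      · simp
    rw [Finset.sum_congr rfl h1, Env.walkMat, sum_mul_apply_mul, Finset.sum_comm, Finset.mul_sum]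
    refine Finset.sum_congr rfl fun y _ => ?_
    rw [Env.adj, Matrix.of_apply, Finset.sum_mul, Finset.mul_sum]

/-- The weighted number of walks that start with the constraint `c` and continue with `cs`. -/
def Env.segMat (E : Env) (c : Con) (cs : List Con) : Matrix (Fin E.g.S) (Fin E.g.S) ℕ :=
  E.sel c * E.walkMat cs

theorem Env.sum_allWalks {E : Env} (hg : E.g.Valid) (φ : ℕ → ℕ → ℕ) {c : Con}
    (hle : E.ρ c.lo ≤ E.ρ c.hi) (hS : E.ρ c.hi ≤ E.g.S) (cs : List Con) :
    ((E.allWalks c cs).map fun q => q.2.2 * φ q.1 q.2.1).sum =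
      ∑ x : Fin E.g.S, ∑ t : Fin E.g.S, E.segMat c cs x t * φ x t := by
  have h1 : ∀ v < E.g.S, ((if E.Ok c v then (E.walks v 1 cs).map (Prod.mk v) else []).map
      fun q : ℕ × ℕ × ℕ => q.2.2 * φ q.1 q.2.1).sum =
      if h : v < E.g.S then ∑ t : Fin E.g.S, E.segMat c cs ⟨v, h⟩ t * φ v t else 0 := by
    intro v hv
    rw [dif_pos hv]
    simp only [Env.segMat, Env.sel_mul_apply]
    by_cases hok : E.Ok c v
    · simp only [if_pos hok, List.map_map]
      have := E.sum_walks hg (φ v) cs ⟨v, hv⟩ 1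
      rw [one_mul] at this
      exact this
    · simp [if_neg hok]
  rw [Env.allWalks, sum_map_flatMap, sum_map_range', Nat.add_sub_cancel' hle,
    Finset.sum_congr rfl fun v hv => h1 v ((Finset.mem_Ico.1 hv).2.trans_le hS)]
  have h2 : ∑ v ∈ Finset.Ico (E.ρ c.lo) (E.ρ c.hi),
      (if h : v < E.g.S then ∑ t : Fin E.g.S, E.segMat c cs ⟨v, h⟩ t * φ v t else 0) =
      ∑ v ∈ Finset.range E.g.S,
      (if h : v < E.g.S then ∑ t : Fin E.g.S, E.segMat c cs ⟨v, h⟩ t * φ v t else 0) := by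
    refine Finset.sum_subset (fun v hv => ?_) (fun v hv hv' => ?_)
    · rw [Finset.mem_Ico] at hv; rw [Finset.mem_range]; omega
    · rw [dif_pos (Finset.mem_range.1 hv)]
      refine Finset.sum_eq_zero fun t _ => ?_
      rw [Env.segMat, Env.sel_mul_apply, if_neg, zero_mul]
      rintro ⟨h3, h4, -⟩
      exact hv' (Finset.mem_Ico.2 ⟨h3, h4⟩)
  rw [h2, Finset.sum_range]
  refine Finset.sum_congr rfl fun v _ => ?_
  rw [dif_pos v.2]

theorem Env.walks_end {E : Env} (hg : E.g.Valid) {h : Con} (cs : List Con) :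
    ∀ {v w : ℕ} {q : ℕ × ℕ}, v < E.g.S → q ∈ E.walks v w (cs ++ [h]) → E.Ok h q.1 ∧ q.1 < E.g.S := by
  have hstep : ∀ {v w : ℕ} {q : ℕ × ℕ} {c : Con} {l : List Con}, v < E.g.S →
      q ∈ E.walks v w (c :: l) → ∃ y w', y < E.g.S ∧ E.Ok c y ∧ q ∈ E.walks y w' l := by
    intro v w q c l hv hq
    rw [Env.walks, List.mem_flatMap] at hq
    obtain ⟨j, hj, hq⟩ := hq
    rw [List.mem_range'_1, hg.off_add_deg hv] at hj
    have htj := hg.tgt_lt j (hj.2.trans_le (hg.off_le_S (v := v + 1) (by omega)))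
    split_ifs at hq with hok
    · exact ⟨_, _, htj, hok, hq⟩
    · simp at hq
  induction cs with
  | nil =>
    intro v w q hv hq
    obtain ⟨y, w', hy, hok, hq⟩ := hstep hv hq
    rw [Env.walks, List.mem_singleton] at hq
    subst hq
    exact ⟨hok, hy⟩
  | cons c cs ih =>
    intro v w q hv hq
    obtain ⟨y, w', hy, hok, hq⟩ := hstep hv hq
    exact ih hy hq

theorem Env.mem_allWalks {E : Env} (hg : E.g.Valid) {c h : Con} (hS : E.ρ c.hi ≤ E.g.S)
    {cs : List Con} {q : ℕ × ℕ × ℕ} (hq : q ∈ E.allWalks c (cs ++ [h])) :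
    E.Ok c q.1 ∧ E.Ok h q.2.1 ∧ q.1 < E.g.S ∧ q.2.1 < E.g.S := by
  rw [Env.allWalks, List.mem_flatMap] at hq
  obtain ⟨v, -, hq⟩ := hq
  split_ifs at hq with hok
  · rw [List.mem_map] at hq
    obtain ⟨q', hq', rfl⟩ := hq
    have hv : v < E.g.S := hok.2.1.trans_le hS
    have := E.walks_end hg cs hv hq'
    exact ⟨hok, this.1, hv, this.2⟩
  · simp at hq

/-! ### The cost of an enumeration -/

/-- Only the degrees of the vertices before the last one matter: `ex c` is the exponent in the bound
for the degrees of the vertices with the constraint `c`. -/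
theorem Env.extendCost_le {E : Env} (hg : E.g.Valid) {δ : ℕ} (hδ : 1 ≤ δ) (ex : Con → ℕ) (T : ℕ)
    (cs : List Con) : (∀ c ∈ cs.dropLast, ∀ v < E.g.S, E.Ok c v → E.g.deg v ≤ δ ^ ex c) →
    cs ≠ [] → ∀ v < E.g.S, E.extendCost T v cs ≤
      (E.g.deg v + 1) * (2 ^ cs.length * (T + 50 * cs.length) *
        δ ^ ((cs.dropLast.map ex).sum)) := by
  induction cs with
  | nil => intro _ h; exact absurd rfl h
  | cons c cs ih =>
    intro hdeg _ v hv
    -- `X` bounds the cost from the next vertex on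
    have key : ∀ X, (∀ y < E.g.S, E.Ok c y → E.extendCost T y cs ≤ X) →
        E.extendCost T v (c :: cs) ≤ (E.g.deg v + 1) * (X + 43) := by
      intro X hX
      rw [Env.extendCost]
      have : ∑ j ∈ Finset.Ico (E.g.off v) (E.g.off (v + 1)),
          ((if E.Ok c (E.g.tgt j) then E.extendCost T (E.g.tgt j) cs else 0) + 33) ≤
          ∑ j ∈ Finset.Ico (E.g.off v) (E.g.off (v + 1)), (X + 33) := by
        refine Finset.sum_le_sum fun j hj => ?_
        rw [Finset.mem_Ico] at hj
        have htj := hg.tgt_lt j (hj.2.trans_le (hg.off_le_S (v := v + 1) (by omega)))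
        split_ifs with hok
        · have := hX _ htj hok; omega
        · omega
      rw [Finset.sum_const, Nat.card_Ico, smul_eq_mul] at this
      have h2 : E.g.off (v + 1) - E.g.off v = E.g.deg v := rfl
      rw [h2] at this
      nlinarith
    cases cs with
    | nil =>
      refine (key (T + 4) fun y _ _ => by simp [Env.extendCost]).trans ?_
      refine Nat.mul_le_mul_left _ ?_
      simp only [List.length_singleton, List.dropLast_singleton, List.map_nil, List.sum_nil, pow_zero]
      omega
    | cons c' cs' =>
      set Y := 2 ^ (c' :: cs').length * (T + 50 * (c' :: cs').length) *
        δ ^ (((c' :: cs').dropLast.map ex).sum) with hY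
      have hdl : (c :: c' :: cs').dropLast = c :: (c' :: cs').dropLast := rfl
      rw [hdl] at hdeg ⊢
      refine (key ((δ ^ ex c + 1) * Y) fun y hy hok => ?_).trans ?_
      · refine (ih (fun c₁ hc₁ => hdeg c₁ (by simp [hc₁])) (by simp) y hy).trans ?_
        exact Nat.mul_le_mul_right _ (by have := hdeg c (by simp) y hy hok; omega)
      · refine Nat.mul_le_mul_left _ ?_
        have h1 : 1 ≤ δ ^ ex c := Nat.one_le_pow _ _ hδ
        set m := ((c' :: cs').dropLast.map ex).sum
        have h2 : 1 ≤ δ ^ m := Nat.one_le_pow _ _ hδ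
        have h3 : 1 ≤ 2 ^ (c' :: cs').length := Nat.one_le_pow _ _ (by omega)
        rw [List.map_cons, List.sum_cons, List.length_cons, pow_succ, pow_add]
        set n := (c' :: cs').length
        calc (δ ^ ex c + 1) * Y + 43 ≤ (2 * δ ^ ex c) * Y + 43 * (2 ^ n * (δ ^ ex c * δ ^ m)) := by
              have : 1 ≤ 2 ^ n * (δ ^ ex c * δ ^ m) := Nat.mul_pos h3 (Nat.mul_pos h1 h2)
              nlinarith
          _ ≤ 2 ^ n * 2 * (T + 50 * (n + 1)) * (δ ^ ex c * δ ^ m) := by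
              rw [hY]; nlinarith [Nat.zero_le (2 ^ n * (δ ^ ex c * δ ^ m))]

/-- The number of arcs and vertices before the vertex `v`. -/
def Csr.before (g : Csr) (v : ℕ) : ℕ := g.off v + v

theorem Csr.Valid.sum_deg {g : Csr} (hg : g.Valid) {u v : ℕ} (huv : u ≤ v) (hv : v ≤ g.S) :
    ∑ x ∈ Finset.Ico u v, (g.deg x + 1) = g.before v - g.before u := by
  induction v, huv using Nat.le_induction with
  | base => simp
  | succ v huv ih =>
    rw [Finset.sum_Ico_succ_top huv, ih (by omega)]
    have h1 := hg.off_add_deg (v := v) (by omega)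
    have h2 := hg.off_mono huv (by omega)
    simp only [Csr.before]
    omega

theorem Csr.Valid.before_mono {g : Csr} (hg : g.Valid) {u v : ℕ} (huv : u ≤ v) (hv : v ≤ g.S) :
    g.before u ≤ g.before v := by
  have := hg.off_mono huv hv
  simp only [Csr.before]; omega

theorem Csr.Valid.before_le {g : Csr} (hg : g.Valid) {v : ℕ} (hv : v ≤ g.S) :
    g.before v ≤ 2 * g.S := by
  have := hg.off_le_S hv
  simp only [Csr.before]; omega

/-- The number of walks is at most the number of their first arcs times the degrees of their inner
vertices. -/
theorem Env.enumCost_le {E : Env} (hg : E.g.Valid) {δ : ℕ} (hδ : 1 ≤ δ) (ex : Con → ℕ) (T : ℕ)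
    {c : Con} (hle : E.ρ c.lo ≤ E.ρ c.hi) (hS : E.ρ c.hi ≤ E.g.S) {cs : List Con} (hcs : cs ≠ [])
    (hdeg : ∀ c ∈ cs.dropLast, ∀ v < E.g.S, E.Ok c v → E.g.deg v ≤ δ ^ ex c) :
    E.enumCost T c cs ≤ (E.g.before (E.ρ c.hi) - E.g.before (E.ρ c.lo)) *
      (25 * (2 ^ cs.length * (T + 50 * cs.length)) * δ ^ ((cs.dropLast.map ex).sum)) + 6 := by
  rw [Env.enumCost, ← hg.sum_deg hle hS, Finset.sum_mul]
  refine Nat.add_le_add_right (Finset.sum_le_sum fun v hv => ?_) 6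
  have hv' := (Finset.mem_Ico.1 hv).2.trans_le hS
  have := E.extendCost_le hg hδ ex T cs hdeg hcs v hv'
  set Z := 2 ^ cs.length * (T + 50 * cs.length) * δ ^ ((cs.dropLast.map ex).sum) with hZ
  have hl : 1 ≤ cs.length := List.length_pos_iff.2 hcs
  have hZ1 : 1 ≤ Z := by
    rw [hZ]
    exact Nat.mul_pos (Nat.mul_pos (by positivity) (by omega)) (Nat.one_le_pow _ _ hδ)
  calc E.extendCost T v cs + 24 ≤ (E.g.deg v + 1) * Z + 24 * ((E.g.deg v + 1) * Z) := by
        have : 1 ≤ (E.g.deg v + 1) * Z := Nat.mul_pos (by omega) hZ1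
        omega
    _ = _ := by rw [hZ]; ring

/-! ### Joining two families of walks in an associative array -/

/-- Clear the cell of the current walk. -/
def zeroBody (a : ℕ) (addr : Expr) : Program := .write a addr (.const 0)

/-- Add the weight of the current walk to its cell. -/
def scatterBody (a : ℕ) (addr : Expr) : Program :=
  .write a addr (.op .add (.read a addr) (.reg 17))

/-- Add the weight of the current walk, times the contents of its cell, to the total. -/
def gatherBody (a : ℕ) (addr : Expr) : Program :=
  .assign 13 (.op .add (.reg 13) (.op .mul (.reg 17) (.read a addr)))

theorem isBody_zeroBody {a : ℕ} (ha : 8 ≤ a) (addr : Expr) : IsBody (zeroBody a addr) :=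
  ⟨fun _ h => h.elim, fun _ h => by cases h; exact ha⟩

theorem isBody_scatterBody {a : ℕ} (ha : 8 ≤ a) (addr : Expr) : IsBody (scatterBody a addr) :=
  ⟨fun _ h => h.elim, fun _ h => by cases h; exact ha⟩

theorem isBody_gatherBody (a : ℕ) (addr : Expr) : IsBody (gatherBody a addr) :=
  ⟨fun _ h => h, fun _ h => h.elim⟩

/-- The start and the end of a walk satisfy the constraints `c` and `h`. -/
def Env.Ends (E : Env) (c h : Con) (x t : ℕ) : Prop :=
  E.Ok c x ∧ E.Ok h t ∧ x < E.g.S ∧ t < E.g.S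

/-- The expression `addr` computes the address `α x t` of the cell for walks from `x` to `t`. -/
structure IsAddr (b : ℕ) (E : Env) (c h : Con) (addr : Expr) (α : ℕ → ℕ → ℕ) : Prop where
  cost_le : addr.cost ≤ 12
  lt : ∀ x t, E.Ends c h x t → α x t < 2 ^ b
  eval : ∀ (s : State b) (x t : ℕ), E.HeldBy s → E.Ends c h x t → s.reg 20 = BitVec.ofNat b x →
    s.reg 16 = BitVec.ofNat b t → addr.eval s = BitVec.ofNat b (α x t)

/-- A walk from a vertex with the constraint `c` to one with the constraint `h`, with the
constraints `cs` in between: everything fits into the memory. -/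
structure SegFits (b : ℕ) (E : Env) (c : Con) (cs : List Con) (h : Con) : Prop where
  valid : E.g.Valid
  fits : E.Fits b
  start : c.Fits E b
  mid : ∀ c' ∈ cs, c'.Fits E b
  finish : h.Fits E b

theorem SegFits.tail {E : Env} {c h : Con} {cs : List Con} (hs : SegFits b E c cs h) :
    ∀ c' ∈ cs ++ [h], c'.Fits E b := by
  intro c' hc'
  rcases List.mem_append.1 hc' with hc' | hc'
  · exact hs.mid c' hc'
  · rw [List.mem_singleton.1 hc']; exact hs.finish

/-- The cells of all walks are cleared; cells in `Z` that were clear remain so. -/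
theorem zero_spec {E : Env} {c h : Con} {cs : List Con} (hs : SegFits b E c cs h) {addr : Expr}
    {α : ℕ → ℕ → ℕ} (hα : IsAddr b E c h addr α) {a : ℕ} (ha : 8 ≤ a) (Z : ℕ → Prop)
    (s : State b) (hE : E.HeldBy s)
    (h0 : ∀ p, Z p → s.arr a (BitVec.ofNat b p) = BitVec.ofNat b 0) :
    Tri (enumerate (zeroBody a addr) c (cs ++ [h])) s (E.enumCost 30 c (cs ++ [h])) (fun s' =>
      ∀ p, (Z p ∨ ∃ q ∈ E.allWalks c (cs ++ [h]), α q.1 q.2.1 = p) →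
        s'.arr a (BitVec.ofNat b p) = BitVec.ofNat b 0) := by
  refine enumerate_spec hs.valid hs.fits (isBody_zeroBody ha addr) (J := fun l s' =>
    ∀ p, (Z p ∨ ∃ q ∈ l, α q.1 q.2.1 = p) → s'.arr a (BitVec.ofNat b p) = BitVec.ofNat b 0)
    ?_ hs.start hs.tail ?_ s hE ?_
  · intro l s s' _ harr h
    rwa [harr]
  · intro l q s' hq hE' hx ht _ hl
    have hends := E.mem_allWalks hs.valid hs.start.le_S hq
    have hc := hα.cost_le
    refine Tri.write (by simp only [Expr.cost]; omega) ?_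
    rw [hα.eval s' _ _ hE' hends hx ht, State.setArr_arr, if_pos rfl]
    intro p hp
    by_cases hpq : BitVec.ofNat b p = BitVec.ofNat b (α q.1 q.2.1)
    · rw [hpq, Function.update_self]; rfl
    · rw [Function.update_of_ne hpq]
      refine hl p (hp.imp_right ?_)
      rintro ⟨q', hq', rfl⟩
      rcases List.mem_append.1 hq' with hq' | hq'
      · exact ⟨q', hq', rfl⟩
      · rw [List.mem_singleton.1 hq'] at hpq; exact absurd rfl hpq
  · intro p hp
    rcases hp with hp | ⟨q, hq, -⟩
    · exact h0 p hp
    · simp at hq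

/-- Each cell in `Z` receives the weighted number of the walks with its address. -/
theorem scatter_spec {E : Env} {c h : Con} {cs : List Con} (hs : SegFits b E c cs h) {addr : Expr}
    {α : ℕ → ℕ → ℕ} (hα : IsAddr b E c h addr α) {a : ℕ} (ha : 8 ≤ a) (Z : ℕ → Prop)
    (hZ : ∀ p, Z p → p < 2 ^ b) (s : State b) (hE : E.HeldBy s)
    (h0 : ∀ p, Z p → s.arr a (BitVec.ofNat b p) = BitVec.ofNat b 0) :
    Tri (enumerate (scatterBody a addr) c (cs ++ [h])) s (E.enumCost 30 c (cs ++ [h])) (fun s' =>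
      ∀ p, Z p → s'.arr a (BitVec.ofNat b p) = BitVec.ofNat b (∑ x : Fin E.g.S, ∑ t : Fin E.g.S,
        E.segMat c (cs ++ [h]) x t * if α x t = p then 1 else 0)) := by
  have hsum := fun p => E.sum_allWalks hs.valid (fun x t => if α x t = p then 1 else 0)
    hs.start.le hs.start.le_S (cs ++ [h])
  refine (enumerate_spec hs.valid hs.fits (isBody_scatterBody ha addr) (J := fun l s' =>
    ∀ p, Z p → s'.arr a (BitVec.ofNat b p) = BitVec.ofNat b
      ((l.map fun q => q.2.2 * if α q.1 q.2.1 = p then 1 else 0).sum))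
    ?_ hs.start hs.tail ?_ s hE ?_).mono le_rfl ?_
  · intro l s s' _ harr h
    rwa [harr]
  · intro l q s' hq hE' hx ht hw hl
    have hends := E.mem_allWalks hs.valid hs.start.le_S hq
    have hc := hα.cost_le
    have hev := hα.eval s' _ _ hE' hends hx ht
    refine Tri.write (by simp only [Expr.cost]; omega) ?_
    rw [hev, State.setArr_arr, if_pos rfl]
    intro p hp
    rw [List.map_append, List.sum_append, List.map_singleton, List.sum_singleton]
    by_cases hpq : p = α q.1 q.2.1
    · rw [← hpq, Function.update_self, if_pos rfl, mul_one, BitVec.ofNat_add, ← hl p hp, ← hw]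
      simp only [Expr.eval, Op.eval, hev, hpq]
    · rw [Function.update_of_ne, if_neg (Ne.symm hpq), mul_zero, add_zero, hl p hp]
      rwa [Ne, ofNat_inj_of_lt (hZ p hp) (hα.lt _ _ hends)]
  · simpa using h0
  · intro s' _ h p hp
    rw [h p hp, ← hsum]

/-- The total receives the weighted sum, over all walks, of the contents of their cells. -/
theorem gather_spec {E : Env} {c h : Con} {cs : List Con} (hs : SegFits b E c cs h) {addr : Expr}
    {α : ℕ → ℕ → ℕ} (hα : IsAddr b E c h addr α) (a : ℕ) (val : ℕ → ℕ → ℕ) (s : State b)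
    (hE : E.HeldBy s) (hval : ∀ q ∈ E.allWalks c (cs ++ [h]),
      s.arr a (BitVec.ofNat b (α q.1 q.2.1)) = BitVec.ofNat b (val q.1 q.2.1)) :
    Tri (enumerate (gatherBody a addr) c (cs ++ [h])) s (E.enumCost 30 c (cs ++ [h])) (fun s' =>
      s'.reg 13 = s.reg 13 + BitVec.ofNat b (∑ x : Fin E.g.S, ∑ t : Fin E.g.S,
        E.segMat c (cs ++ [h]) x t * val x t)) := by
  rw [← E.sum_allWalks hs.valid val hs.start.le hs.start.le_S (cs ++ [h])]
  refine (enumerate_spec hs.valid hs.fits (isBody_gatherBody a addr) (J := fun l s' =>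
    s'.arr a = s.arr a ∧ s'.reg 13 = s.reg 13 +
      BitVec.ofNat b ((l.map fun q => q.2.2 * val q.1 q.2.1).sum))
    ?_ hs.start hs.tail ?_ s hE ?_).mono le_rfl (fun s' _ h => h.2)
  · intro l s s' hr harr h
    rwa [harr, hr 13 (by omega)]
  · intro l q s' hq hE' hx ht hw hl
    have hends := E.mem_allWalks hs.valid hs.start.le_S hq
    have hc := hα.cost_le
    refine Tri.assign (by simp only [Expr.cost]; omega) ⟨hl.1, ?_⟩
    rw [State.setReg_reg, if_pos rfl]
    simp only [Expr.eval, Op.eval, hα.eval s' _ _ hE' hends hx ht, hl.1, hl.2, hval q hq, hw]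
    rw [List.map_append, List.sum_append, List.map_singleton, List.sum_singleton, BitVec.ofNat_add,
      BitVec.ofNat_mul, add_assoc]
  · simp

/-- Whatever the cells contain, the time bound holds; this is needed after a multiplication that was
stopped. -/
theorem gather_halts {E : Env} {c h : Con} {cs : List Con} (hs : SegFits b E c cs h) {addr : Expr}
    {α : ℕ → ℕ → ℕ} (hα : IsAddr b E c h addr α) (a : ℕ) (s : State b) (hE : E.HeldBy s) :
    Tri (enumerate (gatherBody a addr) c (cs ++ [h])) s (E.enumCost 30 c (cs ++ [h]))
      (fun _ => True) := by
  have hc := hα.cost_le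
  refine enumerate_spec hs.valid hs.fits (isBody_gatherBody a addr) (J := fun l s' => True)
    (fun _ _ _ _ _ h => h) hs.start hs.tail ?_ s hE trivial
  intro l q s' _ _ _ _ _ _
  exact Tri.assign (by simp only [Expr.cost]; omega) trivial

/-- The address `x * S + t`. -/
def pairAddr : Expr := .op .add (.op .mul (.reg 20) (.reg 2)) (.reg 16)

/-- The address `t * S + x`. -/
def pairAddrRev : Expr := .op .add (.op .mul (.reg 16) (.reg 2)) (.reg 20)

/-- Add to the total the weighted number of closed walks that go from the constraint `c` through the
constraints `cs` to `h` and through `ds` back.  Array `8` collects the first half; only those of its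
cells that are used are ever cleared. -/
def hashJoin (c : Con) (cs : List Con) (h : Con) (ds : List Con) : Program :=
  .seq (enumerate (zeroBody 8 pairAddr) c (cs ++ [h])) <|
  .seq (enumerate (zeroBody 8 pairAddrRev) h (ds ++ [c])) <|
  .seq (enumerate (scatterBody 8 pairAddr) c (cs ++ [h])) <|
  enumerate (gatherBody 8 pairAddrRev) h (ds ++ [c])

theorem hashJoin_wr {c h : Con} {cs ds : List Con} {r : ℕ} (hr : (hashJoin c cs h ds).wr r) :
    r = 13 ∨ 16 ≤ r := by
  rcases hr with hr | hr | hr | hr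
  all_goals
    rcases enumerate_wr _ _ hr with hr | hr
    · first
        | exact hr.elim
        | exact Or.inl hr
    · exact Or.inr hr

theorem hashJoin_wa {c h : Con} {cs ds : List Con} {a : ℕ} (ha : (hashJoin c cs h ds).wa a) :
    a = 8 := by
  rcases ha with ha | ha | ha | ha
  all_goals
    have := enumerate_wa _ _ ha
    first
      | exact this
      | exact this.elim

theorem hashJoin_spec {E : Env} {c h : Con} {cs ds : List Con} (hs : SegFits b E c cs h)
    (hds : ∀ c' ∈ ds, c'.Fits E b) (hSS : E.g.S * E.g.S ≤ 2 ^ b) (hρ : E.ρ 2 = E.g.S) (s : State b)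
    (hE : E.HeldBy s) :
    Tri (hashJoin c cs h ds) s
      (2 * E.enumCost 30 c (cs ++ [h]) + 2 * E.enumCost 30 h (ds ++ [c]))
      (fun s' => s'.reg 13 = s.reg 13 + BitVec.ofNat b
        (E.segMat c (cs ++ [h]) * E.segMat h (ds ++ [c])).trace) := by
  have hs' : SegFits b E h ds c := ⟨hs.valid, hs.fits, hs.finish, hds, hs.start⟩
  have hα : ∀ c h, IsAddr b E c h pairAddr (fun x t => x * E.g.S + t) := fun c h =>
    { cost_le := by simp [pairAddr, Expr.cost]
      lt := fun x t hxt => (mul_add_lt_mul hxt.2.2.1 hxt.2.2.2).trans_le hSS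
      eval := fun s x t hE _ hx ht => by
        simp [pairAddr, Expr.eval, Op.eval, hx, ht, hE.reg 2, hρ, BitVec.ofNat_add,
          BitVec.ofNat_mul] }
  have hβ : ∀ c h, IsAddr b E c h pairAddrRev (fun x t => t * E.g.S + x) := fun c h =>
    { cost_le := by simp [pairAddrRev, Expr.cost]
      lt := fun x t hxt => (mul_add_lt_mul hxt.2.2.2 hxt.2.2.1).trans_le hSS
      eval := fun s x t hE _ hx ht => by
        simp [pairAddrRev, Expr.eval, Op.eval, hx, ht, hE.reg 2, hρ, BitVec.ofNat_add,
          BitVec.ofNat_mul] }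
  have hframe : ∀ {body : Program} {c : Con} {cs : List Con} {s s' : State b}, IsBody body →
      E.HeldBy s → Frame (enumerate body c cs) s s' → E.HeldBy s' := fun hB hE hf =>
    hE.frame hf (fun r hr => by have := (enumerate_wr _ _ hr).imp_left (hB.1 r); omega)
      (fun a ha => hB.2 a (enumerate_wa _ _ ha))
  set L := E.allWalks c (cs ++ [h]) with hL
  set L' := E.allWalks h (ds ++ [c]) with hL'
  -- the cells that are used
  set Z : ℕ → Prop := fun p => (∃ q ∈ L, q.1 * E.g.S + q.2.1 = p) ∨
    ∃ q ∈ L', q.2.1 * E.g.S + q.1 = p with hZ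
  have hZlt : ∀ p, Z p → p < 2 ^ b := by
    rintro p (⟨q, hq, rfl⟩ | ⟨q, hq, rfl⟩)
    · exact (hα c h).lt _ _ (E.mem_allWalks hs.valid hs.start.le_S hq)
    · exact (hβ h c).lt _ _ (E.mem_allWalks hs.valid hs'.start.le_S hq)
  refine (zero_spec hs (hα c h) le_rfl (fun _ => False) s hE
    (fun _ h => h.elim)).seq' (fun s₁ hf₁ h₁ => ?_) (T₂ := E.enumCost 30 h (ds ++ [c]) +
      (E.enumCost 30 c (cs ++ [h]) + E.enumCost 30 h (ds ++ [c]))) (by omega)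
  have hE₁ := hframe (isBody_zeroBody le_rfl _) hE hf₁
  refine (zero_spec hs' (hβ h c) le_rfl (fun p => ∃ q ∈ L, q.1 * E.g.S + q.2.1 = p)
    s₁ hE₁ (fun p hp => h₁ p (Or.inr hp))).seq'
    (fun s₂ hf₂ h₂ => ?_) le_rfl
  have hE₂ := hframe (isBody_zeroBody le_rfl _) hE₁ hf₂
  refine (scatter_spec hs (hα c h) le_rfl Z hZlt s₂ hE₂ h₂).seq' (fun s₃ hf₃ h₃ => ?_) le_rfl
  have hE₃ := hframe (isBody_scatterBody le_rfl _) hE₂ hf₃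
  have h13 : s₃.reg 13 = s.reg 13 := by
    have hn : ∀ {body : Program} {c : Con} {cs : List Con}, ¬ body.wr 13 →
        ¬ (enumerate body c cs).wr 13 := fun hb h => by
      rcases enumerate_wr _ _ h with h | h
      · exact hb h
      · omega
    rw [hf₃.1 13 (hn id), hf₂.1 13 (hn id), hf₁.1 13 (hn id)]
  refine (gather_spec hs' (hβ h c) 8 (fun y x => if hxy : x < E.g.S ∧ y < E.g.S then
    E.segMat c (cs ++ [h]) ⟨x, hxy.1⟩ ⟨y, hxy.2⟩ else 0) s₃ hE₃ ?_).mono le_rfl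
    (fun s₄ _ h₄ => ?_)
  · intro q hq
    have hends := E.mem_allWalks hs.valid hs'.start.le_S hq
    rw [h₃ _ (Or.inr ⟨q, hq, rfl⟩), dif_pos ⟨hends.2.2.2, hends.2.2.1⟩]
    congr 1
    rw [Finset.sum_eq_single ⟨q.2.1, hends.2.2.2⟩, Finset.sum_eq_single ⟨q.1, hends.2.2.1⟩]
    · simp
    · intro t _ ht
      rw [if_neg, mul_zero]
      intro h
      exact ht (Fin.ext (mul_add_inj t.2 hends.2.2.1 h).2)
    · simp
    · intro x _ hx
      refine Finset.sum_eq_zero fun t _ => ?_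
      rw [if_neg, mul_zero]
      intro h
      exact hx (Fin.ext (mul_add_inj t.2 hends.2.2.1 h).1)
    · simp
  · rw [h₄, h13]
    congr 2
    rw [Matrix.trace_mul_comm, Matrix.trace]
    refine Finset.sum_congr rfl fun y _ => ?_
    rw [Matrix.diag_apply, Matrix.mul_apply]
    refine Finset.sum_congr rfl fun x _ => ?_
    simp

/-! ### Bounds for the entries of products -/

/-- All row sums of `M` are at most `r`. -/
def RowLe {n : ℕ} (M : Matrix (Fin n) (Fin n) ℕ) (r : ℕ) : Prop := ∀ x, ∑ t, M x t ≤ r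

theorem RowLe.mul {n r r' : ℕ} {M M' : Matrix (Fin n) (Fin n) ℕ} (h : RowLe M r)
    (h' : RowLe M' r') : RowLe (M * M') (r * r') := by
  intro x
  simp only [Matrix.mul_apply]
  rw [Finset.sum_comm]
  calc ∑ y, ∑ t, M x y * M' y t = ∑ y, M x y * ∑ t, M' y t := by simp only [Finset.mul_sum]
    _ ≤ ∑ y, M x y * r' := Finset.sum_le_sum fun y _ => Nat.mul_le_mul_left _ (h' y)
    _ = (∑ y, M x y) * r' := by rw [Finset.sum_mul]
    _ ≤ r * r' := Nat.mul_le_mul_right _ (h x)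

theorem RowLe.natEntry_le {n r : ℕ} {M : Matrix (Fin n) (Fin n) ℕ} (h : RowLe M r) (i j : ℕ) :
    natEntry M i j ≤ r := by
  unfold natEntry
  split_ifs with hij
  · exact (Finset.single_le_sum (f := fun t => M ⟨i, hij.1⟩ t) (fun _ _ => Nat.zero_le _)
      (Finset.mem_univ _)).trans (h _)
  · exact Nat.zero_le _

theorem rowLe_one {n : ℕ} : RowLe (1 : Matrix (Fin n) (Fin n) ℕ) 1 := by
  intro x
  simp [Matrix.one_apply]

theorem Env.rowLe_sel (E : Env) (c : Con) : RowLe (E.sel c) 1 := by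
  intro x
  rw [Env.sel, Finset.sum_eq_single x]
  · rw [Matrix.diagonal_apply_eq]; split_ifs <;> simp
  · intro t _ ht; rw [Matrix.diagonal_apply_ne _ ht.symm]
  · simp

theorem Env.rowLe_walkMat {E : Env} {β : ℕ} (hβ : RowLe E.adj β) (cs : List Con) :
    RowLe (E.walkMat cs) (β ^ cs.length) := by
  induction cs with
  | nil => exact rowLe_one
  | cons c cs ih =>
    have := hβ.mul ((E.rowLe_sel c).mul ih)
    rwa [one_mul, ← pow_succ'] at this

theorem Env.rowLe_segMat {E : Env} {β : ℕ} (hβ : RowLe E.adj β) (c : Con) (cs : List Con) :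
    RowLe (E.segMat c cs) (β ^ cs.length) := by
  have := (E.rowLe_sel c).mul (E.rowLe_walkMat hβ cs)
  rwa [one_mul] at this

/-! ### Multiplying matrices of walks by a clocked program -/

/-- Array `a` stores the square block of `F`, of the size `E.ρ 5`, with the corner `E.ρ r`,
`E.ρ r'`. -/
def MatHeld (E : Env) (s : State b) (a r r' : ℕ) (F : Matrix (Fin E.g.S) (Fin E.g.S) ℕ) : Prop :=
  ∀ i < E.ρ 5, ∀ j < E.ρ 5, s.arr a (BitVec.ofNat b (i * E.ρ 5 + j)) =
    BitVec.ofNat b (natEntry F (E.ρ r + i) (E.ρ r' + j))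

/-- The constraint selects at most as many vertices as the block size. -/
structure Con.Small (c : Con) (E : Env) (b : ℕ) : Prop extends c.Fits E b where
  small : E.ρ c.hi ≤ E.ρ c.lo + E.ρ 5

/-- Set the block in array `a` to zero. -/
def clearMat (a : ℕ) : Program :=
  .seq (.assign 14 (.const 0)) <|
    forTo 14 (.op .mul (.reg 5) (.reg 5)) (.write a (.reg 14) (.const 0))

/-- Copy the block in array `102` to array `100`. -/
def copyMat : Program :=
  .seq (.assign 14 (.const 0)) <|
    forTo 14 (.op .mul (.reg 5) (.reg 5)) (.write 100 (.reg 14) (.read 102 (.reg 14)))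

theorem clearMat_spec {D : ℕ} (a : ℕ) (hD : D * D < 2 ^ b) (s : State b)
    (h5 : s.reg 5 = BitVec.ofNat b D) :
    Tri (clearMat a) s (13 * (D * D) + 8) (fun s' => ∀ p < D * D,
      s'.arr a (BitVec.ofNat b p) = BitVec.ofNat b 0) := by
  refine Tri.assign_seq (T₂ := 13 * (D * D) + 6) ?_ (by simp only [Expr.cost]; omega)
  refine (Tri.forTo_const (lo := 0) (hi := D * D) (T := 3) (I := fun k s' => ∀ p < k,
    s'.arr a (BitVec.ofNat b p) = BitVec.ofNat b 0) ?_ hD (Nat.zero_le _) ?_ ?_ ?_ ?_ ?_).mono le_rfl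
    (fun _ _ h => h.2)
  · simp [Program.wr]
  · simp [Expr.eval]
  · intro p hp; omega
  · intro k s' _ _ hf _
    have := hf.1 5 (by simp [Program.wr, forTo])
    simp [Expr.eval, Op.eval, this, h5, BitVec.ofNat_mul]
  · intro k s' _ hk _ hrk hI
    refine Tri.write (by simp [Expr.cost]) ?_
    intro p hp
    simp only [State.setReg_arr, State.setArr_arr, if_true, Expr.eval, hrk]
    rcases Nat.lt_succ_iff_lt_or_eq.1 hp with h | rfl
    · rw [Function.update_of_ne, hI p h]
      rw [Ne, ofNat_inj_of_lt (by omega) (by omega)]; omega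
    · rw [Function.update_self]
  · simp only [Expr.cost]; omega

theorem copyMat_spec {D : ℕ} (hD : D * D < 2 ^ b) (s : State b)
    (h5 : s.reg 5 = BitVec.ofNat b D) :
    Tri copyMat s (14 * (D * D) + 8) (fun s' => ∀ p < D * D,
      s'.arr 100 (BitVec.ofNat b p) = s.arr 102 (BitVec.ofNat b p)) := by
  refine Tri.assign_seq (T₂ := 14 * (D * D) + 6) ?_ (by simp only [Expr.cost]; omega)
  refine (Tri.forTo_const (lo := 0) (hi := D * D) (T := 4) (I := fun k s' => ∀ p < k,
    s'.arr 100 (BitVec.ofNat b p) = s.arr 102 (BitVec.ofNat b p)) ?_ hD (Nat.zero_le _)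
    ?_ ?_ ?_ ?_ ?_).mono le_rfl (fun _ _ h => h.2)
  · simp [Program.wr]
  · simp [Expr.eval]
  · intro p hp; omega
  · intro k s' _ _ hf _
    have := hf.1 5 (by simp [Program.wr, forTo])
    simp [Expr.eval, Op.eval, this, h5, BitVec.ofNat_mul]
  · intro k s' _ hk hf hrk hI
    have h102 := hf.2 102 (by simp [Program.wa, forTo])
    rw [State.setReg_arr] at h102
    refine Tri.write (by simp [Expr.cost]) ?_
    intro p hp
    rw [State.setReg_arr, State.setArr_arr, if_pos rfl]
    simp only [Expr.eval, hrk]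
    rcases Nat.lt_succ_iff_lt_or_eq.1 hp with h | rfl
    · rw [Function.update_of_ne, hI p h]
      rw [Ne, ofNat_inj_of_lt (by omega) (by omega)]; omega
    · rw [Function.update_self, h102]
  · simp only [Expr.cost]; omega

theorem clearMat_wr {a r : ℕ} (h : (clearMat a).wr r) : r = 14 := by
  rcases h with h | h | h
  · exact h
  · exact h.elim
  · exact h

theorem clearMat_wa {a a' : ℕ} (h : (clearMat a).wa a') : a' = a := by
  rcases h with h | h | h
  · exact h.elim
  · exact h
  · exact h.elim

theorem copyMat_wr {r : ℕ} (h : copyMat.wr r) : r = 14 := by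
  rcases h with h | h | h
  · exact h
  · exact h.elim
  · exact h

theorem copyMat_wa {a : ℕ} (h : copyMat.wa a) : a = 100 := by
  rcases h with h | h | h
  · exact h.elim
  · exact h
  · exact h.elim

/-- The address of the entry for a walk from `x` to `t` in the block with corner `r`, `r'`. -/
def matAddr (r r' : ℕ) : Expr :=
  .op .add (.op .mul (.op .sub (.reg 20) (.reg r)) (.reg 5)) (.op .sub (.reg 16) (.reg r'))

/-- The address of the entry for the way back of a walk from `x` to `t`. -/
def matAddrRev (r r' : ℕ) : Expr :=
  .op .add (.op .mul (.op .sub (.reg 16) (.reg r')) (.reg 5)) (.op .sub (.reg 20) (.reg r))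

theorem Con.Small.sub_lt {E : Env} {c : Con} (hc : c.Small E b) {x : ℕ} (hx : E.Ok c x) :
    x - E.ρ c.lo < E.ρ 5 := by
  have h1 := hc.small
  have h2 := hx.1
  have h3 := hx.2.1
  omega

theorem isAddr_matAddr {E : Env} {c h : Con} (hF : E.Fits b) (hc : c.Small E b) (hh : h.Small E b)
    (hD : E.ρ 5 * E.ρ 5 < 2 ^ b) : IsAddr b E c h (matAddr c.lo h.lo)
      (fun x t => (x - E.ρ c.lo) * E.ρ 5 + (t - E.ρ h.lo)) where
  cost_le := by simp [matAddr, Expr.cost]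
  lt x t hxt := (mul_add_lt_mul (hc.sub_lt hxt.1) (hh.sub_lt hxt.2.1)).trans hD
  eval s x t hE hxt hx ht := by
    have h1 := hxt.1.1
    have h2 := hxt.2.1.1
    have h3 := hF.S_lt
    have h4 := hxt.2.2.1
    have h5 := hxt.2.2.2
    simp only [matAddr, Expr.eval, Op.eval, hx, ht, hE.reg c.lo hc.lo.1 hc.lo.2,
      hE.reg h.lo hh.lo.1 hh.lo.2, hE.reg 5 (by omega) (by omega)]
    rw [BitVec.ofNat_sub_ofNat_of_le _ _ (by omega) h1,
      BitVec.ofNat_sub_ofNat_of_le _ _ (by omega) h2, BitVec.ofNat_add, BitVec.ofNat_mul]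

theorem isAddr_matAddrRev {E : Env} {c h : Con} (hF : E.Fits b) (hc : c.Small E b)
    (hh : h.Small E b) (hD : E.ρ 5 * E.ρ 5 < 2 ^ b) : IsAddr b E c h (matAddrRev c.lo h.lo)
      (fun x t => (t - E.ρ h.lo) * E.ρ 5 + (x - E.ρ c.lo)) where
  cost_le := by simp [matAddrRev, Expr.cost]
  lt x t hxt := (mul_add_lt_mul (hh.sub_lt hxt.2.1) (hc.sub_lt hxt.1)).trans hD
  eval s x t hE hxt hx ht := by
    have h1 := hxt.1.1
    have h2 := hxt.2.1.1
    have h3 := hF.S_lt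
    have h4 := hxt.2.2.1
    have h5 := hxt.2.2.2
    simp only [matAddrRev, Expr.eval, Op.eval, hx, ht, hE.reg c.lo hc.lo.1 hc.lo.2,
      hE.reg h.lo hh.lo.1 hh.lo.2, hE.reg 5 (by omega) (by omega)]
    rw [BitVec.ofNat_sub_ofNat_of_le _ _ (by omega) h1,
      BitVec.ofNat_sub_ofNat_of_le _ _ (by omega) h2, BitVec.ofNat_add, BitVec.ofNat_mul]

theorem Env.segMat_mul_sel (E : Env) (c h : Con) (cs : List Con) :
    E.segMat c (cs ++ [h]) * E.sel h = E.segMat c (cs ++ [h]) := by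
  have hw : ∀ cs : List Con, E.walkMat (cs ++ [h]) * E.sel h = E.walkMat (cs ++ [h]) := by
    intro cs
    induction cs with
    | nil => simp [Env.walkMat, Matrix.mul_assoc, Env.sel_mul_self]
    | cons c cs ih => rw [List.cons_append, Env.walkMat, Matrix.mul_assoc, Matrix.mul_assoc, ih]
  rw [Env.segMat, Matrix.mul_assoc, hw]

/-- Store in array `a` the weighted numbers of walks from the constraint `c` through `cs` to `h`. -/
def fill (a : ℕ) (c : Con) (cs : List Con) (h : Con) : Program :=
  .seq (clearMat a) (enumerate (scatterBody a (matAddr c.lo h.lo)) c (cs ++ [h]))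

theorem fill_wr {a : ℕ} {c h : Con} {cs : List Con} {r : ℕ} (hr : (fill a c cs h).wr r) :
    14 ≤ r := by
  rcases hr with hr | hr
  · have := clearMat_wr hr; omega
  · rcases enumerate_wr _ _ hr with hr | hr
    · exact hr.elim
    · omega

theorem fill_wa {a : ℕ} {c h : Con} {cs : List Con} {a' : ℕ} (ha : (fill a c cs h).wa a') :
    a' = a := by
  rcases ha with ha | ha
  · exact clearMat_wa ha
  · exact enumerate_wa _ _ ha

theorem fill_spec {E : Env} {c h : Con} {cs : List Con} (hs : SegFits b E c cs h)
    (hc : c.Small E b) (hh : h.Small E b) (hD : E.ρ 5 * E.ρ 5 < 2 ^ b) {a : ℕ} (ha : 8 ≤ a)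
    (s : State b) (hE : E.HeldBy s) :
    Tri (fill a c cs h) s (E.enumCost 30 c (cs ++ [h]) + (13 * (E.ρ 5 * E.ρ 5) + 8)) (fun s' =>
      MatHeld E s' a c.lo h.lo (E.segMat c (cs ++ [h]))) := by
  refine (clearMat_spec a hD s (hE.reg 5 (by omega) (by omega))).seq' (fun s₁ hf₁ h₁ => ?_)
    (T₂ := E.enumCost 30 c (cs ++ [h])) (by omega)
  have hE₁ : E.HeldBy s₁ := hE.frame hf₁ (fun r hr => by have := clearMat_wr hr; omega)
    (fun a' ha' => by have := clearMat_wa ha'; omega)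
  refine (scatter_spec hs (isAddr_matAddr hs.fits hc hh hD) ha (fun p => p < E.ρ 5 * E.ρ 5)
    (fun p hp => hp.trans hD) s₁ hE₁ h₁).mono le_rfl (fun s₂ _ h₂ i hi j hj => ?_)
  rw [h₂ _ (mul_add_lt_mul hi hj)]
  congr 1
  -- a walk counts for the entry `i, j` only if it joins the vertices `lo + i` and `lo' + j`
  have hterm : ∀ x t : Fin E.g.S, (E.segMat c (cs ++ [h]) x t *
      if (x - E.ρ c.lo) * E.ρ 5 + (t - E.ρ h.lo) = i * E.ρ 5 + j then 1 else 0) =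
      if (x : ℕ) = E.ρ c.lo + i ∧ (t : ℕ) = E.ρ h.lo + j then E.segMat c (cs ++ [h]) x t else 0 := by
    intro x t
    by_cases hx : E.Ok c x
    swap
    · have : E.segMat c (cs ++ [h]) x t = 0 := by rw [Env.segMat, Env.sel_mul_apply, if_neg hx]
      simp [this]
    by_cases ht : E.Ok h t
    swap
    · have : E.segMat c (cs ++ [h]) x t = 0 := by
        rw [← Env.segMat_mul_sel, Env.mul_sel_apply, if_neg ht]
      simp [this]
    have h1 := hx.1
    have h2 := ht.1
    by_cases h3 : (x : ℕ) = E.ρ c.lo + i ∧ (t : ℕ) = E.ρ h.lo + j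
    · rw [if_pos h3, if_pos, mul_one]
      rw [h3.1, h3.2, Nat.add_sub_cancel_left, Nat.add_sub_cancel_left]
    · rw [if_neg h3, if_neg, mul_zero]
      intro h4
      have := mul_add_inj (hh.sub_lt ht) hj h4
      omega
  simp only [hterm]
  unfold natEntry
  split_ifs with hij
  · rw [Finset.sum_eq_single ⟨E.ρ c.lo + i, hij.1⟩, Finset.sum_eq_single ⟨E.ρ h.lo + j, hij.2⟩]
    · simp
    · intro t _ ht
      rw [if_neg]
      exact fun h => ht (Fin.ext h.2)
    · simp
    · intro x _ hx
      refine Finset.sum_eq_zero fun t _ => ?_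
      rw [if_neg]
      exact fun h => hx (Fin.ext h.1)
    · simp
  · refine Finset.sum_eq_zero fun x _ => Finset.sum_eq_zero fun t _ => ?_
    rw [if_neg]
    rintro ⟨h1, h2⟩
    exact hij ⟨by omega, by omega⟩

/-- The program `P` multiplies `n × n` matrices with entries at most `N` in at most `tm n` steps, if
the words are of at least `κ log N` bits. -/
def Multiplies (P : Program) (κ : ℕ) (tm : ℕ → ℕ) : Prop :=
  ∀ (n N b : ℕ) (A B : Matrix (Fin n) (Fin n) ℕ), 2 ≤ N → n ≤ N → (∀ i j, A i j ≤ N) →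
    (∀ i j, B i j ≤ N) → N ^ κ ≤ 2 ^ b → ∀ s : State b, (s.reg 0).toNat = n →
    s.HoldsMatrix 0 A → s.HoldsMatrix 1 B →
    ∃ (s₁ : State b) (t : ℕ), Exec P s s₁ t ∧ s₁.HoldsMatrix 2 (A * B) ∧ t ≤ tm n

/-- The factor of proportionality between the time of a clocked program and its clock. -/
noncomputable def clockFactor (P : Program) : ℕ := P.clocked_spec.choose

/-- With the block of walks to the constraint `c` in array `100`, append the walks from `c` through
`cs` to `h`.  Register `6` limits the time for the multiplication; register `12` is set to `0` if
that was not enough. -/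
def mulStep (P : Program) (c : Con) (cs : List Con) (h : Con) : Program :=
  .seq (fill 101 c cs h) <| .seq (.assign 100 (.reg 5)) <| .seq (.assign 99 (.reg 6)) <|
    .seq P.clocked <| .seq (.cond (.reg 99) .skip (.assign 12 (.const 0))) copyMat

theorem natEntry_mul_eq_sum {n : ℕ} (A B : Matrix (Fin n) (Fin n) ℕ) (i j : ℕ) :
    natEntry (A * B) i j = ∑ k ∈ Finset.range n, natEntry A i k * natEntry B k j := by
  by_cases h : i < n ∧ j < n
  · exact natEntry_mul A B h.1 h.2
  · rw [natEntry, dif_neg h, Finset.sum_eq_zero]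
    intro k _
    rw [Nat.mul_eq_zero, natEntry, natEntry]
    by_cases hi : i < n
    · right; rw [dif_neg]; exact fun h' => h ⟨hi, h'.2⟩
    · left; rw [dif_neg]; exact fun h' => hi h'.1

theorem natEntry_mul_block {E : Env} {c : Con} (hc : c.Small E b)
    {F G : Matrix (Fin E.g.S) (Fin E.g.S) ℕ} (hF : F * E.sel c = F) (x z : ℕ) :
    natEntry (F * G) x z =
      ∑ j ∈ Finset.range (E.ρ 5), natEntry F x (E.ρ c.lo + j) * natEntry G (E.ρ c.lo + j) z := by
  rw [natEntry_mul_eq_sum]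
  have h1 := Finset.sum_Ico_eq_sum_range (fun y => natEntry F x y * natEntry G y z) (E.ρ c.lo)
    (E.ρ c.lo + E.ρ 5)
  rw [Nat.add_sub_cancel_left] at h1
  rw [← h1]
  refine Finset.sum_congr_of_eq_on_inter (fun y hy hy' => ?_) (fun y _ hy' => ?_)
    (fun _ _ _ => rfl)
  · rw [Nat.mul_eq_zero]
    left
    rw [natEntry]
    split_ifs with hxy
    · rw [← hF, Env.mul_sel_apply, if_neg]
      intro hok
      have := hc.sub_lt hok
      have := hok.1
      exact hy' (Finset.mem_Ico.2 ⟨hok.1, by simp only at *; omega⟩)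
    · rfl
  · rw [Nat.mul_eq_zero]
    left
    rw [natEntry, dif_neg]
    exact fun h => hy' (Finset.mem_range.2 h.2)

theorem mulStep_wr {P : Program} {c h : Con} {cs : List Con} {r : ℕ}
    (hr : (mulStep P c cs h).wr r) : r = 12 ∨ 14 ≤ r := by
  rcases hr with hr | hr | hr | hr | (hr | hr) | hr
  · exact Or.inr (fill_wr hr)
  · have : r = 100 := hr; omega
  · have : r = 99 := hr; omega
  · have := P.clocked_wr hr; omega
  · exact hr.elim
  · exact Or.inl hr
  · have := copyMat_wr hr; omega

theorem mulStep_wa {P : Program} {c h : Con} {cs : List Con} {a : ℕ}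
    (ha : (mulStep P c cs h).wa a) : 8 ≤ a := by
  rcases ha with ha | ha | ha | ha | (ha | ha) | ha
  · have := fill_wa ha; omega
  · exact ha.elim
  · exact ha.elim
  · have := P.clocked_wa ha; omega
  · exact ha.elim
  · exact ha.elim
  · have := copyMat_wa ha; omega

/-- Register `12` never changes except to `0`, and does not change at all if the time limit exceeds
the time for the multiplication.  The bound for the running time holds in any case. -/
theorem mulStep_spec {P : Program} {κ : ℕ} {tm : ℕ → ℕ} (hP : Multiplies P κ tm) {E : Env}
    {c h : Con} {cs : List Con} (hs : SegFits b E c cs h) (hc : c.Small E b) (hh : h.Small E b)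
    (hD : E.ρ 5 * E.ρ 5 < 2 ^ b) {N : ℕ} (hN : 2 ≤ N) (hNb : N ^ κ ≤ 2 ^ b)
    (hNlt : N < 2 ^ b) (hDN : E.ρ 5 ≤ N)
    (hbud : E.ρ 6 < 2 ^ b) {r : ℕ} {F : Matrix (Fin E.g.S) (Fin E.g.S) ℕ} (hF : F * E.sel c = F)
    (hFN : ∀ i j, natEntry F i j ≤ N) (hGN : ∀ i j, natEntry (E.segMat c (cs ++ [h])) i j ≤ N)
    (s : State b) (hE : E.HeldBy s) (hM : s.reg 12 = 0 ∨ MatHeld E s 100 r c.lo F) :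
    Tri (mulStep P c cs h) s (E.enumCost 30 c (cs ++ [h]) +
      (clockFactor P * (E.ρ 6 + 1) + 27 * (E.ρ 5 * E.ρ 5) + 30)) (fun s' =>
      (s'.reg 12 = 0 ∨ MatHeld E s' 100 r h.lo (F * E.segMat c (cs ++ [h]))) ∧
      (s'.reg 12 = 0 ∨ s'.reg 12 = s.reg 12) ∧ (tm (E.ρ 5) < E.ρ 6 → s'.reg 12 = s.reg 12)) := by
  have hb : 0 < b := by
    have := hs.fits.S_lt
    rcases Nat.eq_zero_or_pos b with rfl | h
    · simp at this
    · exact h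
  refine (fill_spec hs hc hh hD (a := 101) (by omega) s hE).seq' (fun s₁ hf₁ h₁ => ?_)
    (T₂ := clockFactor P * (E.ρ 6 + 1) + 14 * (E.ρ 5 * E.ρ 5) + 22) (by omega)
  have hE₁ : E.HeldBy s₁ := hE.frame hf₁ (fun r hr => by have := fill_wr hr; omega)
    (fun a' ha' => by have := fill_wa ha'; omega)
  have h12 : s₁.reg 12 = s.reg 12 := hf₁.1 12 fun hr => by have := fill_wr hr; omega
  have h100 : s₁.arr 100 = s.arr 100 := hf₁.2 100 fun ha => by have := fill_wa ha; omega
  refine Tri.assign_seq (T₂ := clockFactor P * (E.ρ 6 + 1) + 14 * (E.ρ 5 * E.ρ 5) + 20) ?_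
    (by simp only [Expr.cost]; omega)
  refine Tri.assign_seq (T₂ := clockFactor P * (E.ρ 6 + 1) + 14 * (E.ρ 5 * E.ρ 5) + 18) ?_
    (by simp only [Expr.cost]; omega)
  set s₂ := (s₁.setReg 100 ((Expr.reg 5).eval s₁)).setReg 99
    ((Expr.reg 6).eval (s₁.setReg 100 ((Expr.reg 5).eval s₁))) with hs₂
  have hE₂ : E.HeldBy s₂ := (hE₁.setReg (by omega) _).setReg (by omega) _
  have hclock : s₂.clock = E.ρ 6 := by
    simp [hs₂, State.clock, Expr.eval, hE₁.reg 6, Nat.mod_eq_of_lt hbud]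
  have hDb : E.ρ 5 < 2 ^ b := by
    rcases Nat.eq_zero_or_pos (E.ρ 5) with h | h
    · rw [h]; positivity
    · nlinarith
  have hreg0 : (s₂.upper.reg 0).toNat = E.ρ 5 := by
    simp [hs₂, State.upper, Expr.eval, hE₁.reg 5, Nat.mod_eq_of_lt hDb]
  have h12₂ : s₂.reg 12 = s.reg 12 := by simp [hs₂, h12]
  obtain ⟨s₃, t₃, he₃, hc₃, ht₃, hsim⟩ := P.clocked_spec.choose_spec hb s₂
  change t₃ + clockFactor P * s₃.clock ≤ clockFactor P + clockFactor P * s₂.clock at ht₃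
  have hf₃ := he₃.frame
  have hE₃ : E.HeldBy s₃ := hE₂.frame hf₃ (fun r hr => by have := P.clocked_wr hr; omega)
    (fun a ha => by have := P.clocked_wa ha; omega)
  have h12₃ : s₃.reg 12 = s.reg 12 := by
    rw [hf₃.1 12 (fun hr => by have := P.clocked_wr hr; omega), h12₂]
  -- what the multiplication yields if its input was right
  set A : Matrix (Fin (E.ρ 5)) (Fin (E.ρ 5)) ℕ := .of fun i j =>
    natEntry F (E.ρ r + i) (E.ρ c.lo + j) with hA
  set B : Matrix (Fin (E.ρ 5)) (Fin (E.ρ 5)) ℕ := .of fun i j =>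
    natEntry (E.segMat c (cs ++ [h])) (E.ρ c.lo + i) (E.ρ h.lo + j) with hB
  have hprod : MatHeld E s 100 r c.lo F → (s₃.clock ≠ 0 → ∀ i < E.ρ 5, ∀ j < E.ρ 5,
      s₃.arr 102 (BitVec.ofNat b (i * E.ρ 5 + j)) = BitVec.ofNat b
        (natEntry (F * E.segMat c (cs ++ [h])) (E.ρ r + i) (E.ρ h.lo + j))) ∧
      (tm (E.ρ 5) < E.ρ 6 → s₃.clock ≠ 0) := by
    intro hMF
    have hA' : s₂.upper.HoldsMatrix 0 A := by
      intro i j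
      have : s₂.upper.arr 0 = s.arr 100 := by simp [hs₂, State.upper, h100]
      rw [this, hMF i i.2 j j.2, BitVec.toNat_ofNat, Nat.mod_eq_of_lt ((hFN _ _).trans_lt hNlt), hA,
        Matrix.of_apply]
    have hB' : s₂.upper.HoldsMatrix 1 B := by
      intro i j
      have : s₂.upper.arr 1 = s₁.arr 101 := by simp [hs₂, State.upper]
      rw [this, h₁ i i.2 j j.2, BitVec.toNat_ofNat, Nat.mod_eq_of_lt ((hGN _ _).trans_lt hNlt), hB,
        Matrix.of_apply]
    obtain ⟨s₄, t₄, he₄, hs₄, ht₄⟩ := hP _ N b A B hN hDN (fun i j => hFN _ _) (fun i j => hGN _ _)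
      hNb s₂.upper hreg0 hA' hB'
    obtain ⟨h5, h6⟩ := hsim s₄ t₄ he₄
    refine ⟨fun h0 i hi j hj => ?_, fun h0 => by omega⟩
    have h7 : s₃.arr 102 = s₄.arr 2 := by rw [← h5 h0]; rfl
    rw [h7, hs₄.eq_natEntry hi hj, natEntry_mul _ _ hi hj, natEntry_mul_block hc hF]
    congr 1
    refine Finset.sum_congr rfl fun k hk => ?_
    rw [natEntry_of_lt _ hi (Finset.mem_range.1 hk), natEntry_of_lt _ (Finset.mem_range.1 hk) hj]
    rfl
  have hcz : s₃.reg 99 = 0 ↔ s₃.clock = 0 := by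
    rw [State.clock, ← BitVec.toNat_inj]; simp
  refine Tri.seq' (p := P.clocked) (T₁ := clockFactor P * (E.ρ 6 + 1))
    (T₂ := 14 * (E.ρ 5 * E.ρ 5) + 16) (P := fun s' => s' = s₃) ⟨s₃, t₃, he₃, ?_, rfl⟩ ?_ (by omega)
  · rw [hclock] at ht₃; nlinarith
  intro s' _ hs'
  rw [hs']
  refine Tri.seq' (T₁ := 5) (T₂ := 14 * (E.ρ 5 * E.ρ 5) + 8)
    (P := fun s' => s'.arr = s₃.arr ∧ E.HeldBy s' ∧
      ((s₃.clock = 0 ∧ s'.reg 12 = 0) ∨ (s₃.clock ≠ 0 ∧ s'.reg 12 = s.reg 12))) ?_ ?_ (by omega)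
  · refine Tri.cond' 2 (fun h => Tri.skip (by omega) ⟨rfl, hE₃, Or.inr ⟨?_, h12₃⟩⟩)
      (fun h => Tri.assign (by simp [Expr.cost])
        ⟨rfl, hE₃.setReg (by omega) _, Or.inl ⟨?_, ?_⟩⟩) (by simp [Expr.cost])
    · exact fun h' => h (hcz.2 h')
    · exact hcz.1 h
    · rw [State.setReg_reg, if_pos rfl]; rfl
  · rintro s₅ - ⟨harr, hE₅, hok⟩
    refine (copyMat_spec hD s₅ (hE₅.reg 5 (by omega) (by omega))).mono le_rfl fun s₆ hf₆ h₆ => ?_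
    have h12₆ : s₆.reg 12 = s₅.reg 12 := hf₆.1 12 fun hr => by have := copyMat_wr hr; omega
    rw [h12₆]
    refine ⟨?_, ?_, fun hlt => ?_⟩
    · rcases hok with ⟨-, h0⟩ | ⟨h0, h1⟩
      · exact Or.inl h0
      · rcases hM with hM | hM
        · exact Or.inl (h1.trans hM)
        · right
          intro i hi j hj
          rw [h₆ _ (mul_add_lt_mul hi hj), harr, (hprod hM).1 h0 i hi j hj]
    · rcases hok with ⟨-, h0⟩ | ⟨h0, h1⟩
      · exact Or.inl h0
      · exact Or.inr h1
    · rcases hok with ⟨h0, h1⟩ | ⟨h0, h1⟩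
      · rcases hM with hM | hM
        · rw [h1, hM]
        · exact absurd h0 ((hprod hM).2 hlt)
      · exact h1

/-- The constraints and the starts of the later parts of a cyclic chain of walks. -/
abbrev Parts := List (Con × List Con)

/-- With the block of walks from the constraint `c₁` to `c` in array `100`, continue through `cs`
and the parts in `rest`, back to `c₁`, and add the weighted number of closed walks to the total. -/
def mulSteps (P : Program) (c₁ : Con) : Con → List Con → Parts → Program
  | c, cs, [] => enumerate (gatherBody 100 (matAddrRev c.lo c₁.lo)) c (cs ++ [c₁])
  | c, cs, (c', cs') :: rest => .seq (mulStep P c cs c') (mulSteps P c₁ c' cs' rest)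

/-- The product of the matrices of walks of a cyclic chain. -/
def Env.chainMat (E : Env) (c₁ : Con) : Con → List Con → Parts → Matrix (Fin E.g.S) (Fin E.g.S) ℕ
  | c, cs, [] => E.segMat c (cs ++ [c₁])
  | c, cs, (c', cs') :: rest => E.segMat c (cs ++ [c']) * E.chainMat c₁ c' cs' rest

/-- The number of arcs of a cyclic chain. -/
def chainLen : List Con → Parts → ℕ
  | cs, [] => cs.length + 1
  | cs, (_, cs') :: rest => cs.length + 1 + chainLen cs' rest

/-- A bound for the time of `mulSteps`; `X` is the time for a multiplication. -/
def Env.chainCost (E : Env) (X : ℕ) (c₁ : Con) : Con → List Con → Parts → ℕ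
  | c, cs, [] => E.enumCost 30 c (cs ++ [c₁])
  | c, cs, (c', cs') :: rest => E.enumCost 30 c (cs ++ [c']) + X + E.chainCost X c₁ c' cs' rest

/-- The time for a multiplication and its preparation. -/
noncomputable def Env.mulCost (E : Env) (P : Program) : ℕ :=
  clockFactor P * (E.ρ 6 + 1) + 27 * (E.ρ 5 * E.ρ 5) + 30

/-- The assumptions on the sizes of words and numbers under which products are computed: entries
stay below `N` if all row sums of the adjacency matrix are at most `β`. -/
structure MulFits (b : ℕ) (E : Env) (κ N β : ℕ) : Prop where
  valid : E.g.Valid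
  fits : E.Fits b
  block : E.ρ 5 * E.ρ 5 < 2 ^ b
  two_le : 2 ≤ N
  pow_le : N ^ κ ≤ 2 ^ b
  lt : N < 2 ^ b
  block_le : E.ρ 5 ≤ N
  budget_lt : E.ρ 6 < 2 ^ b
  one_le : 1 ≤ β
  row : RowLe E.adj β

theorem mulSteps_wr {P : Program} {c₁ : Con} {rest : Parts} : ∀ {c : Con} {cs : List Con} {r : ℕ},
    (mulSteps P c₁ c cs rest).wr r → 12 ≤ r := by
  induction rest with
  | nil =>
    intro c cs r h
    rcases enumerate_wr _ _ h with h | h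
    · have : r = 13 := h; omega
    · omega
  | cons p rest ih =>
    intro c cs r h
    rcases h with h | h
    · have := mulStep_wr h; omega
    · exact ih h

theorem mulSteps_wa {P : Program} {c₁ : Con} {rest : Parts} : ∀ {c : Con} {cs : List Con} {a : ℕ},
    (mulSteps P c₁ c cs rest).wa a → 8 ≤ a := by
  induction rest with
  | nil =>
    intro c cs r h
    exact (enumerate_wa _ _ h : False).elim
  | cons p rest ih =>
    intro c cs r h
    rcases h with h | h
    · exact mulStep_wa h
    · exact ih h

theorem mulSteps_spec {P : Program} {κ : ℕ} {tm : ℕ → ℕ} (hP : Multiplies P κ tm) {E : Env}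
    {N β : ℕ} (hm : MulFits b E κ N β) {c₁ : Con} (hc₁ : c₁.Small E b) (rest : Parts) :
    ∀ (c : Con) (cs : List Con) (F : Matrix (Fin E.g.S) (Fin E.g.S) ℕ) (p : ℕ) (s : State b),
    c.Small E b → (∀ d ∈ cs, d.Fits E b) →
    (∀ d ∈ rest, d.1.Small E b ∧ ∀ d' ∈ d.2, d'.Fits E b) → F * E.sel c = F →
    RowLe F (β ^ p) → β ^ (p + chainLen cs rest) ≤ N → E.HeldBy s →
    (s.reg 12 = 0 ∨ MatHeld E s 100 c₁.lo c.lo F) →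
    Tri (mulSteps P c₁ c cs rest) s (E.chainCost (E.mulCost P) c₁ c cs rest) (fun s' =>
      (s'.reg 12 = 0 ∨ s'.reg 13 = s.reg 13 +
        BitVec.ofNat b (F * E.chainMat c₁ c cs rest).trace) ∧
      (s'.reg 12 = 0 ∨ s'.reg 12 = s.reg 12) ∧ (tm (E.ρ 5) < E.ρ 6 → s'.reg 12 = s.reg 12)) := by
  have hS := hm.fits.S_lt
  induction rest with
  | nil =>
    intro c cs F p s hc hcs _ hF hrow hN hE hM
    have hs : SegFits b E c cs c₁ := ⟨hm.valid, hm.fits, hc.toFits, hcs, hc₁.toFits⟩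
    have hα := isAddr_matAddrRev hm.fits hc hc₁ hm.block
    have h12 : ∀ s' : State b, Frame (enumerate (gatherBody 100 (matAddrRev c.lo c₁.lo)) c
        (cs ++ [c₁])) s s' → s'.reg 12 = s.reg 12 := fun s' hf => hf.1 12 fun hr => by
      rcases enumerate_wr _ _ hr with hr | hr
      · have : 12 = 13 := hr; omega
      · omega
    rcases hM with hM | hM
    · refine (gather_halts hs hα 100 s hE).mono le_rfl fun s' hf _ => ?_
      rw [h12 s' hf]
      exact ⟨Or.inl hM, Or.inr rfl, fun _ => rfl⟩
    · refine (gather_spec hs hα 100 (fun x t => natEntry F t x) s hE fun q hq => ?_).mono le_rfl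
        fun s' hf h => ?_
      · have hends := E.mem_allWalks hs.valid hs.start.le_S hq
        have h1 := hends.1.1
        have h2 := hends.2.1.1
        rw [hM _ (hc₁.sub_lt hends.2.1) _ (hc.sub_lt hends.1), Nat.add_sub_cancel' h1,
          Nat.add_sub_cancel' h2]
      · rw [h12 s' hf]
        refine ⟨Or.inr ?_, Or.inr rfl, fun _ => rfl⟩
        rw [h, Env.chainMat, Matrix.trace_mul_comm]
        congr 2
        refine Finset.sum_congr rfl fun x _ => ?_
        rw [Matrix.diag_apply, Matrix.mul_apply]
        refine Finset.sum_congr rfl fun t _ => ?_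
        rw [natEntry_coe]
  | cons d rest ih =>
    obtain ⟨c', cs'⟩ := d
    intro c cs F p s hc hcs hrest hF hrow hN hE hM
    obtain ⟨hc', hcs'⟩ := hrest (c', cs') (by simp)
    have hs : SegFits b E c cs c' := ⟨hm.valid, hm.fits, hc.toFits, hcs, hc'.toFits⟩
    have hrowG := E.rowLe_segMat hm.row c (cs ++ [c'])
    have hle : ∀ q, q ≤ p + chainLen cs ((c', cs') :: rest) → β ^ q ≤ N := fun q hq =>
      (Nat.pow_le_pow_right hm.one_le hq).trans hN
    rw [List.length_append, List.length_singleton] at hrowG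
    refine (mulStep_spec hP hs hc hc' hm.block hm.two_le hm.pow_le hm.lt hm.block_le hm.budget_lt
      hF (fun i j => (hrow.natEntry_le i j).trans (hle _ (by omega)))
      (fun i j => (hrowG.natEntry_le i j).trans (hle _ (by rw [chainLen]; omega))) s hE hM).seq'
      (fun s₁ hf₁ h₁ => ?_) (T₂ := E.chainCost (E.mulCost P) c₁ c' cs' rest) ?_
    swap
    · rw [Env.chainCost, Env.mulCost]
    obtain ⟨h1, h2, h3⟩ := h₁
    have hE₁ : E.HeldBy s₁ := hE.frame hf₁ (fun r hr => by have := mulStep_wr hr; omega)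
      (fun a ha => mulStep_wa ha)
    have h13 : s₁.reg 13 = s.reg 13 := hf₁.1 13 fun hr => by have := mulStep_wr hr; omega
    refine (ih c' cs' (F * E.segMat c (cs ++ [c'])) (p + (cs.length + 1)) s₁ hc' hcs'
      (fun d hd => hrest d (by simp [hd])) ?_ ?_ ?_ hE₁ h1).mono le_rfl fun s₂ _ h₂ => ?_
    · rw [Matrix.mul_assoc, E.segMat_mul_sel]
    · rw [pow_add]; exact hrow.mul hrowG
    · exact hle _ (by rw [chainLen]; omega)
    · obtain ⟨h4, h5, h6⟩ := h₂
      refine ⟨?_, ?_, fun h => (h6 h).trans (h3 h)⟩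
      · rw [Env.chainMat, ← Matrix.mul_assoc, ← h13]; exact h4
      · rcases h5 with h5 | h5
        · exact Or.inl h5
        · rw [h5]; exact h2

/-- Add to the total the weighted number of closed walks through a cyclic chain of constraints. -/
def matChain (P : Program) (c₁ : Con) (cs₁ : List Con) (c₂ : Con) (cs₂ : List Con) (rest : Parts) :
    Program :=
  .seq (fill 100 c₁ cs₁ c₂) (mulSteps P c₁ c₂ cs₂ rest)

theorem matChain_wr {P : Program} {c₁ c₂ : Con} {cs₁ cs₂ : List Con} {rest : Parts} {r : ℕ}
    (h : (matChain P c₁ cs₁ c₂ cs₂ rest).wr r) : 12 ≤ r := by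
  rcases h with h | h
  · have := fill_wr h; omega
  · exact mulSteps_wr h

theorem matChain_wa {P : Program} {c₁ c₂ : Con} {cs₁ cs₂ : List Con} {rest : Parts} {a : ℕ}
    (h : (matChain P c₁ cs₁ c₂ cs₂ rest).wa a) : 8 ≤ a := by
  rcases h with h | h
  · have := fill_wa h; omega
  · exact mulSteps_wa h

theorem matChain_spec {P : Program} {κ : ℕ} {tm : ℕ → ℕ} (hP : Multiplies P κ tm) {E : Env}
    {N β : ℕ} (hm : MulFits b E κ N β) {c₁ c₂ : Con} {cs₁ cs₂ : List Con} {rest : Parts}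
    (hc₁ : c₁.Small E b) (hcs₁ : ∀ d ∈ cs₁, d.Fits E b)
    (hc₂ : c₂.Small E b) (hcs₂ : ∀ d ∈ cs₂, d.Fits E b)
    (hrest : ∀ d ∈ rest, d.1.Small E b ∧ ∀ d' ∈ d.2, d'.Fits E b)
    (hN : β ^ (cs₁.length + 1 + chainLen cs₂ rest) ≤ N) (s : State b) (hE : E.HeldBy s) :
    Tri (matChain P c₁ cs₁ c₂ cs₂ rest) s (E.enumCost 30 c₁ (cs₁ ++ [c₂]) + E.mulCost P +
      E.chainCost (E.mulCost P) c₁ c₂ cs₂ rest) (fun s' =>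
      (s'.reg 12 = 0 ∨ s'.reg 13 = s.reg 13 +
        BitVec.ofNat b (E.segMat c₁ (cs₁ ++ [c₂]) * E.chainMat c₁ c₂ cs₂ rest).trace) ∧
      (s'.reg 12 = 0 ∨ s'.reg 12 = s.reg 12) ∧ (tm (E.ρ 5) < E.ρ 6 → s'.reg 12 = s.reg 12)) := by
  have hs : SegFits b E c₁ cs₁ c₂ := ⟨hm.valid, hm.fits, hc₁.toFits, hcs₁, hc₂.toFits⟩
  refine (fill_spec hs hc₁ hc₂ hm.block (a := 100) (by omega) s hE).seq' (fun s₁ hf₁ h₁ => ?_)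
    (T₂ := E.chainCost (E.mulCost P) c₁ c₂ cs₂ rest) (by rw [Env.mulCost]; omega)
  have hE₁ : E.HeldBy s₁ := hE.frame hf₁ (fun r hr => by have := fill_wr hr; omega)
    (fun a' ha' => by have := fill_wa ha'; omega)
  have h12 : s₁.reg 12 = s.reg 12 := hf₁.1 12 fun hr => by have := fill_wr hr; omega
  have h13 : s₁.reg 13 = s.reg 13 := hf₁.1 13 fun hr => by have := fill_wr hr; omega
  have hrow := E.rowLe_segMat hm.row c₁ (cs₁ ++ [c₂])
  rw [List.length_append, List.length_singleton] at hrow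
  rw [← h12, ← h13]
  exact mulSteps_spec hP hm hc₁ rest c₂ cs₂ _ (cs₁.length + 1) s₁ hc₂ hcs₂ hrest
    (E.segMat_mul_sel _ _ _) hrow hN hE₁ (Or.inr h₁)

/-! ### Cyclic chains split into parts -/

/-- The diagonal matrix that selects the vertices from `lo` to `hi - 1` with the label `l`. -/
def Csr.sel (g : Csr) (lo hi l : ℕ) : Matrix (Fin g.S) (Fin g.S) ℕ :=
  .diagonal fun v => if lo ≤ (v : ℕ) ∧ (v : ℕ) < hi ∧ g.lab v = l then 1 else 0

/-- The weighted adjacency matrix. -/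
def Csr.adj (g : Csr) : Matrix (Fin g.S) (Fin g.S) ℕ := .of fun u v =>
  ∑ j ∈ Finset.Ico (g.off u) (g.off (u + 1)), if g.tgt j = v then g.wt j else 0

theorem Csr.sel_add_sel (g : Csr) {x y z : ℕ} (hxy : x ≤ y) (hyz : y ≤ z) (l : ℕ) :
    g.sel x y l + g.sel y z l = g.sel x z l := by
  rw [Csr.sel, Csr.sel, Csr.sel, Matrix.diagonal_add]
  congr 1
  funext v
  split_ifs <;> first | rfl | omega

theorem Csr.sel_self (g : Csr) (x l : ℕ) : g.sel x x l = 0 := by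
  rw [Csr.sel, ← Matrix.diagonal_zero]
  congr 1
  funext v
  rw [if_neg]
  omega

/-- The matrix of the walks of one step from a vertex with the given constraint, for each of the
constraints. -/
def Env.prodMat (E : Env) (cs : List Con) : Matrix (Fin E.g.S) (Fin E.g.S) ℕ :=
  (cs.map fun c => E.sel c * E.adj).prod

/-- All constraints of a list of parts. -/
def flat {α : Type*} (ps : List (α × List α)) : List α := ps.flatMap fun d => d.1 :: d.2

theorem Env.segMat_eq (E : Env) (c : Con) (cs : List Con) (h : Con) :
    E.segMat c (cs ++ [h]) = E.prodMat (c :: cs) * E.sel h := by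
  rw [Env.segMat]
  induction cs generalizing c with
  | nil => simp [Env.walkMat, Env.prodMat, Matrix.mul_assoc]
  | cons d cs ih =>
    rw [List.cons_append, Env.walkMat, ih d]
    simp only [Env.prodMat, List.map_cons, List.prod_cons, Matrix.mul_assoc]

theorem Env.sel_mul_prodMat (E : Env) (c : Con) (cs : List Con) :
    E.sel c * E.prodMat (c :: cs) = E.prodMat (c :: cs) := by
  rw [Env.prodMat, List.map_cons, List.prod_cons, ← Matrix.mul_assoc, ← Matrix.mul_assoc,
    E.sel_mul_self]

theorem Env.chainMat_eq (E : Env) (c₁ : Con) (rest : Parts) : ∀ (c : Con) (cs : List Con),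
    E.chainMat c₁ c cs rest = E.prodMat (c :: cs ++ flat rest) * E.sel c₁ := by
  induction rest with
  | nil => intro c cs; rw [Env.chainMat, E.segMat_eq]; simp [flat]
  | cons d rest ih =>
    intro c cs
    rw [Env.chainMat, E.segMat_eq, ih]
    have h1 : flat (d :: rest) = d.1 :: d.2 ++ flat rest := rfl
    have h2 : E.prodMat (c :: cs ++ flat (d :: rest)) =
        E.prodMat (c :: cs) * E.prodMat (d.1 :: d.2 ++ flat rest) := by
      rw [h1]; simp only [Env.prodMat, List.map_append, List.prod_append]
    rw [h2, ← Matrix.mul_assoc, Matrix.mul_assoc (E.prodMat (c :: cs)), List.cons_append,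
      E.sel_mul_prodMat]

/-- The weighted number of closed walks through a cyclic list of constraints. -/
def Env.cyc (E : Env) (cs : List Con) : ℕ := (E.prodMat cs).trace

theorem Env.trace_chain (E : Env) (c₁ : Con) (cs₁ : List Con) (c₂ : Con) (cs₂ : List Con)
    (rest : Parts) : (E.segMat c₁ (cs₁ ++ [c₂]) * E.chainMat c₁ c₂ cs₂ rest).trace =
      E.cyc (flat ((c₁, cs₁) :: (c₂, cs₂) :: rest)) := by
  have := E.chainMat_eq c₁ ((c₂, cs₂) :: rest) c₁ cs₁
  rw [Env.chainMat] at this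
  rw [this, Matrix.trace_mul_comm, List.cons_append, E.sel_mul_prodMat]
  rfl

theorem Env.cyc_cons (E : Env) (c : Con) (cs : List Con) :
    E.cyc (c :: cs) = (E.sel c * (E.adj * E.prodMat cs)).trace := by
  rw [Env.cyc, Env.prodMat, List.map_cons, List.prod_cons, Matrix.mul_assoc]; rfl

/-! ### Vertex classes -/

/-- The parameters of one round of the algorithm: the graph, a number `M` greater than that of its
edges, the degree parameter `δ`, and the borders `D₁` and `D₂` of the vertex classes. -/
structure Params where
  g : Csr
  M : ℕ
  δ : ℕ
  D₁ : ℕ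
  D₂ : ℕ

/-- The values of the parameter registers: register `5` holds the size of the blocks, register `6`
the time limit for a multiplication, and `10` and `11` the borders of the current block. -/
def Params.env (p : Params) (dim bud bl bh : ℕ) : Env where
  g := p.g
  ρ := fun r => match r with
    | 2 => p.g.S
    | 3 => p.M
    | 4 => p.δ
    | 5 => dim
    | 6 => bud
    | 8 => p.D₁
    | 9 => p.D₂
    | 10 => bl
    | 11 => bh
    | _ => 0

/-- The first vertex of a class: the classes `0`, `1` and `2` are those of the vertices of high,
medium and low degree. -/
def Params.lo (p : Params) : Fin 3 → ℕ := ![0, p.D₁, p.D₂]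

/-- The first vertex after a class. -/
def Params.hi (p : Params) : Fin 3 → ℕ := ![p.D₁, p.D₂, p.g.S]

/-- A class and a label. -/
abbrev Vtx := Fin 3 × ℕ

/-- The registers that hold the borders of the classes. -/
def Vtx.toCon (v : Vtx) : Con := ⟨![7, 8, 9] v.1, ![8, 9, 2] v.1, v.2⟩

theorem Params.env_lo (p : Params) (dim bud bl bh : ℕ) (v : Vtx) :
    (p.env dim bud bl bh).ρ (Vtx.toCon v).lo = p.lo v.1 := by
  obtain ⟨c, l⟩ := v
  fin_cases c <;> rfl

theorem Params.env_hi (p : Params) (dim bud bl bh : ℕ) (v : Vtx) :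
    (p.env dim bud bl bh).ρ (Vtx.toCon v).hi = p.hi v.1 := by
  obtain ⟨c, l⟩ := v
  fin_cases c <;> rfl

/-- What makes a round efficient: the classes have the right sizes and degrees.  The number `β`
depends on the length of the cycles. -/
structure Params.Good (p : Params) (β : ℕ) : Prop where
  valid : p.g.Valid
  one_le_δ : 1 ≤ p.δ
  one_le_M : 1 ≤ p.M
  S_le : p.g.S ≤ 2 * p.M
  D_le : p.D₁ ≤ p.D₂
  D_le_S : p.D₂ ≤ p.g.S
  deg_le_sq : ∀ v < p.g.S, p.D₁ ≤ v → p.g.deg v ≤ p.δ ^ 2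
  deg_le : ∀ v < p.g.S, p.D₂ ≤ v → p.g.deg v ≤ p.δ
  S_le_mul : p.g.S ≤ 2 * p.δ ^ 2 * p.D₁
  D_le_mul : p.D₂ ≤ 2 * p.δ * p.D₁
  sq_le : p.D₁ * p.D₁ ≤ 10 * (p.M * p.δ ^ β)
  sq_le' : p.D₂ * p.D₂ ≤ 10 * (p.M * p.δ ^ (β + 2))

/-- What keeps all numbers below the size of a word. -/
structure Params.Word (p : Params) (b κ N B β : ℕ) : Prop where
  S_lt : p.g.S + 1 < 2 ^ b
  SS_le : p.g.S * p.g.S < 2 ^ b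
  lab_lt : ∀ v < p.g.S, p.g.lab v < 2 ^ b
  two_le : 2 ≤ N
  pow_le : N ^ κ ≤ 2 ^ b
  lt : N < 2 ^ b
  S_le_N : p.g.S ≤ N
  budget_lt : p.M * p.δ ^ (β + 4) < 2 ^ b
  double_lt : 2 * p.g.S < 2 ^ b
  one_le : 1 ≤ B
  row : RowLe p.g.adj B
  B_pow_le : B ^ 5 ≤ N

/-- The memory holds the graph and the parameters. -/
def Params.HeldBy (p : Params) (s : State b) : Prop :=
  ∃ dim bud bl bh, (p.env dim bud bl bh).HeldBy s

theorem Params.lo_le_hi {p : Params} {β : ℕ} (hp : p.Good β) (c : Fin 3) : p.lo c ≤ p.hi c := by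
  have h1 := hp.D_le
  have h2 := hp.D_le_S
  fin_cases c <;> simp [Params.lo, Params.hi] <;> omega

theorem Params.hi_le {p : Params} {β : ℕ} (hp : p.Good β) (c : Fin 3) : p.hi c ≤ p.g.S := by
  have h1 := hp.D_le
  have h2 := hp.D_le_S
  fin_cases c <;> simp [Params.hi] <;> omega

theorem Params.env_fits {p : Params} {κ N B β : ℕ} (hw : p.Word b κ N B β) (dim bud bl bh : ℕ) :
    (p.env dim bud bl bh).Fits b := ⟨hw.S_lt, hw.lab_lt⟩

theorem Params.con_fits {p : Params} {β : ℕ} (hp : p.Good β) {v : Vtx} (hv : v.2 < 2 ^ b)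
    (dim bud bl bh : ℕ) : (Vtx.toCon v).Fits (p.env dim bud bl bh) b where
  lo := by
    obtain ⟨c, l⟩ := v
    fin_cases c <;> simp [Vtx.toCon]
  hi := by
    obtain ⟨c, l⟩ := v
    fin_cases c <;> simp [Vtx.toCon]
  le := by rw [p.env_lo, p.env_hi]; exact p.lo_le_hi hp _
  le_S := by rw [p.env_hi]; exact p.hi_le hp _
  lab := hv

/-- The exponent in the bound for the degrees of a class. -/
def degExp (c : Con) : ℕ := if c.lo = 9 then 1 else 2

/-- No vertex of high degree occurs in `cs`, and the exponents add up to at most `e`. -/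
def midsOk (cs : List (Fin 3)) (e : ℕ) : Bool :=
  cs.all (fun c => c != 0) && ((cs.map fun c => if c = 2 then 1 else 2).sum ≤ e)

theorem Params.enumCost_le {p : Params} {β : ℕ} (hp : p.Good β) {dim bud bl bh : ℕ} {c h : Con}
    {vs : List Vtx} (hle : (p.env dim bud bl bh).ρ c.lo ≤ (p.env dim bud bl bh).ρ c.hi)
    (hS : (p.env dim bud bl bh).ρ c.hi ≤ p.g.S) (hl : vs.length ≤ 4) {e : ℕ}
    (he : midsOk (vs.map Prod.fst) e = true) :
    (p.env dim bud bl bh).enumCost 30 c (vs.map Vtx.toCon ++ [h]) ≤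
      (p.g.before ((p.env dim bud bl bh).ρ c.hi) - p.g.before ((p.env dim bud bl bh).ρ c.lo)) *
        (224000 * p.δ ^ e) + 6 := by
  set E := p.env dim bud bl bh with hE
  have hdl : (vs.map Vtx.toCon ++ [h]).dropLast = vs.map Vtx.toCon := by simp
  simp only [midsOk, Bool.and_eq_true, List.all_eq_true, List.mem_map, decide_eq_true_eq] at he
  have h1 := E.enumCost_le (c := c) hp.valid hp.one_le_δ degExp 30 hle hS
    (cs := vs.map Vtx.toCon ++ [h]) (by simp) ?_
  · refine h1.trans (Nat.add_le_add_right (Nat.mul_le_mul_left _ ?_) 6)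
    rw [hdl, List.length_append, List.length_map, List.length_singleton]
    have hsum : ((vs.map Vtx.toCon).map degExp).sum ≤ e := by
      refine le_trans (le_of_eq ?_) he.2
      rw [List.map_map, List.map_map]
      congr 2
      funext v
      obtain ⟨c, l⟩ := v
      fin_cases c <;> simp [degExp, Vtx.toCon]
    refine Nat.mul_le_mul ?_ (Nat.pow_le_pow_right hp.one_le_δ hsum)
    have h2 : 2 ^ (vs.length + 1) ≤ 2 ^ 5 := Nat.pow_le_pow_right (by omega) (by omega)
    have h3 : 30 + 50 * (vs.length + 1) ≤ 280 := by omega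
    calc 25 * (2 ^ (vs.length + 1) * (30 + 50 * (vs.length + 1))) ≤ 25 * (2 ^ 5 * 280) :=
          Nat.mul_le_mul_left _ (Nat.mul_le_mul h2 h3)
      _ = 224000 := by norm_num
  · rw [hdl]
    intro c' hc' v hv hok
    obtain ⟨w, hw, rfl⟩ := List.mem_map.1 hc'
    have hne := he.1 w.1 ⟨w, hw, rfl⟩
    have hlo := hok.1
    rw [p.env_lo] at hlo
    obtain ⟨c, l⟩ := w
    fin_cases c
    · simp at hne
    · exact hp.deg_le_sq v hv hlo
    · exact (hp.deg_le v hv hlo).trans_eq (by simp [degExp, Vtx.toCon])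

/-! ### Joins of short walks -/

/-- The weighted number of closed walks through a cyclic list of classes and labels. -/
def Params.value (p : Params) (vs : List Vtx) : ℕ :=
  (vs.map fun v => p.g.sel (p.lo v.1) (p.hi v.1) v.2 * p.g.adj).prod.trace

theorem Params.sel_env (p : Params) (dim bud bl bh : ℕ) (v : Vtx) :
    (p.env dim bud bl bh).sel (Vtx.toCon v) = p.g.sel (p.lo v.1) (p.hi v.1) v.2 := by
  obtain ⟨c, l⟩ := v
  fin_cases c <;> rfl

theorem Params.prodMat_env (p : Params) (dim bud bl bh : ℕ) (vs : List Vtx) :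
    (p.env dim bud bl bh).prodMat (vs.map Vtx.toCon) =
      (vs.map fun v => p.g.sel (p.lo v.1) (p.hi v.1) v.2 * p.g.adj).prod := by
  rw [Env.prodMat, List.map_map]
  congr 2
  funext v
  rw [Function.comp, p.sel_env]
  rfl

/-- The split of a list of vertices into parts. -/
abbrev VParts := List (Vtx × List Vtx)

/-- A part, with registers for the borders of the classes. -/
def toPart (d : Vtx × List Vtx) : Con × List Con := (Vtx.toCon d.1, d.2.map Vtx.toCon)

theorem flat_map_toPart (ps : VParts) : flat (ps.map toPart) = (flat ps).map Vtx.toCon := by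
  induction ps with
  | nil => rfl
  | cons d ps ih =>
    have h1 : flat (d :: ps) = d.1 :: d.2 ++ flat ps := rfl
    have h2 : flat ((d :: ps).map toPart) = Vtx.toCon d.1 :: d.2.map Vtx.toCon ++
      flat (ps.map toPart) := rfl
    rw [h1, h2, ih]
    simp

/-- The program that joins two short walks. -/
def joinProg (c : Vtx) (cs : List Vtx) (h : Vtx) (ds : List Vtx) : Program :=
  hashJoin (Vtx.toCon c) (cs.map Vtx.toCon) (Vtx.toCon h) (ds.map Vtx.toCon)

theorem joinProg_spec {p : Params} {κ N B β : ℕ} (hp : p.Good β) (hw : p.Word b κ N B β)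
    {c h : Vtx} {cs ds : List Vtx} (hlab : ∀ v ∈ flat [(c, cs), (h, ds)], v.2 < 2 ^ b)
    (hcs : midsOk (cs.map Prod.fst) 2 = true) (hds : midsOk (ds.map Prod.fst) 2 = true)
    (hcl : cs.length ≤ 4) (hdl : ds.length ≤ 4) (s : State b) (hs : p.HeldBy s) :
    Tri (joinProg c cs h ds) s (4000000 * (p.M * p.δ ^ 2)) (fun s' =>
      p.HeldBy s' ∧ s'.reg 12 = s.reg 12 ∧
      s'.reg 13 = s.reg 13 + BitVec.ofNat b (p.value (flat [(c, cs), (h, ds)]))) := by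
  obtain ⟨dim, bud, bl, bh, hE⟩ := hs
  set E := p.env dim bud bl bh with hEdef
  have hfit : ∀ v ∈ flat [(c, cs), (h, ds)], (Vtx.toCon v).Fits E b := fun v hv =>
    p.con_fits hp (hlab v hv) _ _ _ _
  have hcf := hfit c (by simp [flat])
  have hhf := hfit h (by simp [flat])
  have hsf : SegFits b E (Vtx.toCon c) (cs.map Vtx.toCon) (Vtx.toCon h) :=
    ⟨hp.valid, p.env_fits hw _ _ _ _, hcf, fun c' hc' => by
      obtain ⟨v, hv, rfl⟩ := List.mem_map.1 hc'
      exact hfit v (by simp [flat, hv]), hhf⟩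
  have hbefore : ∀ x y, x ≤ p.g.S → p.g.before x - p.g.before y ≤ 4 * p.M := fun x y hx => by
    have := hp.valid.before_le hx
    have := hp.S_le
    omega
  have hcost : ∀ {c h : Con} {vs : List Vtx}, c.Fits E b → vs.length ≤ 4 →
      midsOk (vs.map Prod.fst) 2 = true →
      E.enumCost 30 c (vs.map Vtx.toCon ++ [h]) ≤ 1000000 * (p.M * p.δ ^ 2) := by
    intro c h vs hc hl hm
    refine (p.enumCost_le hp hc.le hc.le_S hl hm).trans ?_
    refine (Nat.add_le_add_right (Nat.mul_le_mul_right _ (hbefore _ _ hc.le_S)) 6).trans ?_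
    have : 1 ≤ p.M * p.δ ^ 2 := Nat.mul_pos hp.one_le_M (Nat.one_le_pow _ _ hp.one_le_δ)
    nlinarith
  refine (hashJoin_spec hsf (fun c' hc' => by
      obtain ⟨v, hv, rfl⟩ := List.mem_map.1 hc'
      exact hfit v (by simp [flat, hv])) hw.SS_le.le rfl s hE).mono ?_ fun s' hf h' => ?_
  · have h1 := hcost (h := Vtx.toCon h) hcf hcl hcs
    have h2 := hcost (h := Vtx.toCon c) hhf hdl hds
    omega
  · refine ⟨⟨dim, bud, bl, bh, hE.frame hf (fun r hr => by have := hashJoin_wr hr; omega)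
      (fun a ha => by have := hashJoin_wa ha; omega)⟩, hf.1 12 fun hr => by
        have := hashJoin_wr hr; omega, ?_⟩
    rw [h']
    have h1 := E.trace_chain (Vtx.toCon c) (cs.map Vtx.toCon) (Vtx.toCon h) (ds.map Vtx.toCon) []
    have h2 : flat ([(Vtx.toCon c, cs.map Vtx.toCon), (Vtx.toCon h, ds.map Vtx.toCon)]) =
      (flat [(c, cs), (h, ds)]).map Vtx.toCon := flat_map_toPart [(c, cs), (h, ds)]
    rw [h2, Env.cyc, hEdef, p.prodMat_env] at h1
    exact congrArg (fun x => s.reg 13 + BitVec.ofNat b x) h1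

/-! ### Chains of products of matrices -/

/-- The exponent `e` of the time limit `M * δ ^ e` for a multiplication.  The matrices have the size
`D₂` if `d` is true, and `D₁` otherwise. -/
def budExp (β : ℕ) (d : Bool) : ℕ := β + if d then 2 else 0

/-- The size of the matrices. -/
def Params.dim (p : Params) (d : Bool) : ℕ := if d then p.D₂ else p.D₁

/-- A class of vertices is split into at most `2 * δ ^ nbExp d c` blocks; vertices of low degree are
never split into blocks of size `D₂`, and get a forbidding exponent there. -/
def nbExp (d : Bool) (c : Fin 3) : ℕ := if d then (if c = 2 then 9 else 0) else c

/-- The class fits into a single block. -/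
def dimOk (d : Bool) (c : Fin 3) : Bool := c = 0 || (d && c != 2)

/-- The conditions under which the time for a chain of products is `O(M * δ ^ 2)`. -/
def chainOk (β : ℕ) (d : Bool) (c : Fin 3) (cs : List (Fin 3))
    (rest : List (Fin 3 × List (Fin 3))) : Bool :=
  decide (nbExp d c + budExp β d ≤ 2) && midsOk cs 2 &&
    rest.all fun q => dimOk d q.1 && midsOk q.2 (2 - nbExp d c)

/-- The classes of the vertices of a part. -/
def classes (q : Vtx × List Vtx) : Fin 3 × List (Fin 3) := (q.1.1, q.2.map Prod.fst)

/-- The time limit `M * δ ^ e`. -/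
def budgetExpr : ℕ → Expr
  | 0 => .reg 3
  | e + 1 => .op .mul (budgetExpr e) (.reg 4)

/-- Add the weighted number of closed walks through a cyclic list of classes and labels to the
total, by products of matrices.  The first vertex runs through blocks of the size of the matrices,
with the borders in the registers `10` and `11`. -/
def blockProg (P : Program) (β : ℕ) (d : Bool) (c₁ : Vtx) (cs₁ : List Vtx) (c₂ : Vtx)
    (cs₂ : List Vtx) (rest : VParts) : Program :=
  .seq (.assign 5 (.reg (if d then 9 else 8))) <|
  .seq (.assign 6 (budgetExpr (budExp β d))) <|
  .seq (.assign 10 (.reg (Vtx.toCon c₁).lo)) <|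
  .loop (.op .lt (.reg 10) (.reg (Vtx.toCon c₁).hi)) <|
    .seq (.assign 11 (.op .add (.reg 10) (.reg 5))) <|
    .seq (.cond (.op .lt (.reg (Vtx.toCon c₁).hi) (.reg 11))
      (.assign 11 (.reg (Vtx.toCon c₁).hi)) .skip) <|
    .seq (matChain P ⟨10, 11, c₁.2⟩ (cs₁.map Vtx.toCon) (Vtx.toCon c₂) (cs₂.map Vtx.toCon)
      (rest.map toPart)) (.assign 10 (.reg 11))

theorem budgetExpr_cost (e : ℕ) : (budgetExpr e).cost = 2 * e + 1 := by
  induction e with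
  | zero => rfl
  | succ e ih => rw [budgetExpr, Expr.cost, ih]; simp [Expr.cost]; omega

theorem budgetExpr_eval {M δ : ℕ} {s : State b} (h3 : s.reg 3 = BitVec.ofNat b M)
    (h4 : s.reg 4 = BitVec.ofNat b δ) (e : ℕ) :
    (budgetExpr e).eval s = BitVec.ofNat b (M * δ ^ e) := by
  induction e with
  | zero => simpa [budgetExpr, Expr.eval] using h3
  | succ e ih =>
    simp only [budgetExpr, Expr.eval, Op.eval] at ih ⊢
    rw [ih, h4, ← BitVec.ofNat_mul, pow_succ, mul_assoc]

theorem chainLen_eq (cs : List Con) (rest : Parts) :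
    chainLen cs rest = cs.length + 1 + (flat rest).length := by
  induction rest generalizing cs with
  | nil => simp [chainLen, flat]
  | cons d rest ih =>
    obtain ⟨c', cs'⟩ := d
    rw [chainLen, ih]
    simp [flat]
    omega

theorem length_lt_flat {α : Type*} {q : α × List α} {ps : List (α × List α)} (hq : q ∈ ps) :
    q.2.length < (flat ps).length := by
  induction ps with
  | nil => simp at hq
  | cons d ps ih =>
    have h1 : (flat (d :: ps)).length = d.2.length + 1 + (flat ps).length := by
      simp [flat]; omega
    rcases List.mem_cons.1 hq with rfl | hq
    · omega
    · have := ih hq; omega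

theorem Env.chainCost_le {E : Env} {X Y : ℕ} {c₁ : Con} (rest : Parts) : ∀ (c : Con)
    (cs : List Con), (∀ d ∈ (c, cs) :: rest, ∀ h, E.enumCost 30 d.1 (d.2 ++ [h]) ≤ Y) →
    E.chainCost X c₁ c cs rest ≤ (rest.length + 1) * Y + rest.length * X := by
  induction rest with
  | nil => intro c cs h; simpa [Env.chainCost] using h (c, cs) (by simp) c₁
  | cons d rest ih =>
    intro c cs h
    obtain ⟨c', cs'⟩ := d
    have h1 := h (c, cs) (by simp) c'
    have h2 := ih c' cs' fun d hd => h d (by simp only [List.mem_cons] at hd ⊢; tauto)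
    rw [Env.chainCost, List.length_cons]
    simp only at h1
    nlinarith

theorem sum_range_sub_le {f : ℕ → ℕ} (n : ℕ) (hf : ∀ k < n, f k ≤ f (k + 1)) :
    ∑ k ∈ Finset.range n, (f (k + 1) - f k) ≤ f n := by
  induction n with
  | zero => simp
  | succ n ih =>
    rw [Finset.sum_range_succ]
    have := ih fun k hk => hf k (by omega)
    have := hf n (by omega)
    omega

theorem Params.env_setReg {p : Params} {dim bud bl bh dim' bud' bl' bh' : ℕ} {s : State b} {r x : ℕ}
    (h : (p.env dim bud bl bh).HeldBy s) (hx : (p.env dim' bud' bl' bh').ρ r = x)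
    (hne : ∀ r', r' ≠ r → (p.env dim' bud' bl' bh').ρ r' = (p.env dim bud bl bh).ρ r') :
    (p.env dim' bud' bl' bh').HeldBy (s.setReg r (BitVec.ofNat b x)) where
  reg r' h1 h2 := by
    rw [State.setReg_reg]
    split_ifs with hr
    · rw [hr, hx]
    · rw [h.reg r' h1 h2, hne r' hr]
  off := h.off
  tgt := h.tgt
  wt := h.wt
  lab := h.lab

theorem Params.ne_reg {p : Params} {dim bud bl bh dim' bud' bl' bh' r : ℕ}
    (h5 : r ≠ 5 → dim' = dim) (h6 : r ≠ 6 → bud' = bud) (h10 : r ≠ 10 → bl' = bl)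
    (h11 : r ≠ 11 → bh' = bh) : ∀ r', r' ≠ r →
    (p.env dim' bud' bl' bh').ρ r' = (p.env dim bud bl bh).ρ r' := by
  intro r' hr'
  simp only [Params.env]
  split
  all_goals first
    | rfl
    | exact h5 (Ne.symm hr')
    | exact h6 (Ne.symm hr')
    | exact h10 (Ne.symm hr')
    | exact h11 (Ne.symm hr')

/-- A factor for the time of a chain of products. -/
noncomputable def chainFactor (P : Program) (n : ℕ) : ℕ :=
  1100000 + (n + 1) * (4 * clockFactor P + 2000000)

theorem Params.dim_le {p : Params} {β : ℕ} (hp : p.Good β) (d : Bool) : p.dim d ≤ p.g.S := by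
  have h1 := hp.D_le
  have h2 := hp.D_le_S
  cases d <;> simp [Params.dim] <;> omega

/-- A class is covered by `2 * δ ^ nbExp d c` blocks of the size of the matrices. -/
theorem Params.hi_le_add {p : Params} {β : ℕ} (hp : p.Good β) {d : Bool} {c : Fin 3}
    (h : nbExp d c ≤ 2) : p.hi c ≤ p.lo c + 2 * p.δ ^ nbExp d c * p.dim d := by
  have h1 := hp.D_le
  have h2 := hp.S_le_mul
  have h3 := hp.D_le_mul
  cases d <;> fin_cases c <;> simp [Params.hi, Params.lo, Params.dim, nbExp] at h ⊢ <;> omega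

theorem Params.small {p : Params} {β : ℕ} (hp : p.Good β) {d : Bool} {v : Vtx}
    (h : dimOk d v.1 = true) (hl : v.2 < 2 ^ b) (bud bl bh : ℕ) :
    (Vtx.toCon v).Small (p.env (p.dim d) bud bl bh) b where
  toFits := p.con_fits hp hl _ _ _ _
  small := by
    rw [p.env_lo, p.env_hi]
    have h1 := hp.D_le
    obtain ⟨c, l⟩ := v
    cases d <;> fin_cases c <;> simp [dimOk] at h <;>
      simp [Params.hi, Params.lo, Params.dim, Params.env] <;> omega

theorem Params.sq_dim_le {p : Params} {β : ℕ} (hp : p.Good β) (d : Bool) :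
    p.dim d * p.dim d ≤ 10 * (p.M * p.δ ^ budExp β d) := by
  cases d
  · simpa [Params.dim, budExp] using hp.sq_le
  · simpa [Params.dim, budExp] using hp.sq_le'

theorem Params.pow_budExp_le {p : Params} {β : ℕ} (hp : p.Good β) (d : Bool) :
    p.M * p.δ ^ budExp β d ≤ p.M * p.δ ^ (β + 4) := by
  refine Nat.mul_le_mul_left _ (Nat.pow_le_pow_right hp.one_le_δ ?_)
  cases d
  · simp [budExp]
  · simp [budExp]

theorem Params.mulFits {p : Params} {κ N B β : ℕ} (hp : p.Good β) (hw : p.Word b κ N B β)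
    (d : Bool) (bl bh : ℕ) :
    MulFits b (p.env (p.dim d) (p.M * p.δ ^ budExp β d) bl bh) κ N B where
  valid := hp.valid
  fits := p.env_fits hw _ _ _ _
  block := lt_of_le_of_lt (Nat.mul_le_mul (p.dim_le hp d) (p.dim_le hp d)) hw.SS_le
  two_le := hw.two_le
  pow_le := hw.pow_le
  lt := hw.lt
  block_le := (p.dim_le hp d).trans hw.S_le_N
  budget_lt := (p.pow_budExp_le hp d).trans_lt hw.budget_lt
  one_le := hw.one_le
  row := hw.row

/-- The time for a round of the loop over the blocks of the first vertex. -/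
noncomputable def Params.roundCost (p : Params) (P : Program) (β : ℕ) (d : Bool) (c₁ : Vtx) (n : ℕ)
    (x y : ℕ) : ℕ :=
  (p.g.before y - p.g.before x) * (224000 * p.δ ^ 2) + 26 +
    (n + 1) * (4 * p.M * (224000 * p.δ ^ (2 - nbExp d c₁.1)) + 6 +
      (clockFactor P * (p.M * p.δ ^ budExp β d + 1) + 27 * (p.dim d * p.dim d) + 30))

theorem blockRound_spec {P : Program} {κ : ℕ} {tm : ℕ → ℕ} (hP : Multiplies P κ tm) {p : Params}
    {N B β : ℕ} (hp : p.Good β) (hw : p.Word b κ N B β) {d : Bool} {c₁ c₂ : Vtx}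
    {cs₁ cs₂ : List Vtx} {rest : VParts}
    (hlab : ∀ v ∈ flat ((c₁, cs₁) :: (c₂, cs₂) :: rest), v.2 < 2 ^ b)
    (hlen : (flat ((c₁, cs₁) :: (c₂, cs₂) :: rest)).length ≤ 5)
    (hok : chainOk β d c₁.1 (cs₁.map Prod.fst) (((c₂, cs₂) :: rest).map classes) = true)
    {x y bh : ℕ} (hxy : x ≤ y) (hy : y ≤ p.g.S) (hyx : y ≤ x + p.dim d) (hbh : bh = y)
    (s : State b) (hE : (p.env (p.dim d) (p.M * p.δ ^ budExp β d) x bh).HeldBy s) :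
    Tri (matChain P ⟨10, 11, c₁.2⟩ (cs₁.map Vtx.toCon) (Vtx.toCon c₂) (cs₂.map Vtx.toCon)
      (rest.map toPart)) s (p.roundCost P β d c₁ (rest.length + 1) x y - 20) (fun s' =>
      (s'.reg 12 = 0 ∨ s'.reg 13 = s.reg 13 + BitVec.ofNat b
        (p.g.sel x y c₁.2 * (p.g.adj * ((cs₁ ++ flat ((c₂, cs₂) :: rest)).map fun v =>
          p.g.sel (p.lo v.1) (p.hi v.1) v.2 * p.g.adj).prod)).trace) ∧
      (s'.reg 12 = 0 ∨ s'.reg 12 = s.reg 12) ∧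
      (tm (p.dim d) < p.M * p.δ ^ budExp β d → s'.reg 12 = s.reg 12)) := by
  subst hbh
  set E := p.env (p.dim d) (p.M * p.δ ^ budExp β d) x bh with hEdef
  simp only [chainOk, Bool.and_eq_true, List.all_eq_true, decide_eq_true_eq] at hok
  obtain ⟨⟨hnb, hm1⟩, hrest⟩ := hok
  have hsm : ∀ q ∈ (c₂, cs₂) :: rest, (Vtx.toCon q.1).Small E b := fun q hq =>
    p.small hp (hrest _ (List.mem_map_of_mem hq)).1 (hlab _ (by
      have : q.1 ∈ flat ((c₂, cs₂) :: rest) := List.mem_flatMap.2 ⟨q, hq, by simp⟩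
      exact List.mem_append_right _ this)) _ _ _
  have hft : ∀ q ∈ (c₁, cs₁) :: (c₂, cs₂) :: rest, ∀ c ∈ q.2.map Vtx.toCon, c.Fits E b := by
    intro q hq c hc
    obtain ⟨v, hv, rfl⟩ := List.mem_map.1 hc
    exact p.con_fits hp (hlab v (List.mem_flatMap.2 ⟨q, hq, by simp [hv]⟩)) _ _ _ _
  have hmid : ∀ q ∈ (c₂, cs₂) :: rest, midsOk (q.2.map Prod.fst) (2 - nbExp d c₁.1) = true :=
    fun q hq => (hrest _ (List.mem_map_of_mem hq)).2
  have hlenq : ∀ q ∈ (c₁, cs₁) :: (c₂, cs₂) :: rest, q.2.length ≤ 4 := by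
    intro q hq
    have := length_lt_flat hq
    omega
  have hc₁ : (⟨10, 11, c₁.2⟩ : Con).Small E b :=
    { lo := by simp
      hi := by simp
      le := hxy
      le_S := hy
      lab := hlab c₁ (by simp [flat])
      small := hyx }
  refine (matChain_spec hP (p.mulFits hp hw d x bh) hc₁ (hft (c₁, cs₁) (by simp)) (hsm (c₂, cs₂) (by simp))
    (hft (c₂, cs₂) (by simp)) (rest := rest.map toPart) ?_ ?_ s hE).mono ?_ fun s' _ h => ?_
  · intro q hq
    obtain ⟨q', hq', rfl⟩ := List.mem_map.1 hq
    exact ⟨hsm q' (by simp [hq']), hft q' (by simp [hq'])⟩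
  · refine le_trans (Nat.pow_le_pow_right hw.one_le ?_) hw.B_pow_le
    rw [chainLen_eq, flat_map_toPart]
    simp [flat] at hlen ⊢
    omega
  · -- the time
    have h1 := p.enumCost_le hp (dim := p.dim d) (bud := p.M * p.δ ^ budExp β d) (bl := x) (bh := bh)
      (c := ⟨10, 11, c₁.2⟩) (h := Vtx.toCon c₂) hxy hy (hlenq (c₁, cs₁) (by simp)) hm1
    have h2 := Env.chainCost_le (E := E) (X := E.mulCost P) (c₁ := ⟨10, 11, c₁.2⟩)
      (Y := 4 * p.M * (224000 * p.δ ^ (2 - nbExp d c₁.1)) + 6)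
      (rest.map toPart) (Vtx.toCon c₂) (cs₂.map Vtx.toCon) (by
        intro q hq h
        change q ∈ ((c₂, cs₂) :: rest).map toPart at hq
        obtain ⟨q', hq', rfl⟩ := List.mem_map.1 hq
        have hS := (hsm q' hq').le_S
        refine (p.enumCost_le hp (c := Vtx.toCon q'.1) (hsm q' hq').le hS
          (hlenq q' (List.mem_cons_of_mem _ hq')) (hmid q' hq')).trans ?_
        refine Nat.add_le_add_right (Nat.mul_le_mul_right _ ?_) 6
        have h1 := hp.valid.before_le hS
        have h2 := hp.S_le
        refine (Nat.sub_le _ _).trans (h1.trans ?_)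
        change 2 * p.g.S ≤ _
        omega)
    have h3 : E.mulCost P = clockFactor P * (p.M * p.δ ^ budExp β d + 1) +
      27 * (p.dim d * p.dim d) + 30 := rfl
    rw [List.length_map] at h2
    rw [Params.roundCost, ← h3]
    have h4 : E.ρ 11 = bh := rfl
    have h5 : E.ρ 10 = x := rfl
    change E.enumCost 30 _ _ ≤ (p.g.before (E.ρ 11) - p.g.before (E.ρ 10)) * _ + 6 at h1
    rw [h4, h5] at h1
    set Y := 4 * p.M * (224000 * p.δ ^ (2 - nbExp d c₁.1)) + 6
    set W := (p.g.before bh - p.g.before x) * (224000 * p.δ ^ 2)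
    have h6 : E.mulCost P + ((rest.length + 1) * Y + rest.length * E.mulCost P) ≤
        (rest.length + 1 + 1) * (Y + E.mulCost P) := by nlinarith [Nat.zero_le Y]
    refine le_trans (Nat.add_le_add (Nat.add_le_add h1 le_rfl) h2) ?_
    change W + 6 + E.mulCost P + ((rest.length + 1) * Y + rest.length * E.mulCost P) ≤ _
    omega
  · have h1 := E.trace_chain ⟨10, 11, c₁.2⟩ (cs₁.map Vtx.toCon) (Vtx.toCon c₂)
      (cs₂.map Vtx.toCon) (rest.map toPart)
    have h2 : flat ((⟨10, 11, c₁.2⟩, cs₁.map Vtx.toCon) :: (Vtx.toCon c₂, cs₂.map Vtx.toCon) ::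
        rest.map toPart) = ⟨10, 11, c₁.2⟩ :: (cs₁ ++ flat ((c₂, cs₂) :: rest)).map Vtx.toCon := by
      have h3 : flat (toPart (c₂, cs₂) :: rest.map toPart) = _ := flat_map_toPart ((c₂, cs₂) :: rest)
      rw [List.map_append, ← h3]
      rfl
    rw [h2, Env.cyc_cons, hEdef, p.prodMat_env] at h1
    rw [h1] at h
    exact h

/-- The enumerations that start in the blocks add up to a single one over the whole class, and the
rest of the cost is the number of blocks times that of a round. -/
theorem Params.sum_roundCost_le {p : Params} {β : ℕ} (hp : p.Good β) (P : Program) {d : Bool}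
    {c₁ : Vtx} (h : nbExp d c₁.1 + budExp β d ≤ 2) (n : ℕ) {x : ℕ → ℕ} (hx : Monotone x)
    (hS : ∀ k, x k ≤ p.g.S) :
    (∑ k ∈ Finset.range (2 * p.δ ^ nbExp d c₁.1), (p.roundCost P β d c₁ n (x k) (x (k + 1)) + 4)) +
      20 ≤ chainFactor P n * (p.M * p.δ ^ 2) := by
  have hδ := hp.one_le_δ
  have hM := hp.one_le_M
  set X := p.M * p.δ ^ 2 with hX
  set e := nbExp d c₁.1 with he
  have hX1 : 1 ≤ X := Nat.mul_pos hM (Nat.one_le_pow _ _ hδ)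
  have h1 : p.δ ^ e * (p.M * p.δ ^ (2 - e)) = X := by
    rw [hX, mul_left_comm, ← pow_add, Nat.add_sub_cancel' (by omega)]
  have h2 : p.δ ^ e * (p.M * p.δ ^ budExp β d) ≤ X := by
    rw [hX, mul_left_comm, ← pow_add]
    exact Nat.mul_le_mul_left _ (Nat.pow_le_pow_right hδ h)
  have h3 : p.δ ^ e ≤ X := by
    calc p.δ ^ e ≤ p.δ ^ 2 := Nat.pow_le_pow_right hδ (by omega)
      _ ≤ X := Nat.le_mul_of_pos_left _ hM
  have h4 : ∑ k ∈ Finset.range (2 * p.δ ^ e), (p.g.before (x (k + 1)) - p.g.before (x k)) ≤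
      4 * p.M := by
    refine (sum_range_sub_le _ fun k _ => hp.valid.before_mono (hx (Nat.le_succ k)) (hS _)).trans ?_
    have h5 := hp.valid.before_le (hS (2 * p.δ ^ e))
    have h6 := hp.S_le
    omega
  have h5 := p.sq_dim_le hp d
  simp only [Params.roundCost, ← he]
  rw [Finset.sum_add_distrib, Finset.sum_add_distrib, Finset.sum_add_distrib, ← Finset.sum_mul,
    Finset.sum_const, Finset.sum_const, Finset.sum_const, Finset.card_range]
  simp only [smul_eq_mul]
  set T := ∑ k ∈ Finset.range (2 * p.δ ^ e), (p.g.before (x (k + 1)) - p.g.before (x k))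
  set cf := clockFactor P
  have h6 : T * (224000 * p.δ ^ 2) ≤ 896000 * X := by
    rw [hX]; nlinarith [Nat.mul_le_mul_right (224000 * p.δ ^ 2) h4]
  set z := p.M * p.δ ^ budExp β d with hz
  have h7 : p.δ ^ e * (4 * p.M * (224000 * p.δ ^ (2 - e)) + 6 +
      (cf * (z + 1) + 27 * (p.dim d * p.dim d) + 30)) ≤
      896000 * X + 6 * X + (2 * cf * X + 270 * X + 30 * X) := by
    have i1 : p.δ ^ e * (4 * p.M * (224000 * p.δ ^ (2 - e))) = 896000 * X := by rw [← h1]; ring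
    have i2 : p.δ ^ e * (cf * (z + 1)) ≤ 2 * cf * X := by
      calc p.δ ^ e * (cf * (z + 1)) = cf * (p.δ ^ e * z + p.δ ^ e) := by ring
        _ ≤ cf * (X + X) := Nat.mul_le_mul_left _ (by omega)
        _ = 2 * cf * X := by ring
    have i3 : p.δ ^ e * (27 * (p.dim d * p.dim d)) ≤ 270 * X := by
      calc p.δ ^ e * (27 * (p.dim d * p.dim d)) ≤ p.δ ^ e * (27 * (10 * z)) := by gcongr
        _ = 270 * (p.δ ^ e * z) := by ring
        _ ≤ 270 * X := Nat.mul_le_mul_left _ h2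
    rw [mul_add, mul_add, mul_add, mul_add]
    omega
  set R := 4 * p.M * (224000 * p.δ ^ (2 - e)) + 6 + (cf * (z + 1) + 27 * (p.dim d * p.dim d) + 30)
  have h8 : 2 * p.δ ^ e * ((n + 1) * R) ≤
      2 * ((n + 1) * (896000 * X + 6 * X + (2 * cf * X + 270 * X + 30 * X))) := by
    calc 2 * p.δ ^ e * ((n + 1) * R) = 2 * ((n + 1) * (p.δ ^ e * R)) := by ring
      _ ≤ _ := Nat.mul_le_mul_left _ (Nat.mul_le_mul_left _ h7)
  rw [chainFactor]
  nlinarith [Nat.zero_le (n * X), Nat.zero_le (n * (cf * X))]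

/-- Register `12` is the flag of success: it never changes except to `0`, and does not change if the
time limit is sufficient; the total is correct unless the flag is `0`. -/
theorem blockProg_spec {P : Program} {κ : ℕ} {tm : ℕ → ℕ} (hP : Multiplies P κ tm) {p : Params}
    {N B β : ℕ} (hp : p.Good β) (hw : p.Word b κ N B β) {d : Bool} {c₁ c₂ : Vtx}
    {cs₁ cs₂ : List Vtx} {rest : VParts}
    (hlab : ∀ v ∈ flat ((c₁, cs₁) :: (c₂, cs₂) :: rest), v.2 < 2 ^ b)
    (hlen : (flat ((c₁, cs₁) :: (c₂, cs₂) :: rest)).length ≤ 5)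
    (hok : chainOk β d c₁.1 (cs₁.map Prod.fst) (((c₂, cs₂) :: rest).map classes) = true)
    (s : State b) (hs : p.HeldBy s) :
    Tri (blockProg P β d c₁ cs₁ c₂ cs₂ rest) s
      (chainFactor P (rest.length + 1) * (p.M * p.δ ^ 2)) (fun s' => p.HeldBy s' ∧
      (s'.reg 12 = 0 ∨ s'.reg 13 = s.reg 13 +
        BitVec.ofNat b (p.value (flat ((c₁, cs₁) :: (c₂, cs₂) :: rest)))) ∧
      (s'.reg 12 = 0 ∨ s'.reg 12 = s.reg 12) ∧
      (tm (p.dim d) < p.M * p.δ ^ budExp β d → s'.reg 12 = s.reg 12)) := by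
  have hnb : nbExp d c₁.1 + budExp β d ≤ 2 := by
    simp only [chainOk, Bool.and_eq_true, decide_eq_true_eq] at hok
    exact hok.1.1
  obtain ⟨dim₀, bud₀, bl₀, bh₀, hE⟩ := hs
  set D := p.dim d with hD
  set bud := p.M * p.δ ^ budExp β d with hbud
  set lo := p.lo c₁.1 with hlo
  set hi := p.hi c₁.1 with hhi
  have hlohi : lo ≤ hi := p.lo_le_hi hp _
  have hhiS : hi ≤ p.g.S := p.hi_le hp _
  have hDS : D ≤ p.g.S := p.dim_le hp d
  have hSb := hw.double_lt
  have hnbhi : hi ≤ lo + 2 * p.δ ^ nbExp d c₁.1 * D := p.hi_le_add hp (by omega)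
  set n := 2 * p.δ ^ nbExp d c₁.1 with hn
  -- the borders of the blocks
  set x : ℕ → ℕ := fun k => min (lo + k * D) hi with hx
  have hxmono : Monotone x := fun i j hij =>
    min_le_min_right _ (Nat.add_le_add_left (Nat.mul_le_mul_right _ hij) _)
  have hxS : ∀ k, x k ≤ p.g.S := fun k => (min_le_right _ _).trans hhiS
  have hx0 : x 0 = lo := by simp [hx, hlohi]
  set W := p.g.adj * ((cs₁ ++ flat ((c₂, cs₂) :: rest)).map fun v =>
    p.g.sel (p.lo v.1) (p.hi v.1) v.2 * p.g.adj).prod with hW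
  set V : ℕ → ℕ → ℕ := fun y z => (p.g.sel y z c₁.2 * W).trace with hV
  have hVadd : ∀ {y z w}, y ≤ z → z ≤ w → V y z + V z w = V y w := fun h1 h2 => by
    simp only [hV]
    rw [← Matrix.trace_add, ← Matrix.add_mul, p.g.sel_add_sel h1 h2]
  set E₁ := p.env D bud₀ bl₀ bh₀ with hE₁
  set s₁ := s.setReg 5 ((Expr.reg (if d then 9 else 8)).eval s) with hs₁
  have h₁ : E₁.HeldBy s₁ := by
    have : (Expr.reg (if d then 9 else 8)).eval s = BitVec.ofNat b D := by
      cases d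
      · exact hE.reg 8 (by omega) (by omega)
      · exact hE.reg 9 (by omega) (by omega)
    rw [hs₁, this]
    exact p.env_setReg hE rfl (p.ne_reg (fun h => absurd rfl h) (fun _ => rfl) (fun _ => rfl)
      (fun _ => rfl))
  set s₂ := s₁.setReg 6 ((budgetExpr (budExp β d)).eval s₁) with hs₂
  have h₂ : (p.env D bud bl₀ bh₀).HeldBy s₂ := by
    rw [hs₂, budgetExpr_eval (h₁.reg 3 (by omega) (by omega)) (h₁.reg 4 (by omega) (by omega))]
    exact p.env_setReg h₁ rfl (p.ne_reg (fun _ => rfl) (fun h => absurd rfl h) (fun _ => rfl)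
      (fun _ => rfl))
  set s₃ := s₂.setReg 10 ((Expr.reg (Vtx.toCon c₁).lo).eval s₂) with hs₃
  have h₃ : (p.env D bud lo bh₀).HeldBy s₃ := by
    have hfit := p.con_fits hp (hlab c₁ (by simp [flat])) D bud bl₀ bh₀
    have : (Expr.reg (Vtx.toCon c₁).lo).eval s₂ = BitVec.ofNat b lo := by
      rw [Expr.eval, h₂.reg _ hfit.lo.1 hfit.lo.2, p.env_lo]
    rw [hs₃, this]
    exact p.env_setReg h₂ rfl (p.ne_reg (fun _ => rfl) (fun _ => rfl) (fun h => absurd rfl h)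
      (fun _ => rfl))
  have hbe : budExp β d ≤ 2 := by omega
  have hcost := p.sum_roundCost_le hp P hnb (rest.length + 1) hxmono hxS
  set Z := ∑ k ∈ Finset.range n, (p.roundCost P β d c₁ (rest.length + 1) (x k) (x (k + 1)) + 4)
    with hZ
  refine Tri.assign_seq (T₂ := Z + 4 + 2 + (2 * budExp β d + 2)) (Tri.assign_seq (T₂ := Z + 4 + 2)
    (Tri.assign_seq (T₂ := Z + 4) ?_ ?_) ?_) ?_
  rotate_left
  · simp only [Expr.cost]; omega
  · simp only [budgetExpr_cost]; omega
  · simp only [Expr.cost]; omega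
  refine (Tri.loop (I := fun k s' => (∃ bh, (p.env D bud (x k) bh).HeldBy s') ∧
      (s'.reg 12 = 0 ∨ s'.reg 13 = s.reg 13 + BitVec.ofNat b (V lo (x k))) ∧
      (s'.reg 12 = 0 ∨ s'.reg 12 = s.reg 12) ∧ (tm D < bud → s'.reg 12 = s.reg 12))
    (T := fun k => p.roundCost P β d c₁ (rest.length + 1) (x k) (x (k + 1))) (k₀ := 0) (n := n)
    (Nat.zero_le _) ?_ ?_ (Q := fun s' => p.HeldBy s' ∧
      (s'.reg 12 = 0 ∨ s'.reg 13 = s.reg 13 +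
        BitVec.ofNat b (p.value (flat ((c₁, cs₁) :: (c₂, cs₂) :: rest)))) ∧
      (s'.reg 12 = 0 ∨ s'.reg 12 = s.reg 12) ∧
      (tm D < bud → s'.reg 12 = s.reg 12))).mono ?_ (fun _ _ h => h)
  · have h12 : s₃.reg 12 = s.reg 12 := by simp [hs₃, hs₂, hs₁]
    have h13 : s₃.reg 13 = s.reg 13 := by simp [hs₃, hs₂, hs₁]
    refine ⟨⟨bh₀, by rw [hx0]; exact h₃⟩, Or.inr ?_, Or.inr h12, fun _ => h12⟩
    rw [h13, hx0]
    simp [hV, Csr.sel_self]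
  · rintro k s' - hk - ⟨⟨bh, hE'⟩, i1, i2, i3⟩
    have hfit := p.con_fits hp (hlab c₁ (by simp [flat])) D bud (x k) bh
    have hrhi : s'.reg (Vtx.toCon c₁).hi = BitVec.ofNat b hi := by
      rw [hE'.reg _ hfit.hi.1 hfit.hi.2, p.env_hi]
    have hxkS := hxS k
    have hguard := lt_eval_ne_zero (e := .reg 10) (f := .reg (Vtx.toCon c₁).hi) (s := s') (x := x k)
      (y := hi) (by omega) (by omega) (hE'.reg 10 (by omega) (by omega)) hrhi
    by_cases hlt : x k < hi
    · right
      have hkn : k < n := by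
        refine lt_of_le_of_ne hk ?_
        rintro rfl
        simp only [hx, min_lt_iff] at hlt
        omega
      have hxk : x k = lo + k * D := by
        simp only [hx, min_lt_iff] at hlt ⊢; omega
      have hxk1 : x (k + 1) = min (x k + D) hi := by
        rw [hxk]; simp only [hx]; congr 1; ring
      refine ⟨hkn, hguard.2 hlt, ?_⟩
      have hxle : x k ≤ x (k + 1) := hxmono (Nat.le_succ k)
      have hR : 26 ≤ p.roundCost P β d c₁ (rest.length + 1) (x k) (x (k + 1)) := by
        rw [Params.roundCost]; omega
      set R := p.roundCost P β d c₁ (rest.length + 1) (x k) (x (k + 1)) with hRdef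
      refine Tri.assign_seq (T₂ := R - 4) ?_ (by simp only [Expr.cost]; omega)
      set s₄ := s'.setReg 11 ((Expr.op .add (.reg 10) (.reg 5)).eval s') with hs₄
      have h₄ : (p.env D bud (x k) (x k + D)).HeldBy s₄ := by
        have : (Expr.op .add (.reg 10) (.reg 5)).eval s' = BitVec.ofNat b (x k + D) := by
          rw [Expr.eval, Expr.eval, Expr.eval, Op.eval, hE'.reg 10 (by omega) (by omega),
            hE'.reg 5 (by omega) (by omega), BitVec.ofNat_add]
          rfl
        rw [hs₄, this]
        exact p.env_setReg hE' rfl (p.ne_reg (fun _ => rfl) (fun _ => rfl) (fun _ => rfl)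
          (fun h => absurd rfl h))
      have hrhi₄ : s₄.reg (Vtx.toCon c₁).hi = BitVec.ofNat b hi := by
        rw [h₄.reg _ hfit.hi.1 hfit.hi.2, p.env_hi]
      have hcond := lt_eval_ne_zero (e := .reg (Vtx.toCon c₁).hi) (f := .reg 11) (s := s₄)
        (x := hi) (y := x k + D) (by omega) (by omega) hrhi₄ (h₄.reg 11 (by omega) (by omega))
      refine Tri.seq' (T₁ := 6) (T₂ := R - 10)
        (P := fun s₅ => (p.env D bud (x k) (x (k + 1))).HeldBy s₅ ∧ s₅.reg 12 = s'.reg 12 ∧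
          s₅.reg 13 = s'.reg 13) ?_ ?_ (by omega)
      · refine Tri.cond' 2 (fun h => Tri.assign (by simp [Expr.cost]) ?_)
          (fun h => Tri.skip (by omega) ?_) (by simp [Expr.cost])
        · have := hcond.1 h
          refine ⟨?_, by simp [hs₄], by simp [hs₄]⟩
          rw [Expr.eval, hrhi₄]
          refine p.env_setReg h₄ ?_ (p.ne_reg (fun _ => rfl) (fun _ => rfl) (fun _ => rfl)
            (fun h => absurd rfl h))
          change x (k + 1) = hi
          rw [hxk1]; omega
        · have h6 : ¬ hi < x k + D := fun h' => hcond.2 h' h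
          refine ⟨?_, by simp [hs₄], by simp [hs₄]⟩
          have : x (k + 1) = x k + D := by rw [hxk1]; omega
          rw [this]; exact h₄
      · rintro s₅ - ⟨h₅, j12, j13⟩
        refine (blockRound_spec hP hp hw hlab hlen hok hxle (hxS _) (by rw [hxk1]; omega) rfl s₅
          h₅).seq' (T₂ := 2) (fun s₆ hf₆ h₆ => ?_) (by omega)
        have hE₆ := h₅.frame hf₆ (fun r hr => matChain_wr hr) (fun a ha => matChain_wa ha)
        obtain ⟨k1, k2, k3⟩ := h₆
        refine Tri.assign (by simp [Expr.cost]) ?_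
        refine ⟨⟨x (k + 1), ?_⟩, ?_, ?_, ?_⟩
        · rw [Expr.eval, hE₆.reg 11 (by omega) (by omega)]
          exact p.env_setReg hE₆ rfl (p.ne_reg (fun _ => rfl) (fun _ => rfl) (fun h => absurd rfl h)
            (fun _ => rfl))
        · simp only [State.setReg_reg]
          norm_num
          rcases k2 with k2 | k2
          · exact Or.inl k2
          rcases k1 with k1 | k1
          · exact Or.inl k1
          rcases i1 with i1 | i1
          · left; rw [k2, j12, i1]
          · right
            rw [k1, j13, i1, add_assoc, ← BitVec.ofNat_add]
            congr 2
            exact hVadd (by rw [← hx0]; exact hxmono (Nat.zero_le k)) hxle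
        · simp only [State.setReg_reg]
          norm_num
          rcases k2 with k2 | k2
          · exact Or.inl k2
          · rw [k2, j12]; exact i2
        · intro h
          simp only [State.setReg_reg]
          norm_num
          rw [k3 h, j12, i3 h]
    · left
      refine ⟨by_contra fun h => hlt (hguard.1 h), ⟨D, bud, x k, bh, hE'⟩, ?_, i2, i3⟩
      have : x k = hi := le_antisymm (min_le_right _ _) (by omega)
      rw [this] at i1
      have hval : p.value (flat ((c₁, cs₁) :: (c₂, cs₂) :: rest)) = V lo hi := by
        have : flat ((c₁, cs₁) :: (c₂, cs₂) :: rest) = c₁ :: (cs₁ ++ flat ((c₂, cs₂) :: rest)) := rfl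
        rw [Params.value, this, List.map_cons, List.prod_cons, Matrix.mul_assoc]
      rw [hval]
      exact i1
  · rw [← Finset.range_eq_Ico]
    simp only [Expr.cost]
    exact le_rfl

/-! ### Choosing a strategy for every pattern of classes -/

/-- Split a list into parts of the given sizes. -/
def parts {α : Type*} : List ℕ → List α → List (α × List α)
  | [], _ => []
  | n :: ns, l => match l.take n with
    | [] => []
    | a :: l' => (a, l') :: parts ns (l.drop n)

theorem flat_parts {α : Type*} (ns : List ℕ) : ∀ l : List α, (∀ n ∈ ns, 1 ≤ n) →
    ns.sum = l.length → flat (parts ns l) = l := by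
  induction ns with
  | nil =>
    intro l _ h
    have h0 : l = [] := List.length_eq_zero_iff.1 (by simpa using h.symm)
    rw [h0]
    rfl
  | cons n ns ih =>
    intro l h1 h
    have h2 := h1 n (by simp)
    rw [List.sum_cons] at h
    obtain ⟨a, l', hal⟩ : ∃ a l', l.take n = a :: l' := by
      refine List.exists_cons_of_ne_nil fun h0 => ?_
      have := congrArg List.length h0
      simp at this
      rcases this with h3 | h3
      · omega
      · rw [h3] at h; simp at h; omega
    have h3 := ih (l.drop n) (fun m hm => h1 m (by simp [hm])) (by rw [List.length_drop]; omega)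
    rw [parts, hal]
    change a :: l' ++ flat (parts ns (l.drop n)) = l
    rw [h3, ← hal, List.take_append_drop]

theorem parts_map (ns : List ℕ) : ∀ l : List Vtx,
    (parts ns l).map classes = parts ns (l.map Prod.fst) := by
  induction ns with
  | nil => intro l; rfl
  | cons n ns ih =>
    intro l
    rw [parts, parts, ← List.map_take, ← List.map_drop]
    cases h : l.take n with
    | nil => rfl
    | cons a l' => simp [classes, ih]

/-- A strategy: rotate the cyclic list of classes, split it into parts of the given sizes, and join
two parts in an associative array, or three or more by products of matrices, whose size is `D₂` if
the last component is true, and `D₁` otherwise. -/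
abbrev Strategy := ℕ × List ℕ × Bool

/-- The strategy takes time `O(M * δ ^ 2)` for the given classes. -/
def Strategy.ok (β : ℕ) (cl : List (Fin 3)) (t : Strategy) : Bool :=
  decide (t.1 ≤ cl.length) && (t.2.1.all fun n => decide (1 ≤ n)) &&
    decide (t.2.1.sum = cl.length) && match parts t.2.1 (cl.rotate t.1) with
    | [] => false
    | [_] => false
    | [q, q'] => midsOk q.2 2 && midsOk q'.2 2
    | q :: q' :: rest => chainOk β t.2.2 q.1 q.2 (q' :: rest)

/-- The strategies for cycles of length three, four and five. -/
def strategies (k : ℕ) : List Strategy :=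
  (List.range k).flatMap fun r => (match k with
    | 3 => [([2, 1], false), ([1, 1, 1], false)]
    | 4 => [([2, 2], false), ([1, 1, 2], false), ([1, 1, 1, 1], false), ([1, 3], false),
        ([2, 1, 1], false)]
    | 5 => [([3, 2], false), ([1, 1, 1, 1, 1], true), ([1, 1, 1, 2], true), ([1, 2, 2], true),
        ([3, 1, 1], true), ([3, 1, 1], false)]
    | _ => []).map fun t => (r, t)

/-- The first efficient strategy for a pattern of classes. -/
def plan (β : ℕ) (cl : List (Fin 3)) : Option Strategy :=
  (strategies cl.length).find? (Strategy.ok β cl)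

/-- For triangles: if not all vertices have high degree, a walk of two arcs through a vertex of
lower degree is joined with the remaining arc. -/
theorem plan_three (f : Fin 3 → Fin 3) : (plan 2 (List.ofFn f)).isSome = true := by
  revert f; decide

/-- Each of the patterns of classes on a cycle of length four has an efficient strategy. -/
theorem plan_four (f : Fin 4 → Fin 3) : (plan 1 (List.ofFn f)).isSome = true := by
  revert f; decide

set_option maxRecDepth 4000 in
/-- Each of the patterns of classes on a cycle of length five has an efficient strategy. -/
theorem plan_five (f : Fin 5 → Fin 3) : (plan 0 (List.ofFn f)).isSome = true := by
  revert f; decide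

/-- Add the weighted number of closed walks through a cyclic list of classes and labels to the
total. -/
def planProg (P : Program) (β : ℕ) (vs : List Vtx) : Program :=
  match plan β (vs.map Prod.fst) with
  | none => .skip
  | some t => match parts t.2.1 (vs.rotate t.1) with
    | [] => .skip
    | [_] => .skip
    | [q, q'] => joinProg q.1 q.2 q'.1 q'.2
    | q :: q' :: rest => blockProg P β t.2.2 q.1 q.2 q'.1 q'.2 rest

/-- A factor for the time of `planProg`. -/
noncomputable def planFactor (P : Program) : ℕ := 4000000 + chainFactor P 5

theorem chainFactor_le (P : Program) {n : ℕ} (hn : n ≤ 5) : chainFactor P n ≤ planFactor P := by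
  rw [planFactor, chainFactor, chainFactor]
  have := Nat.mul_le_mul_right (4 * clockFactor P + 2000000) (show n + 1 ≤ 5 + 1 by omega)
  omega

theorem Params.value_rotate (p : Params) (vs : List Vtx) {n : ℕ} (hn : n ≤ vs.length) :
    p.value (vs.rotate n) = p.value vs := by
  rw [List.rotate_eq_drop_append_take hn]
  conv_rhs => rw [← List.take_append_drop n vs]
  simp only [Params.value, List.map_append, List.prod_append]
  rw [Matrix.trace_mul_comm]

theorem length_le_flat {α : Type*} (ps : List (α × List α)) : ps.length ≤ (flat ps).length := by
  induction ps with
  | nil => simp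
  | cons d ps ih =>
    have h1 : (flat (d :: ps)).length = d.2.length + 1 + (flat ps).length := by
      simp [flat]; omega
    rw [h1, List.length_cons]; omega

theorem planProg_spec {P : Program} {κ : ℕ} {tm : ℕ → ℕ} (hP : Multiplies P κ tm) {p : Params}
    {N B β : ℕ} (hp : p.Good β) (hw : p.Word b κ N B β) {vs : List Vtx}
    (hlab : ∀ v ∈ vs, v.2 < 2 ^ b) (hlen : vs.length ≤ 5)
    (hplan : (plan β (vs.map Prod.fst)).isSome = true) (s : State b) (hs : p.HeldBy s) :
    Tri (planProg P β vs) s (planFactor P * (p.M * p.δ ^ 2)) (fun s' => p.HeldBy s' ∧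
      (s'.reg 12 = 0 ∨ s'.reg 13 = s.reg 13 + BitVec.ofNat b (p.value vs)) ∧
      (s'.reg 12 = 0 ∨ s'.reg 12 = s.reg 12) ∧
      ((∀ d, budExp β d ≤ 2 → tm (p.dim d) < p.M * p.δ ^ budExp β d) →
        s'.reg 12 = s.reg 12)) := by
  obtain ⟨t, ht⟩ := Option.isSome_iff_exists.1 hplan
  have hok := List.find?_some ht
  rw [planProg, ht]
  obtain ⟨r, ns, d⟩ := t
  simp only [Strategy.ok, Bool.and_eq_true, List.all_eq_true, decide_eq_true_eq,
    List.length_map] at hok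
  obtain ⟨⟨⟨hr, hns⟩, hsum⟩, hm⟩ := hok
  have hflat := flat_parts ns (vs.rotate r) hns (by rw [hsum, List.length_rotate])
  have hmap := parts_map ns (vs.rotate r)
  rw [List.map_rotate] at hmap
  rw [← hmap] at hm
  simp only
  have hval : p.value vs = p.value (flat (parts ns (vs.rotate r))) := by
    rw [hflat, p.value_rotate vs hr]
  rw [hval]
  have hlab' : ∀ v ∈ flat (parts ns (vs.rotate r)), v.2 < 2 ^ b := by
    rw [hflat]; exact fun v hv => hlab v (List.mem_rotate.1 hv)
  have hlen' : (flat (parts ns (vs.rotate r))).length ≤ 5 := by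
    rw [hflat, List.length_rotate]; exact hlen
  clear hflat hval hmap
  generalize parts ns (vs.rotate r) = ps at hm hlab' hlen' ⊢
  match ps, hm with
  | [(c, cs), (h, ds)], hm =>
    simp only [List.map_cons, List.map_nil, Bool.and_eq_true, classes] at hm
    have h1 := length_lt_flat (ps := [(c, cs), (h, ds)]) (q := (c, cs)) (by simp)
    have h2 := length_lt_flat (ps := [(c, cs), (h, ds)]) (q := (h, ds)) (by simp)
    refine (joinProg_spec hp hw hlab' hm.1 hm.2 (by simp only at h1; omega)
      (by simp only at h2; omega) s hs).mono ?_ fun s' _ h => ?_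
    · refine Nat.mul_le_mul_right _ ?_
      rw [planFactor]; omega
    · exact ⟨h.1, Or.inr h.2.2, Or.inr h.2.1, fun _ => h.2.1⟩
  | (c, cs) :: (h, ds) :: q :: rest, hm =>
    have h1 := length_le_flat ((c, cs) :: (h, ds) :: q :: rest)
    simp only [List.length_cons] at h1
    refine (blockProg_spec hP hp hw hlab' hlen' hm s hs).mono ?_ fun s' _ hQ => ?_
    · exact Nat.mul_le_mul_right _ (chainFactor_le P (by rw [List.length_cons]; omega))
    · refine ⟨hQ.1, hQ.2.1, hQ.2.2.1, fun h' => hQ.2.2.2 (h' d ?_)⟩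
      change chainOk β d c.1 (cs.map Prod.fst) (((h, ds) :: q :: rest).map classes) = true at hm
      simp only [chainOk, Bool.and_eq_true, decide_eq_true_eq] at hm
      omega

/-- Treat several cyclic lists of classes and labels. -/
def sumProg (P : Program) (β : ℕ) : List (List Vtx) → Program
  | [] => .skip
  | vs :: ls => .seq (planProg P β vs) (sumProg P β ls)

theorem sumProg_spec {P : Program} {κ : ℕ} {tm : ℕ → ℕ} (hP : Multiplies P κ tm) {p : Params}
    {N B β : ℕ} (hp : p.Good β) (hw : p.Word b κ N B β) (ls : List (List Vtx)) :
    ∀ s : State b, (∀ vs ∈ ls, (∀ v ∈ vs, v.2 < 2 ^ b) ∧ vs.length ≤ 5 ∧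
      (plan β (vs.map Prod.fst)).isSome = true) → p.HeldBy s →
    Tri (sumProg P β ls) s (ls.length * (planFactor P * (p.M * p.δ ^ 2)) + 1) (fun s' =>
      p.HeldBy s' ∧
      (s'.reg 12 = 0 ∨ s'.reg 13 = s.reg 13 + BitVec.ofNat b ((ls.map p.value).sum)) ∧
      (s'.reg 12 = 0 ∨ s'.reg 12 = s.reg 12) ∧
      ((∀ d, budExp β d ≤ 2 → tm (p.dim d) < p.M * p.δ ^ budExp β d) →
        s'.reg 12 = s.reg 12)) := by
  induction ls with
  | nil => intro s _ hs; exact Tri.skip (by simp) ⟨hs, by simp, Or.inr rfl, fun _ => rfl⟩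
  | cons vs ls ih =>
    intro s hls hs
    obtain ⟨h1, h2, h3⟩ := hls vs (by simp)
    refine (planProg_spec hP hp hw h1 h2 h3 s hs).seq' (fun s₁ _ h => ?_)
      (T₂ := ls.length * (planFactor P * (p.M * p.δ ^ 2)) + 1) (by rw [List.length_cons]; linarith)
    obtain ⟨i1, i2, i3, i4⟩ := h
    refine (ih s₁ (fun vs hvs => hls vs (by simp [hvs])) i1).mono le_rfl fun s₂ _ h => ?_
    obtain ⟨j1, j2, j3, j4⟩ := h
    refine ⟨j1, ?_, ?_, fun h => (j4 h).trans (i4 h)⟩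
    · rcases j3 with j3 | j3
      · exact Or.inl j3
      rcases j2 with j2 | j2
      · exact Or.inl j2
      rcases i2 with i2 | i2
      · left; rw [j3, i2]
      · right; rw [j2, i2, List.map_cons, List.sum_cons, BitVec.ofNat_add, add_assoc]
    · rcases j3 with j3 | j3
      · exact Or.inl j3
      · rw [j3]; exact i3

/-! ### One round, and the search for the degree parameter -/

/-- The parameters that belong to `δ`. -/
def Csr.params (g : Csr) (M δ : ℕ) : Params where
  g := g
  M := M
  δ := δ
  D₁ := min (g.S / (δ * δ) + 1) g.S
  D₂ := min (g.S / δ + 1) g.S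

/-- As the degree of the vertex `v` is at most `S / (v + 1)`, it is at most `z` from the vertex
`S / z + 1` on. -/
theorem Csr.params_good {g : Csr} (hg : g.Valid) {M δ β : ℕ} (hδ : 1 ≤ δ) (hM : 1 ≤ M)
    (hS : g.S ≤ 2 * M) (hMδ : M ≤ δ ^ (β + 4)) : (g.params M δ).Good β := by
  have hdeg : ∀ z, 1 ≤ z → ∀ v < g.S, min (g.S / z + 1) g.S ≤ v → g.deg v ≤ z := by
    intro z hz v hv hle
    have h1 := hg.deg_mul_le v hv
    have h2 : g.S / z + 1 ≤ v := by omega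
    have h3 := Nat.lt_mul_div_succ g.S hz
    by_contra h
    nlinarith [Nat.mul_le_mul (show z + 1 ≤ g.deg v by omega) (show g.S / z + 2 ≤ v + 1 by omega)]
  have hδ2 : 1 ≤ δ * δ := Nat.mul_pos hδ hδ
  have h1 := Nat.lt_mul_div_succ g.S hδ
  have h2 := Nat.lt_mul_div_succ g.S hδ2
  have h3 : g.S / (δ * δ) ≤ g.S / δ := Nat.div_le_div_left (Nat.le_mul_of_pos_right _ hδ) hδ
  have h4 : g.S / δ / δ = g.S / (δ * δ) := Nat.div_div_eq_div_mul _ _ _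
  have h5 := Nat.lt_mul_div_succ (g.S / δ) hδ
  rw [h4] at h5
  have h6 : g.S / δ * δ ≤ g.S := Nat.div_mul_le_self _ _
  have h7 : g.S / (δ * δ) * (δ * δ) ≤ g.S := Nat.div_mul_le_self _ _
  -- a square of a quotient, plus one, against `M * δ ^ e`
  have key : ∀ q e z, q * z ≤ g.S → z * z * δ ^ e = δ ^ (β + 4) →
      (q + 1) * (q + 1) ≤ 10 * (M * δ ^ e) := by
    intro q e z hq hz
    have hpos : 1 ≤ M * δ ^ e := Nat.mul_pos hM (Nat.one_le_pow _ _ hδ)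
    have hz1 : 1 ≤ z * z := by
      rcases Nat.eq_zero_or_pos (z * z) with h0 | h0
      · rw [h0, zero_mul] at hz
        have : 1 ≤ δ ^ (β + 4) := Nat.one_le_pow _ _ hδ
        omega
      · exact h0
    have h8 : q * q * (z * z) ≤ 4 * (M * δ ^ e) * (z * z) := by
      calc q * q * (z * z) = (q * z) * (q * z) := by ring
        _ ≤ (2 * M) * (2 * M) := Nat.mul_le_mul (hq.trans hS) (hq.trans hS)
        _ = 4 * M * M := by ring
        _ ≤ 4 * M * δ ^ (β + 4) := Nat.mul_le_mul_left _ hMδ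
        _ = 4 * (M * δ ^ e) * (z * z) := by rw [← hz]; ring
    have h9 := Nat.le_of_mul_le_mul_right h8 hz1
    nlinarith
  exact
    { valid := hg
      one_le_δ := hδ
      one_le_M := hM
      S_le := hS
      D_le := by simp only [Csr.params]; omega
      D_le_S := min_le_right _ _
      deg_le_sq := fun v hv h => by rw [Csr.params, pow_two]; exact hdeg _ hδ2 v hv h
      deg_le := fun v hv h => hdeg _ hδ v hv h
      S_le_mul := by
        simp only [Csr.params]
        rcases min_choice (g.S / (δ * δ) + 1) g.S with h | h <;> rw [h] <;> nlinarith
      D_le_mul := by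
        simp only [Csr.params]
        have h8 := min_le_left (g.S / δ + 1) g.S
        have h9 := min_le_right (g.S / δ + 1) g.S
        rcases min_choice (g.S / (δ * δ) + 1) g.S with h | h <;> rw [h] <;> nlinarith
      sq_le := by
        simp only [Csr.params]
        have h8 := min_le_left (g.S / (δ * δ) + 1) g.S
        exact (Nat.mul_le_mul h8 h8).trans (key _ β (δ * δ) h7 (by ring))
      sq_le' := by
        simp only [Csr.params]
        have h8 := min_le_left (g.S / δ + 1) g.S
        exact (Nat.mul_le_mul h8 h8).trans (key _ (β + 2) δ h6 (by ring)) }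

/-- Set register `r` to `min (S / e + 1) S`. -/
def setBorder (r : ℕ) (e : Expr) : Program :=
  .seq (.assign r (.op .add (.op .div (.reg 2) e) (.const 1))) <|
    .cond (.op .lt (.reg 2) (.reg r)) (.assign r (.reg 2)) .skip

/-- One round, for the `δ` in register `4`. -/
def roundProg (P : Program) (β : ℕ) (ls : List (List Vtx)) : Program :=
  .seq (.assign 12 (.const 1)) <|
  .seq (.assign 13 (.const 0)) <|
  .seq (setBorder 8 (.op .mul (.reg 4) (.reg 4))) <|
  .seq (setBorder 9 (.reg 4)) <|
  sumProg P β ls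

theorem setBorder_spec {S z r : ℕ} {e : Expr} {s : State b} (hS : S + 1 < 2 ^ b) (hz : z < 2 ^ b)
    (hr : r ≠ 2) (h2 : s.reg 2 = BitVec.ofNat b S) (he : e.eval s = BitVec.ofNat b z)
    (hc : e.cost ≤ 3) : Tri (setBorder r e) s 15 (fun s' =>
      s' = s.setReg r (BitVec.ofNat b (min (S / z + 1) S))) := by
  have hdiv : S / z ≤ S := Nat.div_le_self _ _
  refine Tri.assign_seq (T₂ := 6) ?_ (by simp only [Expr.cost]; omega)
  have hev : (Expr.op .add (.op .div (.reg 2) e) (.const 1)).eval s =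
      BitVec.ofNat b (S / z + 1) := by
    simp only [Expr.eval, Op.eval, h2, he]
    rw [ofNat_div_of_lt (by omega) hz, BitVec.ofNat_add]
  rw [hev]
  have hg := lt_eval_ne_zero (e := .reg 2) (f := .reg r) (x := S) (y := S / z + 1)
    (s := s.setReg r (BitVec.ofNat b (S / z + 1))) (by omega) (by omega)
    (by simp [Expr.eval, hr.symm, h2]) (by simp [Expr.eval])
  refine Tri.cond' 2 (fun h => Tri.assign (by simp [Expr.cost]) ?_)
    (fun h => Tri.skip (by omega) ?_) (by simp [Expr.cost])
  · have h3 := hg.1 h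
    rw [show min (S / z + 1) S = S by omega, Expr.eval, State.setReg_reg, if_neg hr.symm, h2]
    simp [State.setReg]
  · have h3 : ¬ S < S / z + 1 := fun h' => hg.2 h' h
    rw [show min (S / z + 1) S = S / z + 1 by omega]

/-- A round takes time `O(M * δ ^ 2)` in any case.  If it succeeds its result is correct, and it
succeeds if all time limits are sufficient. -/
theorem roundProg_spec {P : Program} {κ : ℕ} {tm : ℕ → ℕ} (hP : Multiplies P κ tm) {g : Csr}
    {M δ N B β : ℕ} (hp : (g.params M δ).Good β) (hw : (g.params M δ).Word b κ N B β)
    (hδ : δ * δ < 2 ^ b) (ls : List (List Vtx)) (hls : ∀ vs ∈ ls, (∀ v ∈ vs, v.2 < 2 ^ b) ∧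
      vs.length ≤ 5 ∧ (plan β (vs.map Prod.fst)).isSome = true) (s : State b) {D D' : ℕ}
    (hs : (⟨g, M, δ, D, D'⟩ : Params).HeldBy s) :
    Tri (roundProg P β ls) s (ls.length * (planFactor P * (M * δ ^ 2)) + 35) (fun s' =>
      (g.params M δ).HeldBy s' ∧
      (s'.reg 12 = 0 ∨ s'.reg 13 = BitVec.ofNat b ((ls.map (g.params M δ).value).sum)) ∧
      ((∀ d, budExp β d ≤ 2 → tm ((g.params M δ).dim d) < M * δ ^ budExp β d) →
        s'.reg 12 ≠ 0)) := by
  obtain ⟨dim, bud, bl, bh, hE⟩ := hs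
  have hS := hw.S_lt
  have hδb : δ < 2 ^ b := lt_of_le_of_lt (Nat.le_mul_self δ) hδ
  refine Tri.assign_seq (T₂ := ls.length * (planFactor P * (M * δ ^ 2)) + 33) (Tri.assign_seq
    (T₂ := ls.length * (planFactor P * (M * δ ^ 2)) + 31) ?_ (by simp only [Expr.cost]; omega))
    (by simp only [Expr.cost]; omega)
  set s₀ := (s.setReg 12 ((Expr.const 1).eval s)).setReg 13 ((Expr.const 0).eval
    (s.setReg 12 ((Expr.const 1).eval s))) with hs₀
  have hE₀ : ((⟨g, M, δ, D, D'⟩ : Params).env dim bud bl bh).HeldBy s₀ :=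
    (hE.setReg (by omega) _).setReg (by omega) _
  refine (setBorder_spec (z := δ * δ) hS hδ (by omega) (hE₀.reg 2 (by omega) (by omega)) (by
    simp only [Expr.eval, Op.eval, hE₀.reg 4 (by omega) (by omega), BitVec.ofNat_mul]; rfl)
    (by simp [Expr.cost])).seq' (T₂ := ls.length * (planFactor P * (M * δ ^ 2)) + 16) ?_ (by omega)
  intro s₁ _ h₁
  have h2₁ : s₁.reg 2 = BitVec.ofNat b g.S := by
    simp [h₁, hE₀.reg 2]; rfl
  have h4₁ : s₁.reg 4 = BitVec.ofNat b δ := by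
    simp [h₁, hE₀.reg 4]; rfl
  refine (setBorder_spec (z := δ) (e := .reg 4) hS hδb (by omega) h2₁ h4₁ (by simp [Expr.cost])).seq'
    (T₂ := ls.length * (planFactor P * (M * δ ^ 2)) + 1) ?_ (by omega)
  intro s₂ _ h₂
  have hE₂ : ((g.params M δ).env dim bud bl bh).HeldBy s₂ := by
    refine ⟨fun r hr1 hr2 => ?_, ?_, ?_, ?_, ?_⟩
    · rw [h₂, h₁]
      simp only [State.setReg_reg]
      split_ifs with h9 h8
      · rw [h9]; rfl
      · rw [h8]; rfl
      · rw [hE₀.reg r hr1 hr2]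
        congr 1
        simp only [Params.env]
        split <;> first | rfl | exact absurd rfl h8 | exact absurd rfl h9
    all_goals rw [h₂, h₁]
    · exact hE₀.off
    · exact hE₀.tgt
    · exact hE₀.wt
    · exact hE₀.lab
  have h12 : s₂.reg 12 = 1 := by simp [h₂, h₁, hs₀, Expr.eval]
  have h13 : s₂.reg 13 = 0 := by simp [h₂, h₁, hs₀, Expr.eval]
  refine (sumProg_spec hP hp hw ls s₂ hls ⟨dim, bud, bl, bh, hE₂⟩).mono le_rfl fun s₃ _ h => ?_
  obtain ⟨i1, i2, -, i4⟩ := h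
  refine ⟨i1, ?_, fun h => ?_⟩
  · rwa [h13, show (0 : BitVec b) = 0#b from rfl, BitVec.zero_add] at i2
  · rw [i4 h, h12]
    exact one_ne_zero_word one_pos (by omega)

/-- The power of the parameter `δ` in register `4`. -/
def powExpr : ℕ → Expr
  | 0 => .const 1
  | e + 1 => .op .mul (powExpr e) (.reg 4)

theorem powExpr_cost (e : ℕ) : (powExpr e).cost = 2 * e + 1 := by
  induction e with
  | zero => rfl
  | succ e ih => rw [powExpr, Expr.cost, ih]; simp [Expr.cost]; omega

theorem powExpr_eval {δ : ℕ} {s : State b} (h4 : s.reg 4 = BitVec.ofNat b δ) (e : ℕ) :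
    (powExpr e).eval s = BitVec.ofNat b (δ ^ e) := by
  induction e with
  | zero => simp [powExpr, Expr.eval]
  | succ e ih =>
    simp only [powExpr, Expr.eval, Op.eval] at ih ⊢
    rw [ih, h4, ← BitVec.ofNat_mul, pow_succ]

/-- Double `δ` until a round succeeds.  Rounds for which `δ` is too small for the bounds on the
sizes of the classes are skipped. -/
def search (P : Program) (β : ℕ) (ls : List (List Vtx)) : Program :=
  .seq (.assign 4 (.const 2)) <| .seq (.assign 12 (.const 0)) <|
  .loop (.op .eq (.reg 12) (.const 0)) <|
    .seq (.cond (.op .lt (powExpr (β + 4)) (.reg 3)) .skip (roundProg P β ls)) <|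
    .assign 4 (.op .add (.reg 4) (.reg 4))

/-- A factor for the time of `search`. -/
noncomputable def searchFactor (P : Program) (β n : ℕ) : ℕ := 2 * (n * planFactor P + 2 * β + 80)

theorem sum_four_pow_le (c : ℕ) (J : ℕ) :
    ∑ k ∈ Finset.Ico 1 (J + 1), c * 4 ^ k + c ≤ 2 * (c * 4 ^ J) := by
  induction J with
  | zero => simp; omega
  | succ J ih =>
    rw [Finset.sum_Ico_succ_top (by omega), pow_succ]
    nlinarith [Nat.zero_le (c * 4 ^ J)]

/-- The search ends with `2 ^ J` at the latest if the time limits for this parameter are sufficient.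
-/
theorem search_spec {P : Program} {κ : ℕ} {tm : ℕ → ℕ} (hP : Multiplies P κ tm) {g : Csr}
    (hg : g.Valid) {M J N B β : ℕ} (hM : 1 ≤ M) (hS : g.S ≤ 2 * M) (hJ : 1 ≤ J)
    (hMJ : M ≤ (2 ^ J) ^ (β + 4)) (hMb : M < 2 ^ b)
    (hw : ∀ δ ≤ 2 ^ J, (g.params M δ).Word b κ N B β)
    (htm : ∀ d, budExp β d ≤ 2 → tm ((g.params M (2 ^ J)).dim d) < M * (2 ^ J) ^ budExp β d)
    (ls : List (List Vtx)) (hls : ∀ vs ∈ ls, (∀ v ∈ vs, v.2 < 2 ^ b) ∧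
      vs.length ≤ 5 ∧ (plan β (vs.map Prod.fst)).isSome = true) {total : ℕ}
    (htotal : ∀ δ, (g.params M δ).Good β → (ls.map (g.params M δ).value).sum = total)
    (s : State b) {δ₀ D D' : ℕ} (hs : (⟨g, M, δ₀, D, D'⟩ : Params).HeldBy s) :
    Tri (search P β ls) s (searchFactor P β ls.length * (M * 4 ^ J)) (fun s' =>
      s'.reg 13 = BitVec.ofNat b total) := by
  obtain ⟨dim, bud, bl, bh, hE⟩ := hs
  have hpow : ∀ δ ≤ 2 ^ J, δ ^ (β + 4) < 2 ^ b := fun δ hδ =>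
    lt_of_le_of_lt (Nat.le_mul_of_pos_left _ hM) (hw δ hδ).budget_lt
  have hb := (hw 0 (Nat.zero_le _)).S_lt
  set F := ls.length * planFactor P + 2 * β + 80 with hF
  set Z := ∑ k ∈ Finset.Ico 1 (J + 1), (F * M) * 4 ^ k with hZ
  have hZle := sum_four_pow_le (F * M) J
  have hFM : 80 ≤ F * M := by nlinarith
  refine Tri.assign_seq (T₂ := Z + 4 + 2) (Tri.assign_seq (T₂ := Z + 4) ?_
    (by simp only [Expr.cost]; omega)) ?_
  swap
  · simp only [Expr.cost, searchFactor]
    rw [show 2 * (ls.length * planFactor P + 2 * β + 80) * (M * 4 ^ J) = 2 * (F * M * 4 ^ J) by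
      rw [hF]; ring]
    omega
  set s₀ := (s.setReg 4 ((Expr.const 2).eval s)).setReg 12 ((Expr.const 0).eval
    (s.setReg 4 ((Expr.const 2).eval s))) with hs₀
  have setδ : ∀ {s' : State b} {δ δ' D D' : ℕ}, (⟨g, M, δ, D, D'⟩ : Params).HeldBy s' →
      (⟨g, M, δ', D, D'⟩ : Params).HeldBy (s'.setReg 4 (BitVec.ofNat b δ')) := by
    rintro s' δ δ' D D' ⟨dim, bud, bl, bh, h⟩
    refine ⟨dim, bud, bl, bh, fun r hr1 hr2 => ?_, h.off, h.tgt, h.wt, h.lab⟩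
    rw [State.setReg_reg]
    split_ifs with h4
    · rw [h4]; rfl
    · rw [h.reg r hr1 hr2]
      congr 1
      simp only [Params.env]
      split <;> first | rfl | exact absurd rfl h4
  have h₀ : (⟨g, M, 2 ^ 1, D, D'⟩ : Params).HeldBy s₀ := by
    obtain ⟨dim, bud, bl, bh, h⟩ := setδ (δ' := 2 ^ 1) ⟨dim, bud, bl, bh, hE⟩
    exact ⟨dim, bud, bl, bh, h.setReg (by omega) _⟩
  refine (Tri.loop (I := fun k s' => (∃ D D', (⟨g, M, 2 ^ k, D, D'⟩ : Params).HeldBy s') ∧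
      (s'.reg 12 = 0 ∨ s'.reg 13 = BitVec.ofNat b total) ∧ (k = J + 1 → s'.reg 12 ≠ 0))
    (T := fun k => F * M * 4 ^ k - 4) (k₀ := 1) (n := J + 1) (by omega) ?_ ?_).mono ?_
    (fun _ _ h => h)
  · refine ⟨⟨D, D', h₀⟩, Or.inl ?_, by omega⟩
    simp [hs₀, Expr.eval]
  · rintro k s' hk1 hk2 - ⟨⟨D₁, D₂, hh⟩, hval, hlast⟩
    have hguard : (Expr.op .eq (.reg 12) (.const 0)).eval s' = 0 ↔ s'.reg 12 ≠ 0 := by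
      simp only [Expr.eval, Op.eval]
      have : (1 : BitVec b) ≠ 0 := one_ne_zero_word one_pos (by omega)
      change (if s'.reg 12 = 0 then (1 : BitVec b) else 0) = 0 ↔ _
      split_ifs with h
      · exact ⟨fun h' => absurd h' this, fun h' => absurd h h'⟩
      · exact ⟨fun _ => h, fun _ => rfl⟩
    by_cases h12 : s'.reg 12 = 0
    swap
    · left
      exact ⟨hguard.2 h12, hval.resolve_left h12⟩
    right
    have hkJ : k ≤ J := by
      by_contra h
      exact hlast (by omega) h12
    refine ⟨by omega, fun h => hguard.1 h h12, ?_⟩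
    have hδJ : 2 ^ k ≤ 2 ^ J := Nat.pow_le_pow_right (by omega) hkJ
    have h4k : (2 ^ k) ^ 2 = 4 ^ k := by rw [← pow_mul, mul_comm, pow_mul]; norm_num
    have h3 : s'.reg 3 = BitVec.ofNat b M := by
      obtain ⟨dim, bud, bl, bh, h⟩ := hh; exact h.reg 3 (by omega) (by omega)
    have h4 : s'.reg 4 = BitVec.ofNat b (2 ^ k) := by
      obtain ⟨dim, bud, bl, bh, h⟩ := hh; exact h.reg 4 (by omega) (by omega)
    have hlt := lt_eval_ne_zero (s := s') (e := powExpr (β + 4)) (f := .reg 3)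
      (hpow _ hδJ) hMb (powExpr_eval h4 _) h3
    have hcost : ls.length * (planFactor P * (M * (2 ^ k) ^ 2)) + 2 * β + 80 ≤ F * M * 4 ^ k := by
      have : 1 ≤ M * 4 ^ k := Nat.mul_pos hM (by positivity)
      rw [h4k, hF]
      nlinarith [Nat.zero_le (β * (M * 4 ^ k))]
    refine Tri.seq' (T₁ := F * M * 4 ^ k - 8) (T₂ := 4) (P := fun s'' =>
      (∃ D D', (⟨g, M, 2 ^ k, D, D'⟩ : Params).HeldBy s'') ∧
      (s''.reg 12 = 0 ∨ s''.reg 13 = BitVec.ofNat b total) ∧ (k = J → s''.reg 12 ≠ 0))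
      ?_ ?_ (by omega)
    · refine Tri.cond' (ls.length * (planFactor P * (M * (2 ^ k) ^ 2)) + 35)
        (fun h => Tri.skip (by omega) ⟨⟨D₁, D₂, hh⟩, Or.inl h12, ?_⟩) (fun h => ?_) ?_
      · rintro rfl
        have := hlt.1 h
        omega
      · have hge : M ≤ (2 ^ k) ^ (β + 4) := by
          by_contra h'
          exact hlt.2 (by omega) h
        have hgood : (g.params M (2 ^ k)).Good β :=
          g.params_good hg Nat.one_le_two_pow hM hS hge
        refine (roundProg_spec hP hgood (hw _ hδJ) ?_ ls hls s' hh).mono le_rfl fun s'' _ h => ?_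
        · refine lt_of_le_of_lt ?_ (hpow _ hδJ)
          rw [← pow_two]
          exact Nat.pow_le_pow_right Nat.one_le_two_pow (by omega)
        · rw [htotal _ hgood] at h
          refine ⟨⟨_, _, h.1⟩, h.2.1, ?_⟩
          rintro rfl
          exact h.2.2 htm
      · simp only [Expr.cost, powExpr_cost]
        omega
    · rintro s'' - ⟨⟨D₃, D₄, hh'⟩, i1, i2⟩
      refine Tri.assign (by simp [Expr.cost]) ?_
      have : (Expr.op .add (.reg 4) (.reg 4)).eval s'' = BitVec.ofNat b (2 ^ (k + 1)) := by
        obtain ⟨dim, bud, bl, bh, h⟩ := hh'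
        have : s''.reg 4 = BitVec.ofNat b (2 ^ k) := h.reg 4 (by omega) (by omega)
        simp only [Expr.eval, Op.eval, this, ← BitVec.ofNat_add]
        congr 1
        ring
      rw [this]
      refine ⟨⟨D₃, D₄, setδ hh'⟩, ?_, fun h => ?_⟩
      · simpa using i1
      · simpa using i2 (by omega)
  · have h1 : (Expr.op .eq (.reg 12) (.const 0)).cost + 1 = 4 := rfl
    rw [h1]
    refine Nat.add_le_add_right (Finset.sum_le_sum fun k _ => ?_) 4
    have : 1 ≤ 4 ^ k := Nat.one_le_pow _ _ (by omega)
    have : 80 ≤ F * M * 4 ^ k := by nlinarith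
    omega

/-! ### Counting sort -/

/-- The contents of all arrays, as natural numbers. -/
abbrev Mem := ℕ → ℕ → ℕ

/-- The arrays of the machine have the contents `F`. -/
def Mem.HeldBy (F : Mem) (s : State b) : Prop :=
  ∀ a p, p < 2 ^ b → s.arr a (BitVec.ofNat b p) = BitVec.ofNat b (F a p)

/-- Change one cell. -/
def Mem.set (F : Mem) (a x y : ℕ) : Mem := Function.update F a (Function.update (F a) x y)

theorem Mem.set_apply (F : Mem) (a x y a' p : ℕ) :
    F.set a x y a' p = if a' = a ∧ p = x then y else F a' p := by
  unfold Mem.set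
  by_cases h : a' = a
  · subst h
    by_cases h2 : p = x
    · subst h2; simp
    · simp [h2]
  · simp [h]

/-- The initial contents of the memory. -/
theorem exists_mem (s : State b) : Mem.HeldBy (fun a p => (s.arr a (BitVec.ofNat b p)).toNat) s :=
  fun a p _ => by simp

theorem Mem.HeldBy.setReg {F : Mem} {s : State b} (h : F.HeldBy s) (r : ℕ) (x : BitVec b) :
    F.HeldBy (s.setReg r x) := h

theorem Mem.HeldBy.read {F : Mem} {s : State b} (h : F.HeldBy s) {a x : ℕ} {i : Expr}
    (hi : i.eval s = BitVec.ofNat b x) (hx : x < 2 ^ b) :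
    (Expr.read a i).eval s = BitVec.ofNat b (F a x) := by
  rw [Expr.eval, hi, h a x hx]

theorem Mem.HeldBy.setArr {F : Mem} {s : State b} (h : F.HeldBy s) {a x y : ℕ} {i e : Expr}
    (hi : i.eval s = BitVec.ofNat b x) (hx : x < 2 ^ b) (he : e.eval s = BitVec.ofNat b y) :
    (F.set a x y).HeldBy (s.setArr a (i.eval s) (e.eval s)) := by
  intro a' p hp
  rw [State.setArr_arr, Mem.set_apply, hi, he]
  by_cases h1 : a' = a
  · subst h1
    rw [if_pos rfl]
    by_cases h2 : p = x
    · subst h2; simp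
    · rw [Function.update_of_ne, if_neg (fun h => h2 h.2), h a' p hp]
      rwa [Ne, ofNat_inj_of_lt hp hx]
  · rw [if_neg h1, if_neg (fun h => h1 h.1), h a' p hp]

theorem eval_add {s : State b} {e f : Expr} {x y : ℕ} (he : e.eval s = BitVec.ofNat b x)
    (hf : f.eval s = BitVec.ofNat b y) : (Expr.op .add e f).eval s = BitVec.ofNat b (x + y) := by
  rw [Expr.eval, he, hf, Op.eval, BitVec.ofNat_add]

theorem eval_sub {s : State b} {e f : Expr} {x y : ℕ} (he : e.eval s = BitVec.ofNat b x)
    (hf : f.eval s = BitVec.ofNat b y) (h : y ≤ x) :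
    (Expr.op .sub e f).eval s = BitVec.ofNat b (x - y) := by
  rw [Expr.eval, he, hf, Op.eval]
  have : BitVec.ofNat b x = BitVec.ofNat b (x - y) + BitVec.ofNat b y := by
    rw [← BitVec.ofNat_add, Nat.sub_add_cancel h]
  rw [this, BitVec.add_sub_cancel]

/-- Run the program for the values of register `14` below the value of `e`. -/
def forN (e : Expr) (p : Program) : Program := .seq (.assign 14 (.const 0)) (forTo 14 e p)

theorem Tri.forN {e : Expr} {p : Program} {s : State b} {hi T T' : ℕ} {F : Mem}
    (I : ℕ → Mem → Prop) (hw : ∀ r, ¬ p.wr r) (hhi : hi < 2 ^ b) (hF : F.HeldBy s) (h0 : I 0 F)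
    (he : ∀ s' : State b, (∀ r, r ≠ 14 → s'.reg r = s.reg r) → e.eval s' = BitVec.ofNat b hi)
    (hp : ∀ k s' F', k < hi → (∀ r, r ≠ 14 → s'.reg r = s.reg r) →
      s'.reg 14 = BitVec.ofNat b k → F'.HeldBy s' → I k F' →
      Tri p s' T (fun s'' => ∃ F'', F''.HeldBy s'' ∧ I (k + 1) F''))
    (hT : hi * (T + (e.cost + 7)) + (e.cost + 5) ≤ T') :
    Tri (WordRAM.forN e p) s T' (fun s' => (∀ r, r ≠ 14 → s'.reg r = s.reg r) ∧
      ∃ F', F'.HeldBy s' ∧ I hi F') := by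
  refine Tri.assign_seq (T₂ := hi * (T + (e.cost + 7)) + (e.cost + 3)) ?_
    (by simp only [Expr.cost]; omega)
  have hreg : ∀ {s' : State b}, Frame (WordRAM.forTo 14 e p) (s.setReg 14 ((Expr.const 0).eval s)) s' →
      ∀ r, r ≠ 14 → s'.reg r = s.reg r := by
    intro s' hf r hr
    rw [hf.1 r, State.setReg_reg, if_neg hr]
    rintro (h | h)
    · exact hw r h
    · exact hr h
  refine (Tri.forTo_const (lo := 0) (hi := hi) (T := T) (I := fun k s' => ∃ F', F'.HeldBy s' ∧ I k F')
    (hw _) hhi (Nat.zero_le _) ?_ ⟨F, hF, h0⟩ ?_ ?_ le_rfl).mono le_rfl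
    (fun s' hf h => ⟨hreg hf, h.2⟩)
  · simp [Expr.eval]
  · intro k s' _ _ hf _
    exact he s' (hreg hf)
  · rintro k s' - hk hf h14 ⟨F', hF', hI⟩
    exact hp k s' F' hk (hreg hf) h14 hF' hI

theorem Tri.write_mem {s : State b} {F : Mem} {T a x y : ℕ} {i e : Expr} {Q : Mem → Prop}
    (hF : F.HeldBy s) (hT : i.cost + e.cost + 1 ≤ T)
    (hi : i.eval s = BitVec.ofNat b x) (hx : x < 2 ^ b) (he : e.eval s = BitVec.ofNat b y)
    (hQ : Q (F.set a x y)) : Tri (.write a i e) s T (fun s' => ∃ F', F'.HeldBy s' ∧ Q F') :=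
  Tri.write hT ⟨_, hF.setArr hi hx he, hQ⟩

/-- Rank the numbers below the value of register `2` by their keys in the array `key`: the number of
smaller keys than `p` goes to cell `p` of the array `off`, and the number of earlier numbers with
the same key to the array `rnk`. -/
def rankProg (key cnt rnk off : ℕ) : Program :=
  .seq (forN (.op .add (.reg 2) (.const 1)) (.write cnt (.reg 14) (.const 0))) <|
  .seq (forN (.reg 2) <|
    .seq (.write rnk (.reg 14) (.read cnt (.read key (.reg 14)))) <|
      .write cnt (.read key (.reg 14))
        (.op .add (.read cnt (.read key (.reg 14))) (.const 1))) <|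
  .seq (.write off (.const 0) (.const 0)) <|
  forN (.op .add (.reg 2) (.const 1)) <| .write off (.op .add (.reg 14) (.const 1))
    (.op .add (.read off (.reg 14)) (.read cnt (.reg 14)))

/-- The number of the `j < S` with a smaller key than `p`. -/
def below (K : ℕ → ℕ) (S p : ℕ) : ℕ := ((Finset.range S).filter fun j => K j < p).card

/-- The number of the `j < S` with the key `p`. -/
def equal (K : ℕ → ℕ) (S p : ℕ) : ℕ := ((Finset.range S).filter fun j => K j = p).card

theorem below_zero (K : ℕ → ℕ) (S : ℕ) : below K S 0 = 0 := by simp [below]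

theorem below_succ (K : ℕ → ℕ) (S p : ℕ) : below K S (p + 1) = below K S p + equal K S p := by
  rw [below, below, equal, ← Finset.card_union_of_disjoint]
  · congr 1
    ext j
    simp only [Finset.mem_filter, Finset.mem_union, Finset.mem_range]
    omega
  · rw [Finset.disjoint_filter]
    intro j _ h1 h2
    omega

theorem equal_succ (K : ℕ → ℕ) (S p : ℕ) :
    equal K (S + 1) p = equal K S p + if K S = p then 1 else 0 := by
  rw [equal, equal, Finset.range_add_one, Finset.filter_insert]
  split_ifs with h
  · rw [Finset.card_insert_of_notMem (by simp)]
  · simp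

theorem below_mono (K : ℕ → ℕ) (S : ℕ) : Monotone (below K S) :=
  monotone_nat_of_le_succ fun p => by rw [below_succ]; omega

theorem below_le (K : ℕ → ℕ) (S p : ℕ) : below K S p ≤ S :=
  (Finset.card_filter_le _ _).trans_eq (Finset.card_range S)

theorem below_eq {K : ℕ → ℕ} {S p : ℕ} (h : ∀ j < S, K j < p) : below K S p = S := by
  rw [below, Finset.filter_true_of_mem (fun j hj => h j (Finset.mem_range.1 hj)), Finset.card_range]

theorem rankProg_spec {key cnt rnk off S : ℕ} {F : Mem} (h1 : key ≠ cnt) (h2 : key ≠ rnk)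
    (h3 : cnt ≠ rnk) (h4 : off ≠ cnt) (h5 : off ≠ rnk) (hS : S + 2 < 2 ^ b)
    (hK : ∀ i < S, F key i ≤ S) (s : State b) (hr : s.reg 2 = BitVec.ofNat b S)
    (hF : F.HeldBy s) :
    Tri (rankProg key cnt rnk off) s (80 * S + 80) (fun s' => (∀ r, r ≠ 14 → s'.reg r = s.reg r) ∧
      ∃ F' : Mem, F'.HeldBy s' ∧ (∀ a, a ≠ cnt → a ≠ rnk → a ≠ off → F' a = F a) ∧
        (∀ p ≤ S + 1, F' off p = below (F key) S p) ∧
        ∀ i < S, F' rnk i = equal (F key) i (F key i)) := by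
  have hS1 : ∀ s' : State b, s'.reg 2 = BitVec.ofNat b S →
      (Expr.op .add (.reg 2) (.const 1)).eval s' = BitVec.ofNat b (S + 1) := fun s' h =>
    eval_add h rfl
  refine (Tri.forN (hi := S + 1) (T := 3) (F := F) (I := fun k F' => (∀ a, a ≠ cnt → F' a = F a) ∧
    ∀ p < k, F' cnt p = 0) (by simp [Program.wr]) (by omega) hF ⟨fun _ _ => rfl, by simp⟩ ?_ ?_
    le_rfl).seq' (T₂ := 55 * S + 55) ?_ (by simp only [Expr.cost]; omega)
  · intro s' h; exact hS1 s' (by rw [h 2 (by omega), hr])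
  · rintro k s' F' hk hreg h14 hF' ⟨i1, i2⟩
    refine Tri.write_mem hF' (by simp [Expr.cost]) h14 (by omega) rfl ⟨fun a ha => ?_, fun p hp => ?_⟩
    · rw [← i1 a ha]; funext p; rw [Mem.set_apply, if_neg (fun h => ha h.1)]
    · rw [Mem.set_apply]
      split_ifs with h
      · rfl
      · exact i2 p (by omega)
  rintro s₁ - ⟨hreg₁, F₁, hF₁, i1, i2⟩
  refine (Tri.forN (hi := S) (T := 14) (F := F₁) (I := fun k F' =>
    (∀ a, a ≠ cnt → a ≠ rnk → F' a = F a) ∧ (∀ p ≤ S, F' cnt p = equal (F key) k p) ∧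
    ∀ i < k, F' rnk i = equal (F key) i (F key i)) (by simp [Program.wr]) (by omega) hF₁
    ⟨fun a ha _ => i1 a ha, fun p hp => ?_, by simp⟩ ?_ ?_ le_rfl).seq' (T₂ := 25 * S + 40) ?_
    (by simp only [Expr.cost]; omega)
  · rw [i2 p (by omega)]; simp [equal]
  · intro s' h; rw [Expr.eval, h 2 (by omega), hreg₁ 2 (by omega), hr]
  · rintro k s' F' hk hreg h14 hF' ⟨j1, j2, j3⟩
    have hkey : F' key = F key := j1 key h1 h2
    have hKk := hK k hk
    have e1 : ∀ {s'' : State b} {F'' : Mem}, F''.HeldBy s'' → s''.reg 14 = BitVec.ofNat b k →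
        F'' key = F key → (Expr.read key (.reg 14)).eval s'' = BitVec.ofNat b (F key k) := by
      intro s'' F'' h h' h''
      rw [h.read (x := k) (i := .reg 14) h' (by omega), h'']
    refine Tri.write_seq (T₂ := 9) ?_ (by simp [Expr.cost])
    have e2 := hF'.read (a := cnt) (e1 hF' h14 hkey) (by omega)
    have hF'' := hF'.setArr (a := rnk) (i := .reg 14) h14 (show k < 2 ^ b by omega) e2
    have hkey'' : (F'.set rnk k (F' cnt (F key k))) key = F key := by
      rw [← hkey]; funext p; rw [Mem.set_apply, if_neg (fun h => h2 h.1)]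
    have hcnt'' : (F'.set rnk k (F' cnt (F key k))) cnt = F' cnt := by
      funext p; rw [Mem.set_apply, if_neg (fun h => h3 h.1)]
    refine Tri.write_mem hF'' (by simp [Expr.cost]) (e1 hF'' (by simpa using h14) hkey'') (by omega)
      (eval_add (hF''.read (e1 hF'' (by simpa using h14) hkey'') (by omega)) rfl)
      ⟨fun a ha ha' => ?_, fun p hp => ?_, fun i hi => ?_⟩
    · rw [← j1 a ha ha']
      funext p
      rw [Mem.set_apply, if_neg (fun h => ha h.1), Mem.set_apply, if_neg (fun h => ha' h.1)]
    · rw [Mem.set_apply, equal_succ, hcnt'']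
      split_ifs with h h' h'
      · rw [j2 _ (by omega), h.2]
      · exact absurd h.2.symm h'
      · exact absurd ⟨rfl, h'.symm⟩ h
      · rw [j2 p hp, add_zero]
    · rw [Mem.set_apply, if_neg (fun h => h3 h.1.symm), Mem.set_apply]
      split_ifs with h
      · rw [h.2, j2 _ hKk]
      · exact j3 i (by
          rcases Nat.lt_succ_iff_lt_or_eq.1 hi with h' | h'
          · exact h'
          · exact absurd ⟨rfl, h'⟩ h)
  rintro s₂ - ⟨hreg₂, F₂, hF₂, j1, j2, j3⟩
  refine Tri.write_seq (T₂ := 25 * S + 37) ?_ (by simp [Expr.cost]; omega)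
  have hF₃ := hF₂.setArr (a := off) (s := s₂) (i := .const 0) (e := .const 0) rfl (by positivity) rfl
  refine (Tri.forN (hi := S + 1) (T := 9) (F := F₂.set off 0 0) (I := fun k F' =>
    (∀ a, a ≠ off → F' a = F₂ a) ∧ ∀ p ≤ k, F' off p = below (F key) S p)
    (by simp [Program.wr]) (by omega) hF₃ ⟨fun a ha => ?_, fun p hp => ?_⟩ ?_ ?_ le_rfl).mono
    (by simp only [Expr.cost]; omega) ?_
  · funext p; rw [Mem.set_apply, if_neg (fun h => ha h.1)]
  · obtain rfl : p = 0 := by omega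
    rw [Mem.set_apply, if_pos ⟨rfl, rfl⟩, below_zero]
  · intro s' h
    refine hS1 s' ?_
    rw [h 2 (by omega), State.setArr_reg, hreg₂ 2 (by omega), hreg₁ 2 (by omega), hr]
  · rintro k s' F' hk hreg h14 hF' ⟨k1, k2⟩
    refine Tri.write_mem hF' (by simp [Expr.cost]) (eval_add (x := k) (e := .reg 14) h14 rfl)
      (by omega) (eval_add (hF'.read (x := k) (i := .reg 14) h14 (by omega))
        (hF'.read (x := k) (i := .reg 14) h14 (by omega)))
      ⟨fun a ha => ?_, fun p hp => ?_⟩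
    · rw [← k1 a ha]; funext p; rw [Mem.set_apply, if_neg (fun h => ha h.1)]
    · rw [Mem.set_apply]
      split_ifs with h
      · rw [h.2, k2 k le_rfl, k1 cnt h4.symm, j2 k (by omega), below_succ]
      · exact k2 p (by
          rcases Nat.lt_succ_iff_lt_or_eq.1 (Nat.lt_succ_of_le hp) with h' | h'
          · omega
          · exact absurd ⟨rfl, h'⟩ h)
  · rintro s' - ⟨hreg, F', hF', k1, k2⟩
    refine ⟨fun r hr => ?_, F', hF', fun a ha ha' ha'' => ?_, k2, fun i hi => ?_⟩
    · rw [hreg r hr, State.setArr_reg, hreg₂ r hr, hreg₁ r hr]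
    · rw [k1 a ha'', j1 a ha ha']
    · rw [k1 rnk h5.symm, j3 i hi]

/-- The position of `i` after sorting by the key `K`. -/
def sortPos (K : ℕ → ℕ) (S i : ℕ) : ℕ := below K S (K i) + equal K i (K i)

theorem equal_strictMono {K : ℕ → ℕ} {i j p : ℕ} (hij : i < j) (hi : K i = p) :
    equal K i p < equal K j p := by
  have h1 : equal K (i + 1) p ≤ equal K j p :=
    Finset.card_le_card (Finset.filter_subset_filter _ (Finset.range_mono hij))
  rw [equal_succ, if_pos hi] at h1
  omega

theorem sortPos_lt_below {K : ℕ → ℕ} {S i : ℕ} (hi : i < S) :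
    sortPos K S i < below K S (K i + 1) := by
  rw [sortPos, below_succ]
  exact Nat.add_lt_add_left (equal_strictMono hi rfl) _

theorem sortPos_lt {K : ℕ → ℕ} {S i : ℕ} (hi : i < S) : sortPos K S i < S :=
  (sortPos_lt_below hi).trans_le (below_le _ _ _)

theorem key_le_of_sortPos_le {K : ℕ → ℕ} {S i j : ℕ} (hi : i < S)
    (h : sortPos K S j ≤ sortPos K S i) : K j ≤ K i := by
  by_contra hlt
  have h1 := sortPos_lt_below (K := K) hi
  have h2 := below_mono K S (show K i + 1 ≤ K j by omega)
  have h3 : below K S (K j) ≤ sortPos K S j := Nat.le_add_right _ _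
  omega

theorem sortPos_injOn (K : ℕ → ℕ) (S : ℕ) : Set.InjOn (sortPos K S) (Finset.range S) := by
  intro i hi j hj h
  rw [Finset.coe_range, Set.mem_Iio] at hi hj
  have hK : K i = K j := le_antisymm (key_le_of_sortPos_le hj h.le) (key_le_of_sortPos_le hi h.ge)
  rw [sortPos, sortPos, hK] at h
  rcases lt_trichotomy i j with hlt | rfl | hlt
  · have := equal_strictMono hlt hK; omega
  · rfl
  · have := equal_strictMono hlt hK.symm; rw [hK] at this; omega

theorem image_sortPos (K : ℕ → ℕ) (S : ℕ) :
    (Finset.range S).image (sortPos K S) = Finset.range S := by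
  refine Finset.eq_of_subset_of_card_le (fun x hx => ?_) ?_
  · obtain ⟨i, hi, rfl⟩ := Finset.mem_image.1 hx
    exact Finset.mem_range.2 (sortPos_lt (Finset.mem_range.1 hi))
  · rw [Finset.card_image_of_injOn (sortPos_injOn K S)]

theorem exists_sortPos_eq (K : ℕ → ℕ) {S x : ℕ} (hx : x < S) : ∃ i < S, sortPos K S i = x := by
  have h := Finset.mem_range.2 hx
  rw [← image_sortPos K S, Finset.mem_image] at h
  obtain ⟨i, hi, h⟩ := h
  exact ⟨i, Finset.mem_range.1 hi, h⟩

theorem sortPos_mem_iff {K : ℕ → ℕ} {S i p : ℕ} (hi : i < S) :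
    below K S p ≤ sortPos K S i ∧ sortPos K S i < below K S (p + 1) ↔ K i = p := by
  have h1 := sortPos_lt_below (K := K) hi
  have h2 : below K S (K i) ≤ sortPos K S i := Nat.le_add_right _ _
  constructor
  · rintro ⟨h3, h4⟩
    rcases lt_trichotomy (K i) p with h | h | h
    · have := below_mono K S (show K i + 1 ≤ p by omega); omega
    · exact h
    · have := below_mono K S (show p + 1 ≤ K i by omega); omega
  · rintro rfl
    exact ⟨h2, h1⟩

/-- A sum over the positions of the items with the key `p` is a sum over those items. -/
theorem sum_Ico_below {K : ℕ → ℕ} {S p : ℕ} (f : ℕ → ℕ) :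
    ∑ j ∈ Finset.Ico (below K S p) (below K S (p + 1)), f j =
      ∑ i ∈ Finset.range S, if K i = p then f (sortPos K S i) else 0 := by
  rw [← Finset.sum_filter]
  symm
  refine Finset.sum_bij (fun i _ => sortPos K S i) ?_ ?_ ?_ ?_
  · intro i hi
    rw [Finset.mem_filter, Finset.mem_range] at hi
    exact Finset.mem_Ico.2 ((sortPos_mem_iff hi.1).2 hi.2)
  · intro i hi j hj h
    exact sortPos_injOn K S (Finset.mem_filter.1 hi).1 (Finset.mem_filter.1 hj).1 h
  · intro x hx
    rw [Finset.mem_Ico] at hx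
    obtain ⟨i, hi, rfl⟩ := exists_sortPos_eq K (hx.2.trans_le (below_le K S _))
    exact ⟨i, Finset.mem_filter.2 ⟨Finset.mem_range.2 hi, (sortPos_mem_iff hi).1 hx⟩, rfl⟩
  · intro i _; rfl

/-! ### Preprocessing -/

/-- The program `p` changes no register but `14`, and ends with arrays that satisfy `R`. -/
def TriMem (p : Program) (s : State b) (T : ℕ) (R : Mem → Prop) : Prop :=
  Tri p s T fun s' => (∀ r, r ≠ 14 → s'.reg r = s.reg r) ∧ ∃ F : Mem, F.HeldBy s' ∧ R F

theorem TriMem.seq {p q : Program} {s : State b} {T T₁ T₂ : ℕ} {R R' : Mem → Prop}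
    (h : TriMem p s T₁ R)
    (h' : ∀ s' F, (∀ r, r ≠ 14 → s'.reg r = s.reg r) → F.HeldBy s' → R F → TriMem q s' T₂ R')
    (hT : T₁ + T₂ ≤ T) : TriMem (.seq p q) s T R' :=
  Tri.seq' h (fun s' _ ⟨hr, F, hF, hR⟩ => (h' s' F hr hF hR).mono le_rfl
    fun _ _ ⟨hr', hq⟩ => ⟨fun r h14 => (hr' r h14).trans (hr r h14), hq⟩) hT

/-- Write to the cells with the addresses `i`, for the values of register `14` below the value of
`e`. -/
def mapLoop (e : Expr) (a : ℕ) (i v : Expr) : Program := forN e (.write a i v)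

/-- If several rounds write to one cell, the specification only says that it holds the value of one
of them. -/
theorem mapLoop_spec {e : Expr} {a : ℕ} {i v : Expr} {s : State b} {F : Mem} {hi T : ℕ}
    (ix val : ℕ → ℕ) (hhi : hi < 2 ^ b) (hF : F.HeldBy s)
    (he : ∀ s' : State b, (∀ r, r ≠ 14 → s'.reg r = s.reg r) → e.eval s' = BitVec.ofNat b hi)
    (hix : ∀ k < hi, ix k < 2 ^ b)
    (hev : ∀ k < hi, ∀ (s' : State b) (F' : Mem), (∀ r, r ≠ 14 → s'.reg r = s.reg r) →
      (Expr.reg 14).eval s' = BitVec.ofNat b k → F'.HeldBy s' → (∀ a', a' ≠ a → F' a' = F a') →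
      i.eval s' = BitVec.ofNat b (ix k) ∧ v.eval s' = BitVec.ofNat b (val k))
    (hT : hi * (i.cost + v.cost + e.cost + 8) + (e.cost + 5) ≤ T) :
    TriMem (mapLoop e a i v) s T fun F' => (∀ a', a' ≠ a → F' a' = F a') ∧
      (∀ k < hi, ∃ k' < hi, ix k' = ix k ∧ F' a (ix k) = val k') ∧
      ∀ p, (∀ k < hi, ix k ≠ p) → F' a p = F a p := by
  refine Tri.forN (T := i.cost + v.cost + 1) (I := fun n F' => (∀ a', a' ≠ a → F' a' = F a') ∧
      (∀ k < n, ∃ k' < n, ix k' = ix k ∧ F' a (ix k) = val k') ∧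
      ∀ p, (∀ k < n, ix k ≠ p) → F' a p = F a p) (fun _ h => h) hhi hF
    ⟨fun _ _ => rfl, by simp, fun _ _ => rfl⟩ he ?_ (by
      rw [show i.cost + v.cost + 1 + (e.cost + 7) = i.cost + v.cost + e.cost + 8 by ring]
      exact hT)
  rintro n s' F' hn hreg h14 hF' ⟨h1, h2, h3⟩
  obtain ⟨e1, e2⟩ := hev n hn s' F' hreg h14 hF' h1
  refine Tri.write_mem hF' le_rfl e1 (hix n hn) e2 ⟨fun a' ha => ?_, fun k hk => ?_, fun p hp => ?_⟩
  · rw [← h1 a' ha]; funext p; rw [Mem.set_apply, if_neg (fun h => ha h.1)]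
  · rw [Mem.set_apply]
    split_ifs with h
    · exact ⟨n, by omega, h.2.symm, rfl⟩
    · have hkn : k < n := lt_of_le_of_ne (Nat.le_of_lt_succ hk) fun h' => h ⟨rfl, by rw [h']⟩
      obtain ⟨k', hk', h4, h5⟩ := h2 k hkn
      exact ⟨k', by omega, h4, h5⟩
  · rw [Mem.set_apply, if_neg fun h => hp n (by omega) h.2.symm]
    exact h3 p fun k hk => hp k (by omega)

/-- The common case of distinct addresses. -/
theorem mapLoop_spec' {e : Expr} {a : ℕ} {i v : Expr} {s : State b} {F : Mem} {hi T : ℕ}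
    (ix val : ℕ → ℕ) (hhi : hi < 2 ^ b) (hF : F.HeldBy s)
    (he : ∀ s' : State b, (∀ r, r ≠ 14 → s'.reg r = s.reg r) → e.eval s' = BitVec.ofNat b hi)
    (hix : ∀ k < hi, ix k < 2 ^ b) (hinj : ∀ k < hi, ∀ k' < hi, ix k' = ix k → k' = k)
    (hev : ∀ k < hi, ∀ (s' : State b) (F' : Mem), (∀ r, r ≠ 14 → s'.reg r = s.reg r) →
      (Expr.reg 14).eval s' = BitVec.ofNat b k → F'.HeldBy s' → (∀ a', a' ≠ a → F' a' = F a') →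
      i.eval s' = BitVec.ofNat b (ix k) ∧ v.eval s' = BitVec.ofNat b (val k))
    (hT : hi * (i.cost + v.cost + e.cost + 8) + (e.cost + 5) ≤ T) :
    TriMem (mapLoop e a i v) s T fun F' => (∀ a', a' ≠ a → F' a' = F a') ∧
      (∀ k < hi, F' a (ix k) = val k) ∧ ∀ p, (∀ k < hi, ix k ≠ p) → F' a p = F a p := by
  refine (mapLoop_spec ix val hhi hF he hix hev hT).mono le_rfl ?_
  rintro s' - ⟨hr, F', hF', h1, h2, h3⟩
  refine ⟨hr, F', hF', h1, fun k hk => ?_, h3⟩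
  obtain ⟨k', hk', h4, h5⟩ := h2 k hk
  rw [h5, hinj k hk k' hk' h4]

/-- Write the arcs of the graph, two for every edge, to the arrays `10` (sources), `11` (targets)
and `12` (weights). -/
def arcsProg : Program :=
  .seq (mapLoop (.reg 1) 10 (.reg 14) (.read 0 (.reg 14))) <|
  .seq (mapLoop (.reg 1) 10 (.op .add (.reg 1) (.reg 14)) (.read 1 (.reg 14))) <|
  .seq (mapLoop (.reg 1) 11 (.reg 14) (.read 1 (.reg 14))) <|
  .seq (mapLoop (.reg 1) 11 (.op .add (.reg 1) (.reg 14)) (.read 0 (.reg 14))) <|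
  .seq (mapLoop (.reg 1) 12 (.reg 14) (.read 2 (.reg 14))) <|
  mapLoop (.reg 1) 12 (.op .add (.reg 1) (.reg 14)) (.read 2 (.reg 14))

theorem arcsProg_spec {m : ℕ} {F : Mem} {s : State b} (hm : 2 * m + 2 < 2 ^ b)
    (hr : s.reg 1 = BitVec.ofNat b m) (hF : F.HeldBy s) :
    TriMem arcsProg s (120 * m + 60) fun F' => F' 3 = F 3 ∧ ∀ i < m,
      (F' 10 i = F 0 i ∧ F' 10 (m + i) = F 1 i) ∧ (F' 11 i = F 1 i ∧ F' 11 (m + i) = F 0 i) ∧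
      (F' 12 i = F 2 i ∧ F' 12 (m + i) = F 2 i) := by
  have loop1 : ∀ (a c : ℕ) (s : State b) (F : Mem), a ≠ c → s.reg 1 = BitVec.ofNat b m →
      F.HeldBy s → TriMem (mapLoop (.reg 1) a (.reg 14) (.read c (.reg 14))) s (12 * m + 6) fun F' =>
        (∀ a', a' ≠ a → F' a' = F a') ∧ ∀ i < m, F' a i = F c i := by
    intro a c s F hac hr hF
    refine (mapLoop_spec' (hi := m) (fun i => i) (F c) (by omega) hF
      (fun s' h => by rw [Expr.eval, h 1 (by omega), hr]) (fun k hk => by omega)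
      (fun _ _ _ _ h => h) ?_ (by simp only [Expr.cost]; omega)).mono le_rfl
      (fun s' _ ⟨h, F', h1, h2, h3, _⟩ => ⟨h, F', h1, h2, h3⟩)
    intro k hk s' F' _ h14 hF' hF''
    exact ⟨h14, by rw [hF'.read h14 (by omega), hF'' c hac.symm]⟩
  have loop2 : ∀ (a c : ℕ) (s : State b) (F : Mem), a ≠ c → s.reg 1 = BitVec.ofNat b m →
      F.HeldBy s → TriMem (mapLoop (.reg 1) a (.op .add (.reg 1) (.reg 14)) (.read c (.reg 14))) s
        (14 * m + 6) fun F' => (∀ a', a' ≠ a → F' a' = F a') ∧ (∀ i < m, F' a (m + i) = F c i) ∧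
          ∀ i < m, F' a i = F a i := by
    intro a c s F hac hr hF
    refine (mapLoop_spec' (hi := m) (fun i => m + i) (F c) (by omega) hF
      (fun s' h => by rw [Expr.eval, h 1 (by omega), hr]) (fun k hk => by omega)
      (fun _ _ _ _ h => by omega) ?_ (by simp only [Expr.cost]; omega)).mono le_rfl
      (fun s' _ ⟨h, F', h1, h2, h3, h4⟩ => ⟨h, F', h1, h2, h3, fun i hi => h4 i fun k _ => by omega⟩)
    intro k hk s' F' hreg h14 hF' hF''
    refine ⟨eval_add ?_ h14, by rw [hF'.read h14 (by omega), hF'' c hac.symm]⟩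
    rw [Expr.eval, hreg 1 (by omega), hr]
  refine (loop1 10 0 s F (by omega) hr hF).seq (T₂ := 108 * m + 54) ?_ (by omega)
  intro s₁ F₁ hr₁ hF₁ ⟨a1, b1⟩
  refine (loop2 10 1 s₁ F₁ (by omega) (by rw [hr₁ 1 (by omega), hr]) hF₁).seq
    (T₂ := 94 * m + 48) ?_ (by omega)
  intro s₂ F₂ hr₂ hF₂ ⟨a2, b2, c2⟩
  have hr₂' : s₂.reg 1 = BitVec.ofNat b m := by rw [hr₂ 1 (by omega), hr₁ 1 (by omega), hr]
  refine (loop1 11 1 s₂ F₂ (by omega) hr₂' hF₂).seq (T₂ := 82 * m + 42) ?_ (by omega)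
  intro s₃ F₃ hr₃ hF₃ ⟨a3, b3⟩
  have hr₃' : s₃.reg 1 = BitVec.ofNat b m := by rw [hr₃ 1 (by omega), hr₂']
  refine (loop2 11 0 s₃ F₃ (by omega) hr₃' hF₃).seq (T₂ := 68 * m + 36) ?_ (by omega)
  intro s₄ F₄ hr₄ hF₄ ⟨a4, b4, c4⟩
  have hr₄' : s₄.reg 1 = BitVec.ofNat b m := by rw [hr₄ 1 (by omega), hr₃']
  refine (loop1 12 2 s₄ F₄ (by omega) hr₄' hF₄).seq (T₂ := 54 * m + 30) ?_ (by omega)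
  intro s₅ F₅ hr₅ hF₅ ⟨a5, b5⟩
  have hr₅' : s₅.reg 1 = BitVec.ofNat b m := by rw [hr₅ 1 (by omega), hr₄']
  refine (loop2 12 2 s₅ F₅ (by omega) hr₅' hF₅).mono (by omega) ?_
  rintro s₆ - ⟨hr₆, F₆, hF₆, a6, b6, c6⟩
  refine ⟨hr₆, F₆, hF₆, ?_, fun i hi => ⟨⟨?_, ?_⟩, ⟨?_, ?_⟩, ?_, ?_⟩⟩
  · rw [a6 3, a5 3, a4 3, a3 3, a2 3, a1 3] <;> omega
  · rw [a6 10 (by omega), a5 10 (by omega), a4 10 (by omega), a3 10 (by omega), c2 i hi, b1 i hi]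
  · rw [a6 10 (by omega), a5 10 (by omega), a4 10 (by omega), a3 10 (by omega), b2 i hi,
      a1 1 (by omega)]
  · rw [a6 11 (by omega), a5 11 (by omega), c4 i hi, b3 i hi, a2 1 (by omega), a1 1 (by omega)]
  · rw [a6 11 (by omega), a5 11 (by omega), b4 i hi, a3 0 (by omega), a2 0 (by omega),
      a1 0 (by omega)]
  · rw [c6 i hi, b5 i hi, a4 2 (by omega), a3 2 (by omega), a2 2 (by omega), a1 2 (by omega)]
  · rw [b6 i hi, a5 2 (by omega), a4 2 (by omega), a3 2 (by omega), a2 2 (by omega),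
      a1 2 (by omega)]

/-- Name every vertex that is the source of an arc by the number of one of these arcs.  The names of
the sources go to array `14`, those of the targets to array `15`, and the labels to array `16`. -/
def namesProg : Program :=
  .seq (mapLoop (.reg 2) 13 (.read 10 (.reg 14)) (.reg 14)) <|
  .seq (mapLoop (.reg 2) 14 (.reg 14) (.read 13 (.read 10 (.reg 14)))) <|
  .seq (mapLoop (.reg 2) 15 (.reg 14) (.read 13 (.read 11 (.reg 14)))) <|
  mapLoop (.reg 2) 16 (.read 14 (.reg 14)) (.read 3 (.read 10 (.reg 14)))

/-- The names are numbers below `S`, whereas the vertices themselves can be arbitrarily large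
compared to the number of edges; so no time is spent on isolated vertices. -/
theorem namesProg_spec {S : ℕ} {F : Mem} {s : State b} (hS : S + 2 < 2 ^ b)
    (hr : s.reg 2 = BitVec.ofNat b S) (hF : F.HeldBy s) (hsrc : ∀ i < S, F 10 i < 2 ^ b)
    (htgt : ∀ i < S, F 11 i < 2 ^ b) :
    TriMem namesProg s (60 * S + 30) fun F' => F' 12 = F 12 ∧ ∃ rep : ℕ → ℕ,
      (∀ i < S, F' 14 i = rep (F 10 i) ∧ F' 15 i = rep (F 11 i)) ∧
      (∀ i < S, rep (F 10 i) < S ∧ F 10 (rep (F 10 i)) = F 10 i) ∧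
      ∀ i < S, F' 16 (rep (F 10 i)) = F 3 (F 10 i) := by
  have hbound : ∀ {s₀ s' : State b}, s₀.reg 2 = BitVec.ofNat b S →
      (∀ r, r ≠ 14 → s'.reg r = s₀.reg r) → (Expr.reg 2).eval s' = BitVec.ofNat b S :=
    fun h0 h => by rw [Expr.eval, h 2 (by omega), h0]
  refine (mapLoop_spec (hi := S) (F 10) (fun i => i) (by omega) hF (fun s' h => hbound hr h)
    hsrc ?_ le_rfl).seq (T₂ := 45 * S + 24) ?_ (by simp only [Expr.cost]; omega)
  · intro k hk s' F' _ h14 hF' hF''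
    exact ⟨by rw [hF'.read h14 (by omega), hF'' 10 (by omega)], h14⟩
  intro s₁ F₁ hr₁ hF₁ ⟨a1, b1, _⟩
  have hr₁' : s₁.reg 2 = BitVec.ofNat b S := by rw [hr₁ 2 (by omega), hr]
  refine (mapLoop_spec' (hi := S) (fun i => i) (fun i => F₁ 13 (F 10 i)) (by omega) hF₁
    (fun s' h => hbound hr₁' h) (fun k hk => by omega) (fun _ _ _ _ h => h) ?_ le_rfl).seq
    (T₂ := 31 * S + 18) ?_ (by simp only [Expr.cost]; omega)
  · intro k hk s' F' _ h14 hF' hF''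
    refine ⟨h14, ?_⟩
    rw [hF'.read (x := F 10 k) ?_ (hsrc k hk), hF'' 13 (by omega)]
    rw [hF'.read h14 (by omega), hF'' 10 (by omega), a1 10 (by omega)]
  intro s₂ F₂ hr₂ hF₂ ⟨a2, b2, _⟩
  have hr₂' : s₂.reg 2 = BitVec.ofNat b S := by rw [hr₂ 2 (by omega), hr₁']
  refine (mapLoop_spec' (hi := S) (fun i => i) (fun i => F₁ 13 (F 11 i)) (by omega) hF₂
    (fun s' h => hbound hr₂' h) (fun k hk => by omega) (fun _ _ _ _ h => h) ?_ le_rfl).seq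
    (T₂ := 17 * S + 12) ?_ (by simp only [Expr.cost]; omega)
  · intro k hk s' F' _ h14 hF' hF''
    refine ⟨h14, ?_⟩
    rw [hF'.read (x := F 11 k) ?_ (htgt k hk), hF'' 13 (by omega), a2 13 (by omega)]
    rw [hF'.read h14 (by omega), hF'' 11 (by omega), a2 11 (by omega), a1 11 (by omega)]
  intro s₃ F₃ hr₃ hF₃ ⟨a3, b3, _⟩
  have hr₃' : s₃.reg 2 = BitVec.ofNat b S := by rw [hr₃ 2 (by omega), hr₂']
  have hrep : ∀ i < S, F₁ 13 (F 10 i) < S ∧ F 10 (F₁ 13 (F 10 i)) = F 10 i := by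
    intro i hi
    obtain ⟨k, hk, h1, h2⟩ := b1 i hi
    rw [h2]
    exact ⟨hk, h1⟩
  refine (mapLoop_spec (hi := S) (fun i => F₁ 13 (F 10 i)) (fun i => F 3 (F 10 i)) (by omega) hF₃
    (fun s' h => hbound hr₃' h) (fun k hk => by have := (hrep k hk).1; omega) ?_ le_rfl).mono
    (by simp only [Expr.cost]; omega) ?_
  · intro k hk s' F' _ h14 hF' hF''
    constructor
    · rw [hF'.read h14 (by omega), hF'' 14 (by omega), a3 14 (by omega), b2 k hk]
    · rw [hF'.read (x := F 10 k) ?_ (hsrc k hk), hF'' 3 (by omega), a3 3 (by omega), a2 3 (by omega),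
        a1 3 (by omega)]
      rw [hF'.read h14 (by omega), hF'' 10 (by omega), a3 10 (by omega), a2 10 (by omega),
        a1 10 (by omega)]
  rintro s₄ - ⟨hr₄, F₄, hF₄, a4, b4, -⟩
  refine ⟨hr₄, F₄, hF₄, ?_, F₁ 13, fun i hi => ⟨?_, ?_⟩, hrep, fun i hi => ?_⟩
  · rw [a4 12, a3 12, a2 12, a1 12] <;> omega
  · rw [a4 14 (by omega), a3 14 (by omega), b2 i hi]
  · rw [a4 15 (by omega), b3 i hi]
  · obtain ⟨k, hk, h1, h2⟩ := b4 i hi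
    rw [h2]
    have := congrArg (F 10) h1
    simp only [(hrep k hk).2, (hrep i hi).2] at this
    rw [this]

/-- Sort the vertices by decreasing degree.  Their positions go to array `22`, and their labels to
array `7`. -/
def vertexSortProg : Program :=
  .seq (rankProg 14 19 20 21) <|
  .seq (mapLoop (.reg 2) 18 (.reg 14) (.op .sub (.reg 2)
    (.op .sub (.read 21 (.op .add (.reg 14) (.const 1))) (.read 21 (.reg 14))))) <|
  .seq (rankProg 18 19 20 21) <|
  .seq (mapLoop (.reg 2) 22 (.reg 14) (.op .add (.read 21 (.read 18 (.reg 14)))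
    (.read 20 (.reg 14)))) <|
  mapLoop (.reg 2) 7 (.read 22 (.reg 14)) (.read 16 (.reg 14))

theorem equal_le (K : ℕ → ℕ) (S p : ℕ) : equal K S p ≤ S :=
  (Finset.card_filter_le _ _).trans_eq (Finset.card_range S)

theorem vertexSortProg_spec {S : ℕ} {F : Mem} {s : State b} (hS : S + 2 < 2 ^ b)
    (hr : s.reg 2 = BitVec.ofNat b S) (hF : F.HeldBy s) (hX : ∀ i < S, F 14 i < S) :
    TriMem vertexSortProg s (240 * S + 220) fun F' => (F' 12 = F 12 ∧ F' 14 = F 14 ∧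
      F' 15 = F 15) ∧ ∃ K : ℕ → ℕ, (∀ p < S, K p = S - equal (F 14) S p) ∧
      (∀ p < S, F' 22 p = sortPos K S p) ∧ ∀ p < S, F' 7 (sortPos K S p) = F 16 p := by
  have hbound : ∀ {s₀ s' : State b}, s₀.reg 2 = BitVec.ofNat b S →
      (∀ r, r ≠ 14 → s'.reg r = s₀.reg r) → (Expr.reg 2).eval s' = BitVec.ofNat b S :=
    fun h0 h => by rw [Expr.eval, h 2 (by omega), h0]
  refine TriMem.seq (rankProg_spec (by omega) (by omega) (by omega) (by omega) (by omega) hS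
    (fun i hi => (hX i hi).le) s hr hF) (T₂ := 160 * S + 140) ?_ (by omega)
  intro s₁ F₁ hr₁ hF₁ ⟨a1, b1, _⟩
  have hr₁' : s₁.reg 2 = BitVec.ofNat b S := by rw [hr₁ 2 (by omega), hr]
  refine (mapLoop_spec' (hi := S) (fun i => i) (fun p => S - equal (F 14) S p) (by omega) hF₁
    (fun s' h => hbound hr₁' h) (fun k hk => by omega) (fun _ _ _ _ h => h) ?_ le_rfl).seq
    (T₂ := 140 * S + 130) ?_ (by simp only [Expr.cost]; omega)
  · intro k hk s' F' hreg h14 hF' hF''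
    refine ⟨h14, eval_sub (hbound hr₁' hreg) ?_ (equal_le _ _ _)⟩
    have h1 := below_succ (F 14) S k
    rw [show equal (F 14) S k = below (F 14) S (k + 1) - below (F 14) S k by omega]
    refine eval_sub ?_ ?_ (by omega)
    · rw [hF'.read (eval_add h14 rfl) (by omega), hF'' 21 (by omega), b1 _ (by omega)]
    · rw [hF'.read h14 (by omega), hF'' 21 (by omega), b1 _ (by omega)]
  intro s₂ F₂ hr₂ hF₂ ⟨a2, b2, _⟩
  have hr₂' : s₂.reg 2 = BitVec.ofNat b S := by rw [hr₂ 2 (by omega), hr₁']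
  have hK : ∀ i < S, F₂ 18 i ≤ S := fun i hi => by rw [b2 i hi]; omega
  refine TriMem.seq (rankProg_spec (by omega) (by omega) (by omega) (by omega) (by omega) hS
    hK s₂ hr₂' hF₂) (T₂ := 40 * S + 40) ?_ (by omega)
  intro s₃ F₃ hr₃ hF₃ ⟨a3, b3, c3⟩
  have hr₃' : s₃.reg 2 = BitVec.ofNat b S := by rw [hr₃ 2 (by omega), hr₂']
  refine (mapLoop_spec' (hi := S) (fun i => i) (fun p => sortPos (F₂ 18) S p) (by omega) hF₃
    (fun s' h => hbound hr₃' h) (fun k hk => by omega) (fun _ _ _ _ h => h) ?_ le_rfl).seq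
    (T₂ := 20 * S + 20) ?_ (by simp only [Expr.cost]; omega)
  · intro k hk s' F' hreg h14 hF' hF''
    have hKk := hK k hk
    refine ⟨h14, eval_add ?_ ?_⟩
    · rw [hF'.read (x := F₂ 18 k) ?_ (by omega), hF'' 21 (by omega), b3 _ (by omega)]
      rw [hF'.read h14 (by omega), hF'' 18 (by omega), a3 18 (by omega) (by omega) (by omega)]
    · rw [hF'.read h14 (by omega), hF'' 20 (by omega), c3 k hk]
  intro s₄ F₄ hr₄ hF₄ ⟨a4, b4, _⟩
  have hr₄' : s₄.reg 2 = BitVec.ofNat b S := by rw [hr₄ 2 (by omega), hr₃']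
  have hlt : ∀ k < S, sortPos (F₂ 18) S k < S := fun k hk => sortPos_lt hk
  refine (mapLoop_spec' (hi := S) (fun i => sortPos (F₂ 18) S i) (fun p => F 16 p) (by omega) hF₄
    (fun s' h => hbound hr₄' h) (fun k hk => by have := hlt k hk; omega)
    (fun k hk k' hk' h => sortPos_injOn _ S (by simpa using hk') (by simpa using hk) h)
    ?_ le_rfl).mono (by simp only [Expr.cost]; omega) ?_
  · intro k hk s' F' hreg h14 hF' hF''
    constructor
    · rw [hF'.read h14 (by omega), hF'' 22 (by omega), b4 k hk]
    · rw [hF'.read h14 (by omega), hF'' 16 (by omega), a4 16 (by omega),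
        a3 16 (by omega) (by omega) (by omega), a2 16 (by omega),
        a1 16 (by omega) (by omega) (by omega)]
  rintro s₅ - ⟨hr₅, F₅, hF₅, a5, b5, -⟩
  refine ⟨hr₅, F₅, hF₅, ⟨?_, ?_, ?_⟩, F₂ 18, b2, fun p hp => ?_, b5⟩
  · rw [a5 12, a4 12, a3 12, a2 12, a1 12] <;> omega
  · rw [a5 14, a4 14, a3 14, a2 14, a1 14] <;> omega
  · rw [a5 15, a4 15, a3 15, a2 15, a1 15] <;> omega
  · rw [a5 22 (by omega), b4 p hp]

/-- Sort the arcs by their sources. -/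
def arcSortProg : Program :=
  .seq (mapLoop (.reg 2) 23 (.reg 14) (.read 22 (.read 14 (.reg 14)))) <|
  .seq (rankProg 23 19 20 4) <|
  .seq (mapLoop (.reg 2) 24 (.reg 14) (.op .add (.read 4 (.read 23 (.reg 14)))
    (.read 20 (.reg 14)))) <|
  .seq (mapLoop (.reg 2) 5 (.read 24 (.reg 14)) (.read 22 (.read 15 (.reg 14)))) <|
  mapLoop (.reg 2) 6 (.read 24 (.reg 14)) (.read 12 (.reg 14))

theorem arcSortProg_spec {S : ℕ} {F : Mem} {s : State b} (hS : S + 2 < 2 ^ b)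
    (hr : s.reg 2 = BitVec.ofNat b S) (hF : F.HeldBy s) (hX : ∀ i < S, F 14 i < S)
    (hY : ∀ i < S, F 15 i < S) (hpos : ∀ i < S, F 22 i < S) :
    TriMem arcSortProg s (180 * S + 140) fun F' => F' 7 = F 7 ∧ ∃ K : ℕ → ℕ,
      (∀ i < S, K i = F 22 (F 14 i)) ∧ (∀ p ≤ S, F' 4 p = below K S p) ∧
      ∀ i < S, F' 5 (sortPos K S i) = F 22 (F 15 i) ∧ F' 6 (sortPos K S i) = F 12 i := by
  have hbound : ∀ {s₀ s' : State b}, s₀.reg 2 = BitVec.ofNat b S →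
      (∀ r, r ≠ 14 → s'.reg r = s₀.reg r) → (Expr.reg 2).eval s' = BitVec.ofNat b S :=
    fun h0 h => by rw [Expr.eval, h 2 (by omega), h0]
  refine (mapLoop_spec' (hi := S) (fun i => i) (fun i => F 22 (F 14 i)) (by omega) hF
    (fun s' h => hbound hr h) (fun k hk => by omega) (fun _ _ _ _ h => h) ?_ le_rfl).seq
    (T₂ := 165 * S + 134) ?_ (by simp only [Expr.cost]; omega)
  · intro k hk s' F' hreg h14 hF' hF''
    have := hX k hk
    refine ⟨h14, ?_⟩
    rw [hF'.read (x := F 14 k) ?_ (by omega), hF'' 22 (by omega)]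
    rw [hF'.read h14 (by omega), hF'' 14 (by omega)]
  intro s₁ F₁ hr₁ hF₁ ⟨a1, b1, _⟩
  have hr₁' : s₁.reg 2 = BitVec.ofNat b S := by rw [hr₁ 2 (by omega), hr]
  have hK : ∀ i < S, F₁ 23 i ≤ S := fun i hi => by rw [b1 i hi]; exact (hpos _ (hX i hi)).le
  refine TriMem.seq (rankProg_spec (by omega) (by omega) (by omega) (by omega) (by omega) hS
    hK s₁ hr₁' hF₁) (T₂ := 85 * S + 54) ?_ (by omega)
  intro s₂ F₂ hr₂ hF₂ ⟨a2, b2, c2⟩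
  have hr₂' : s₂.reg 2 = BitVec.ofNat b S := by rw [hr₂ 2 (by omega), hr₁']
  refine (mapLoop_spec' (hi := S) (fun i => i) (fun p => sortPos (F₁ 23) S p) (by omega) hF₂
    (fun s' h => hbound hr₂' h) (fun k hk => by omega) (fun _ _ _ _ h => h) ?_ le_rfl).seq
    (T₂ := 65 * S + 40) ?_ (by simp only [Expr.cost]; omega)
  · intro k hk s' F' hreg h14 hF' hF''
    have hKk := hK k hk
    refine ⟨h14, eval_add ?_ ?_⟩
    · rw [hF'.read (x := F₁ 23 k) ?_ (by omega), hF'' 4 (by omega), b2 _ (by omega)]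
      rw [hF'.read h14 (by omega), hF'' 23 (by omega), a2 23 (by omega) (by omega) (by omega)]
    · rw [hF'.read h14 (by omega), hF'' 20 (by omega), c2 k hk]
  intro s₃ F₃ hr₃ hF₃ ⟨a3, b3, _⟩
  have hr₃' : s₃.reg 2 = BitVec.ofNat b S := by rw [hr₃ 2 (by omega), hr₂']
  have hlt : ∀ k < S, sortPos (F₁ 23) S k < S := fun k hk => sortPos_lt hk
  have hinj : ∀ k < S, ∀ k' < S, sortPos (F₁ 23) S k' = sortPos (F₁ 23) S k → k' = k :=
    fun k hk k' hk' h => sortPos_injOn _ S (by simpa using hk') (by simpa using hk) h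
  refine (mapLoop_spec' (hi := S) (fun i => sortPos (F₁ 23) S i) (fun i => F 22 (F 15 i)) (by omega)
    hF₃ (fun s' h => hbound hr₃' h) (fun k hk => by have := hlt k hk; omega) hinj ?_ le_rfl).seq
    (T₂ := 30 * S + 20) ?_ (by simp only [Expr.cost]; omega)
  · intro k hk s' F' hreg h14 hF' hF''
    have := hY k hk
    constructor
    · rw [hF'.read h14 (by omega), hF'' 24 (by omega), b3 k hk]
    · rw [hF'.read (x := F 15 k) ?_ (by omega), hF'' 22 (by omega), a3 22 (by omega),
        a2 22 (by omega) (by omega) (by omega), a1 22 (by omega)]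
      rw [hF'.read h14 (by omega), hF'' 15 (by omega), a3 15 (by omega),
        a2 15 (by omega) (by omega) (by omega), a1 15 (by omega)]
  intro s₄ F₄ hr₄ hF₄ ⟨a4, b4, _⟩
  have hr₄' : s₄.reg 2 = BitVec.ofNat b S := by rw [hr₄ 2 (by omega), hr₃']
  refine (mapLoop_spec' (hi := S) (fun i => sortPos (F₁ 23) S i) (F 12) (by omega)
    hF₄ (fun s' h => hbound hr₄' h) (fun k hk => by have := hlt k hk; omega) hinj ?_ le_rfl).mono
    (by simp only [Expr.cost]; omega) ?_
  · intro k hk s' F' hreg h14 hF' hF''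
    constructor
    · rw [hF'.read h14 (by omega), hF'' 24 (by omega), a4 24 (by omega), b3 k hk]
    · rw [hF'.read h14 (by omega), hF'' 12 (by omega), a4 12 (by omega), a3 12 (by omega),
        a2 12 (by omega) (by omega) (by omega), a1 12 (by omega)]
  rintro s₅ - ⟨hr₅, F₅, hF₅, a5, b5, -⟩
  refine ⟨hr₅, F₅, hF₅, ?_, F₁ 23, b1, fun p hp => ?_, fun i hi => ⟨?_, b5 i hi⟩⟩
  · rw [a5 7, a4 7, a3 7, a2 7, a1 7] <;> omega
  · rw [a5 4 (by omega), a4 4 (by omega), a3 4 (by omega), b2 p (by omega)]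
  · rw [a5 5 (by omega), b4 i hi]

/-! ### The sorted graph -/

/-- Vertices sorted by decreasing degree: the degree times the number of vertices up to the given
one is at most the number of arcs. -/
theorem equal_mul_sortPos_le {X K : ℕ → ℕ} {S : ℕ} (hX : ∀ i < S, X i < S)
    (hK : ∀ p < S, K p = S - equal X S p) {p : ℕ} (hp : p < S) :
    equal X S p * (sortPos K S p + 1) ≤ S := by
  set v := sortPos K S p with hv
  have hvS : v < S := sortPos_lt hp
  have hsum : ∑ q ∈ Finset.range S, equal X S q = S := by
    have := Finset.card_eq_sum_card_fiberwise (s := Finset.range S) (t := Finset.range S) (f := X)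
      (fun i hi => by simpa using hX i (by simpa using hi))
    rw [Finset.card_range] at this
    exact this.symm
  set A := (Finset.range S).filter fun q => sortPos K S q ≤ v with hA
  have hcard : A.card = v + 1 := by
    rw [← Finset.card_range (v + 1), ← Finset.card_image_of_injOn (f := sortPos K S) (s := A)
      ((sortPos_injOn K S).mono (by rw [hA, Finset.coe_subset]; exact Finset.filter_subset _ _))]
    congr 1
    ext x
    simp only [hA, Finset.mem_image, Finset.mem_filter, Finset.mem_range]
    constructor
    · rintro ⟨q, ⟨-, hq⟩, rfl⟩; omega
    · intro hx
      obtain ⟨q, hq, rfl⟩ := exists_sortPos_eq K (show x < S by omega)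
      exact ⟨q, ⟨hq, by omega⟩, rfl⟩
  calc equal X S p * (v + 1) = ∑ q ∈ A, equal X S p := by
        rw [Finset.sum_const, hcard, smul_eq_mul, mul_comm]
    _ ≤ ∑ q ∈ A, equal X S q := by
        refine Finset.sum_le_sum fun q hq => ?_
        rw [hA, Finset.mem_filter, Finset.mem_range] at hq
        have h1 := key_le_of_sortPos_le hp hq.2
        rw [hK q hq.1, hK p hp] at h1
        have := equal_le X S p
        omega
    _ ≤ ∑ q ∈ Finset.range S, equal X S q :=
        Finset.sum_le_sum_of_subset (Finset.filter_subset _ _)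
    _ = S := hsum

/-- A vertex with a neighbor. -/
def NonIsolated {V : Type*} (G : SimpleGraph V) (u : V) : Prop := ∃ x, G.Adj u x

open Classical in
/-- The sorted graph `g` represents `G`, without its isolated vertices; `pos` sends the vertices of
`G` to those of `g`. -/
structure Represents {L : ℕ} (g : Csr) (G : WeightedLabeledGraph L) (pos : Fin G.n → ℕ) :
    Prop where
  inj : ∀ u v, NonIsolated G.graph u → NonIsolated G.graph v → pos u = pos v → u = v
  lt : ∀ u, NonIsolated G.graph u → pos u < g.S
  lab : ∀ u, NonIsolated G.graph u → g.lab (pos u) = G.label u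
  adj : ∀ x y, g.adj x y = ∑ u, ∑ v,
    if G.graph.Adj u v ∧ pos u = x ∧ pos v = y then G.weight s(u, v) else 0

open Classical in
/-- A sum over ordered pairs of adjacent vertices as a sum over the edges. -/
theorem sum_adj_eq {n m : ℕ} {G : SimpleGraph (Fin n)} {u v : Fin m → Fin n}
    (h : Set.BijOn (fun i => s(u i, v i)) Set.univ G.edgeSet) (f : Fin n → Fin n → ℕ) :
    (∑ x, ∑ y, if G.Adj x y then f x y else 0) = ∑ i, (f (u i) (v i) + f (v i) (u i)) := by
  have hadj : ∀ i, G.Adj (u i) (v i) := fun i => h.mapsTo (Set.mem_univ i)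
  have h1 : ∀ x y, (if G.Adj x y then f x y else 0) =
      ∑ i, if s(u i, v i) = s(x, y) then f x y else 0 := by
    intro x y
    split_ifs with hxy
    · obtain ⟨i, -, hi⟩ := h.surjOn (show s(x, y) ∈ G.edgeSet from hxy)
      rw [Finset.sum_eq_single i]
      · rw [if_pos hi]
      · intro j _ hj
        rw [if_neg]
        intro hj'
        exact hj (h.injOn (Set.mem_univ _) (Set.mem_univ _) (hj'.trans hi.symm))
      · simp
    · symm
      refine Finset.sum_eq_zero fun i _ => if_neg fun hi => hxy ?_
      have : s(u i, v i) ∈ G.edgeSet := hadj i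
      rw [hi] at this
      exact this
  simp only [h1]
  have h2 : ∀ x, ∑ y, ∑ i, (if s(u i, v i) = s(x, y) then f x y else 0) =
      ∑ i, ∑ y, (if s(u i, v i) = s(x, y) then f x y else 0) := fun x => Finset.sum_comm
  simp only [h2]
  rw [Finset.sum_comm]
  refine Finset.sum_congr rfl fun i _ => ?_
  have hne := (hadj i).ne
  have h3 : ∀ x y, (if s(u i, v i) = s(x, y) then f x y else 0) =
      (if u i = x then if v i = y then f x y else 0 else 0) +
        (if v i = x then if u i = y then f x y else 0 else 0) := by
    intro x y
    simp only [Sym2.eq_iff]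
    by_cases h4 : u i = x <;> by_cases h5 : v i = y <;> by_cases h6 : v i = x <;>
      by_cases h7 : u i = y <;> simp_all
  simp only [h3, Finset.sum_add_distrib]
  simp

/-- Compute the sorted graph, and set the parameter `M` to the number of edges plus `K`. -/
def prepProg (K : ℕ) : Program :=
  .seq (.assign 2 (.op .add (.reg 1) (.reg 1))) <|
  .seq (.assign 3 (.op .add (.reg 1) (.const K))) <|
  .seq (.assign 7 (.const 0)) <|
  .seq arcsProg <| .seq namesProg <| .seq vertexSortProg arcSortProg

/-- In linear time in the number of edges, the program computes a representation of the graph. -/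
theorem prepProg_spec {L : ℕ} (K : ℕ) (G : WeightedLabeledGraph L) (hm : 2 * G.m + 2 < 2 ^ b)
    (s : State b) (hs : G.HeldBy s) :
    Tri (prepProg K) s (1100 * (G.m + 1)) (fun s' => ∃ (g : Csr) (pos : Fin G.n → ℕ) (δ D D' : ℕ),
      g.Valid ∧ g.S = 2 * G.m ∧ (∀ v, g.lab v < 2 ^ b) ∧ Represents g G pos ∧
      (⟨g, G.m + K, δ, D, D'⟩ : Params).HeldBy s') := by
  classical
  obtain ⟨hn, hr1, hedges, hlab⟩ := hs
  generalize hmdef : G.m = m at *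
  obtain ⟨u, v, hbij, harr⟩ := hedges
  have hr1' : s.reg 1 = BitVec.ofNat b m := eq_ofNat_of_toNat_eq hr1
  have hnb : G.n < 2 ^ b := by rw [← hn]; exact BitVec.isLt _
  have hF₀ := exists_mem s
  set F₀ : Mem := fun a p => (s.arr a (BitVec.ofNat b p)).toNat with hF₀def
  have hF₀u : ∀ i : Fin m, F₀ 0 i = u i := fun i => (harr i).1
  have hF₀v : ∀ i : Fin m, F₀ 1 i = v i := fun i => (harr i).2.1
  have hF₀w : ∀ i : Fin m, F₀ 2 i = G.weight s(u i, v i) := fun i => (harr i).2.2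
  have hF₀l : ∀ x : Fin G.n, F₀ 3 x = G.label x := hlab
  refine Tri.assign_seq (T₂ := 1100 * m + 1080) (Tri.assign_seq (T₂ := 1100 * m + 1060)
    (Tri.assign_seq (T₂ := 1100 * m + 1000) ?_ ?_) ?_) ?_
  rotate_left
  iterate 3 simp only [Expr.cost]; omega
  set s₀ := ((s.setReg 2 ((Expr.op .add (.reg 1) (.reg 1)).eval s)).setReg 3
    ((Expr.op .add (.reg 1) (.const K)).eval
      (s.setReg 2 ((Expr.op .add (.reg 1) (.reg 1)).eval s)))).setReg 7
    ((Expr.const 0).eval ((s.setReg 2 ((Expr.op .add (.reg 1) (.reg 1)).eval s)).setReg 3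
    ((Expr.op .add (.reg 1) (.const K)).eval
      (s.setReg 2 ((Expr.op .add (.reg 1) (.reg 1)).eval s))))) with hs₀
  have h1₀ : s₀.reg 1 = BitVec.ofNat b m := by simp [hs₀, hr1']
  have h2₀ : s₀.reg 2 = BitVec.ofNat b (2 * m) := by
    simp [hs₀, hr1', Expr.eval, Op.eval, ← BitVec.ofNat_add, two_mul]
  have h3₀ : s₀.reg 3 = BitVec.ofNat b (m + K) := by
    simp [hs₀, hr1', Expr.eval, Op.eval, BitVec.ofNat_add]
  have h7₀ : s₀.reg 7 = BitVec.ofNat b 0 := by simp [hs₀, Expr.eval]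
  set S := 2 * m with hSdef
  refine Tri.seq' (T₂ := 980 * m + 940) (arcsProg_spec hm h1₀ (F := F₀) hF₀) ?_ (by omega)
  rintro s₁ - ⟨hr₁, F₁, hF₁, hlab₁, harcs⟩
  have h2₁ : s₁.reg 2 = BitVec.ofNat b S := by rw [hr₁ 2 (by omega), h2₀]
  -- an arc comes from an edge, in one of the two directions
  have hcase : ∀ i < S, ∃ e : Fin m, (F₁ 10 i = u e ∧ F₁ 11 i = v e) ∨
      (F₁ 10 i = v e ∧ F₁ 11 i = u e) := by
    intro i hi
    by_cases him : i < m
    · obtain ⟨⟨h1, -⟩, ⟨h2, -⟩, -⟩ := harcs i him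
      exact ⟨⟨i, him⟩, Or.inl ⟨h1.trans (hF₀u ⟨i, him⟩), h2.trans (hF₀v ⟨i, him⟩)⟩⟩
    · have him' : i - m < m := by omega
      obtain ⟨⟨-, h1⟩, ⟨-, h2⟩, -⟩ := harcs (i - m) him'
      rw [show m + (i - m) = i by omega] at h1 h2
      exact ⟨⟨i - m, him'⟩, Or.inr ⟨h1.trans (hF₀v ⟨i - m, him'⟩), h2.trans (hF₀u ⟨i - m, him'⟩)⟩⟩
  have hadj : ∀ i, G.graph.Adj (u i) (v i) := fun i => hbij.mapsTo (Set.mem_univ i)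
  -- every vertex with a neighbor is the source of an arc
  have hsource : ∀ x, NonIsolated G.graph x → ∃ i < S, F₁ 10 i = x := by
    rintro x ⟨y, hxy⟩
    obtain ⟨i, -, hi⟩ := hbij.surjOn (show s(x, y) ∈ G.graph.edgeSet from hxy)
    have hi2 := i.2
    obtain ⟨⟨h1, h2⟩, -⟩ := harcs i i.2
    rcases Sym2.eq_iff.1 hi with ⟨h3, -⟩ | ⟨-, h3⟩
    · exact ⟨i, by omega, by rw [h1, hF₀u i, h3]⟩
    · exact ⟨m + i, by omega, by rw [h2, hF₀v i, h3]⟩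
  have hsrcN : ∀ i < S, ∃ x, NonIsolated G.graph x ∧ F₁ 10 i = x := by
    intro i hi
    obtain ⟨e, ⟨h1, -⟩ | ⟨h1, -⟩⟩ := hcase i hi
    · exact ⟨u e, ⟨_, hadj e⟩, h1⟩
    · exact ⟨v e, ⟨_, (hadj e).symm⟩, h1⟩
  have htgtN : ∀ i < S, ∃ x, NonIsolated G.graph x ∧ F₁ 11 i = x := by
    intro i hi
    obtain ⟨e, ⟨-, h1⟩ | ⟨-, h1⟩⟩ := hcase i hi
    · exact ⟨v e, ⟨_, (hadj e).symm⟩, h1⟩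
    · exact ⟨u e, ⟨_, hadj e⟩, h1⟩
  refine Tri.seq' (T₂ := 860 * m + 700) (namesProg_spec hm h2₁ hF₁ (fun i hi => ?_)
    (fun i hi => ?_)) ?_ (by omega)
  · obtain ⟨x, -, hx⟩ := hsrcN i hi
    rw [hx]; omega
  · obtain ⟨x, -, hx⟩ := htgtN i hi
    rw [hx]; omega
  rintro s₂ - ⟨hr₂, F₂, hF₂, hwt₂, rep, hrep, hrepS, hlab₂⟩
  have h2₂ : s₂.reg 2 = BitVec.ofNat b S := by rw [hr₂ 2 (by omega), h2₁]
  have hrepN : ∀ x, NonIsolated G.graph x → rep x < S ∧ F₁ 10 (rep x) = x := by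
    intro x hx
    obtain ⟨i, hi, h1⟩ := hsource x hx
    rw [← h1]
    exact hrepS i hi
  have hX : ∀ i < S, F₂ 14 i < S := fun i hi => by rw [(hrep i hi).1]; exact (hrepS i hi).1
  have hY : ∀ i < S, F₂ 15 i < S := fun i hi => by
    obtain ⟨x, hx, h1⟩ := htgtN i hi
    rw [(hrep i hi).2, h1]; exact (hrepN x hx).1
  refine Tri.seq' (T₂ := 360 * m + 140) (vertexSortProg_spec hm h2₂ hF₂ hX) ?_ (by omega)
  rintro s₃ - ⟨hr₃, F₃, hF₃, ⟨hwt₃, hX₃, hY₃⟩, Kv, hKv, hpos₃, hlab₃⟩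
  have h2₃ : s₃.reg 2 = BitVec.ofNat b S := by rw [hr₃ 2 (by omega), h2₂]
  refine (arcSortProg_spec hm h2₃ hF₃ (by rwa [hX₃]) (by rwa [hY₃]) (fun i hi => by
    rw [hpos₃ i hi]; exact sortPos_lt hi)).mono (by omega) ?_
  rintro s₄ - ⟨hr₄, F₄, hF₄, hlab₄, K, hK, hoff, hout⟩
  have hKX : ∀ i < S, K i = sortPos Kv S (rep (F₁ 10 i)) := fun i hi => by
    rw [hK i hi, hX₃, hpos₃ _ (hX i hi), (hrep i hi).1]
  have hKlt : ∀ i < S, K i < S := fun i hi => by rw [hKX i hi]; exact sortPos_lt (hrepS i hi).1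
  have htgt : ∀ i < S, F₄ 5 (sortPos K S i) = sortPos Kv S (rep (F₁ 11 i)) := fun i hi => by
    rw [(hout i hi).1, hY₃, hpos₃ _ (hY i hi), (hrep i hi).2]
  have hwt : ∀ i < S, F₄ 6 (sortPos K S i) = F₁ 12 i := fun i hi => by
    rw [(hout i hi).2, hwt₃, hwt₂]
  refine ⟨⟨S, below K S, F₄ 5, F₄ 6, fun v => (s₄.arr 7 (BitVec.ofNat b v)).toNat⟩,
    fun x => sortPos Kv S (rep x), (s₄.reg 4).toNat, (s₄.reg 8).toNat, (s₄.reg 9).toNat,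
    ⟨below_zero _ _, fun v _ => below_mono _ _ (Nat.le_succ v), below_eq hKlt, ?_, ?_⟩, rfl,
    fun v => BitVec.isLt _, ⟨?_, ?_, ?_, ?_⟩, ?_⟩
  · intro j hj
    obtain ⟨i, hi, rfl⟩ := exists_sortPos_eq K hj
    obtain ⟨x, hx, h1⟩ := htgtN i hi
    change F₄ 5 (sortPos K S i) < S
    rw [htgt i hi, h1]
    exact sortPos_lt (hrepN x hx).1
  · intro w hw
    obtain ⟨p, hp, rfl⟩ := exists_sortPos_eq Kv hw
    refine le_trans (le_of_eq ?_) (equal_mul_sortPos_le hX hKv hp)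
    congr 1
    rw [Csr.deg]
    simp only
    rw [below_succ, Nat.add_sub_cancel_left, equal, equal]
    congr 1
    refine Finset.filter_congr fun i hi => ?_
    rw [Finset.mem_range] at hi
    rw [hKX i hi, ← (hrep i hi).1]
    refine ⟨fun h => sortPos_injOn Kv S ?_ ?_ h, fun h => by rw [h]⟩
    · simpa using hX i hi
    · simpa using hp
  · intro x y hx hy hxy
    have h1 := sortPos_injOn Kv S (by simpa using (hrepN x hx).1) (by simpa using (hrepN y hy).1) hxy
    have h2 := (hrepN x hx).2
    rw [h1, (hrepN y hy).2] at h2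
    exact Fin.ext h2.symm
  · intro x hx
    exact sortPos_lt (hrepN x hx).1
  · intro x hx
    have h1 := (hrepN x hx).1
    have h2 : sortPos Kv S (rep x) < S := sortPos_lt h1
    simp only
    rw [hF₄ 7 _ (by omega), hlab₄, hlab₃ _ h1]
    obtain ⟨i, hi, h3⟩ := hsource x hx
    have h4 := hlab₂ i hi
    rw [h3, hlab₁, hF₀l x] at h4
    rw [h4, BitVec.toNat_ofNat, Nat.mod_eq_of_lt]
    rw [← hF₀l x]
    exact BitVec.isLt _
  · intro x y
    simp only [Csr.adj, Matrix.of_apply]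
    rw [sum_Ico_below]
    have h1 : ∀ i ∈ Finset.range S, (if K i = x then
        (if F₄ 5 (sortPos K S i) = y then F₄ 6 (sortPos K S i) else 0) else 0) =
        if sortPos Kv S (rep (F₁ 10 i)) = x ∧ sortPos Kv S (rep (F₁ 11 i)) = y then F₁ 12 i
          else 0 := by
      intro i hi
      rw [Finset.mem_range] at hi
      rw [hKX i hi, htgt i hi, hwt i hi, ite_and]
    rw [Finset.sum_congr rfl h1, show Finset.range S = Finset.range (m + m) by rw [hSdef, two_mul],
      Finset.sum_range_add, ← Finset.sum_add_distrib, Finset.sum_range]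
    have h2 : ∀ a c, (if G.graph.Adj a c ∧ sortPos Kv S (rep a) = x ∧ sortPos Kv S (rep c) = y
        then G.weight s(a, c) else 0) = if G.graph.Adj a c then
          (if sortPos Kv S (rep a) = x ∧ sortPos Kv S (rep c) = y then G.weight s(a, c) else 0)
          else 0 := fun a c => by rw [ite_and]
    simp only [h2]
    rw [sum_adj_eq hbij fun a c =>
      if sortPos Kv S (rep a) = x ∧ sortPos Kv S (rep c) = y then G.weight s(a, c) else 0]
    refine Finset.sum_congr rfl fun i _ => ?_
    obtain ⟨⟨e1, e2⟩, ⟨e3, e4⟩, e5, e6⟩ := harcs i i.2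
    rw [e1, e2, e3, e4, e5, e6, hF₀u i, hF₀v i, hF₀w i, Sym2.eq_swap (a := v i)]
  · refine ⟨(s₄.reg 5).toNat, (s₄.reg 6).toNat, (s₄.reg 10).toNat, (s₄.reg 11).toNat, ?_, ?_, ?_, ?_,
      ?_⟩
    · have hreg : ∀ r, r ≠ 14 → s₄.reg r = s₀.reg r := fun r hr => by
        rw [hr₄ r hr, hr₃ r hr, hr₂ r hr, hr₁ r hr]
      intro r hr1 hr2
      interval_cases r
      · rw [hreg 2 (by omega), h2₀]; rfl
      · rw [hreg 3 (by omega), h3₀]; rfl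
      · exact eq_ofNat_of_toNat_eq rfl
      · exact eq_ofNat_of_toNat_eq rfl
      · exact eq_ofNat_of_toNat_eq rfl
      · rw [hreg 7 (by omega), h7₀]; rfl
      all_goals exact eq_ofNat_of_toNat_eq rfl
    · intro p hp
      have : p ≤ S := hp
      rw [hF₄ 4 p (by omega), hoff p this]
      rfl
    · intro j hj
      have : j < S := hj
      exact hF₄ 5 j (by omega)
    · intro j hj
      have : j < S := hj
      exact hF₄ 6 j (by omega)
    · intro p _
      exact eq_ofNat_of_toNat_eq rfl

/-! ### Closed walks and copies of cycles -/

/-- An entry of a product of matrices is a sum over walks. -/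
theorem prod_ofFn_apply {S : ℕ} : ∀ {k : ℕ} (A : Fin k → Matrix (Fin S) (Fin S) ℕ) (u v : Fin S),
    (List.ofFn A).prod u v = ∑ x : Fin (k + 1) → Fin S,
      if x 0 = u ∧ x (Fin.last k) = v then ∏ i, A i (x i.castSucc) (x i.succ) else 0
  | 0, A, u, v => by
    rw [← (Equiv.funUnique (Fin 1) (Fin S)).symm.sum_comp]
    simp [Matrix.one_apply, ite_and]
  | k + 1, A, u, v => by
    rw [List.ofFn_succ, List.prod_cons, Matrix.mul_apply, ← (Fin.consEquiv fun _ => Fin S).sum_comp,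
      Fintype.sum_prod_type]
    simp only [prod_ofFn_apply, Finset.mul_sum]
    rw [Finset.sum_comm]
    conv_rhs => rw [Finset.sum_comm]
    refine Finset.sum_congr rfl fun x _ => ?_
    rw [Finset.sum_eq_single (x 0), Finset.sum_eq_single u]
    · simp [Fin.consEquiv, Fin.prod_univ_succ, ← Fin.succ_last]
    · intro j _ hj
      exact if_neg fun h => hj h.1
    · simp
    · intro j _ hj
      rw [if_neg (fun h => hj h.1.symm), mul_zero]
    · simp

/-- The trace of a product of matrices is a sum over closed walks. -/
theorem trace_prod_ofFn {S k : ℕ} (A : Fin (k + 1) → Matrix (Fin S) (Fin S) ℕ) :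
    (List.ofFn A).prod.trace = ∑ x : Fin (k + 1) → Fin S, ∏ i, A i (x i) (x (i + 1)) := by
  simp only [Matrix.trace, Matrix.diag_apply, prod_ofFn_apply]
  rw [Finset.sum_comm, ← (Fin.snocEquiv fun _ => Fin S).sum_comp, Fintype.sum_prod_type,
    Finset.sum_comm]
  refine Finset.sum_congr rfl fun x _ => ?_
  rw [Finset.sum_eq_single (x 0)]
  · rw [Finset.sum_eq_single (x 0)]
    · have h0 : (Fin.snocEquiv fun _ => Fin S) (x 0, x) (0 : Fin (k + 2)) = x 0 := by
        have : (0 : Fin (k + 2)) = Fin.castSucc 0 := rfl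
        rw [this]; simp only [Fin.snocEquiv, Equiv.coe_fn_mk, Fin.snoc_castSucc]
      have h1 : (Fin.snocEquiv fun _ => Fin S) (x 0, x) (Fin.last (k + 1)) = x 0 := by
        simp only [Fin.snocEquiv, Equiv.coe_fn_mk, Fin.snoc_last]
      rw [if_pos ⟨h0, h1⟩]
      refine Finset.prod_congr rfl fun i _ => ?_
      have h2 : (Fin.snocEquiv fun _ => Fin S) (x 0, x) i.castSucc = x i := by
        simp only [Fin.snocEquiv, Equiv.coe_fn_mk, Fin.snoc_castSucc]
      have h3 : (Fin.snocEquiv fun _ => Fin S) (x 0, x) i.succ = x (i + 1) := by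
        induction i using Fin.lastCases with
        | last => rw [Fin.succ_last, h1, Fin.last_add_one]
        | cast i =>
          rw [← Fin.castSucc_succ]
          simp only [Fin.snocEquiv, Equiv.coe_fn_mk, Fin.snoc_castSucc]
          congr 1
          exact (Fin.coeSucc_eq_succ).symm
      rw [h2, h3]
    · intro j _ hj
      rw [if_neg]
      rintro ⟨h0, -⟩
      apply hj
      rw [← h0]
      have : (0 : Fin (k + 2)) = Fin.castSucc 0 := rfl
      rw [this]; simp only [Fin.snocEquiv, Equiv.coe_fn_mk, Fin.snoc_castSucc]
    · simp
  · intro j _ hj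
    refine Finset.sum_eq_zero fun u _ => if_neg ?_
    rintro ⟨h0, h1⟩
    apply hj
    have h2 : (Fin.snocEquiv fun _ => Fin S) (j, x) (Fin.last (k + 1)) = j := by
      simp only [Fin.snocEquiv, Equiv.coe_fn_mk, Fin.snoc_last]
    have h3 : (Fin.snocEquiv fun _ => Fin S) (j, x) (0 : Fin (k + 2)) = x 0 := by
      have : (0 : Fin (k + 2)) = Fin.castSucc 0 := rfl
      rw [this]; simp only [Fin.snocEquiv, Equiv.coe_fn_mk, Fin.snoc_castSucc]
    rw [← h2, h1, ← h0, h3]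
  · simp

open Classical in
/-- The classes and labels along a cycle of length `k` with distinct labels. -/
noncomputable def colorings (k L : ℕ) : Finset (Fin k → Fin 3 × Fin L) :=
  {f | Function.Injective fun i => (f i).2}

/-- The vertices `f` of a cycle, as a list. -/
def vtxList {k L : ℕ} (f : Fin k → Fin 3 × Fin L) : List Vtx :=
  List.ofFn fun i => ((f i).1, ((f i).2 : ℕ))

theorem Params.exists_class (p : Params) {v : ℕ} (hv : v < p.g.S) :
    ∃ c, p.lo c ≤ v ∧ v < p.hi c := by
  by_cases h1 : v < p.D₁
  · exact ⟨0, by simp [Params.lo], by simpa [Params.hi] using h1⟩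
  · by_cases h2 : v < p.D₂
    · exact ⟨1, by simp [Params.lo]; omega, by simpa [Params.hi] using h2⟩
    · exact ⟨2, by simp [Params.lo]; omega, by simpa [Params.hi] using hv⟩

theorem Params.class_unique {p : Params} {β : ℕ} (hp : p.Good β) {v : ℕ} {c d : Fin 3}
    (hc : p.lo c ≤ v ∧ v < p.hi c) (hd : p.lo d ≤ v ∧ v < p.hi d) : c = d := by
  have h1 := hp.D_le
  have h2 := hp.D_le_S
  fin_cases c <;> fin_cases d <;> simp [Params.lo, Params.hi] at * <;> omega

open Classical in
theorem Params.value_vtxList (p : Params) {k L : ℕ} (f : Fin (k + 1) → Fin 3 × Fin L) :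
    p.value (vtxList f) = ∑ x : Fin (k + 1) → Fin p.g.S,
      if ∀ i, p.lo (f i).1 ≤ (x i : ℕ) ∧ (x i : ℕ) < p.hi (f i).1 ∧ p.g.lab (x i) = (f i).2 then
        ∏ i, p.g.adj (x i) (x (i + 1)) else 0 := by
  rw [Params.value, vtxList, List.map_ofFn, trace_prod_ofFn]
  refine Finset.sum_congr rfl fun x _ => ?_
  simp only [Function.comp, Csr.sel, Matrix.diagonal_mul, ite_mul, one_mul, zero_mul]
  split_ifs with h
  · exact Finset.prod_congr rfl fun i _ => if_pos (h i)
  · obtain ⟨i, hi⟩ := not_forall.1 h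
    exact Finset.prod_eq_zero (Finset.mem_univ i) (if_neg hi)

open Classical in
/-- Every closed walk with distinct labels belongs to exactly one choice of classes and labels. -/
theorem Params.sum_value {p : Params} {β : ℕ} (hp : p.Good β) (k L : ℕ) :
    (((colorings (k + 1) L).toList.map vtxList).map p.value).sum =
      ∑ x : Fin (k + 1) → Fin p.g.S,
        if (∀ i, p.g.lab (x i) < L) ∧ Function.Injective (fun i => p.g.lab (x i)) then
          ∏ i, p.g.adj (x i) (x (i + 1)) else 0 := by
  rw [List.map_map, Finset.sum_map_toList]
  simp only [Function.comp, p.value_vtxList]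
  rw [Finset.sum_comm]
  refine Finset.sum_congr rfl fun x _ => ?_
  split_ifs with h
  · choose c hc using fun i => p.exists_class (x i).2
    rw [Finset.sum_eq_single fun i => (c i, ⟨p.g.lab (x i), h.1 i⟩)]
    · exact if_pos fun i => ⟨(hc i).1, (hc i).2, rfl⟩
    · intro f _ hf
      refine if_neg fun hf' => hf ?_
      funext i
      exact Prod.ext (Params.class_unique hp ⟨(hf' i).1, (hf' i).2.1⟩ (hc i))
        (Fin.ext (hf' i).2.2.symm)
    · intro hf
      refine absurd ?_ hf
      simp only [colorings, Finset.mem_filter, Finset.mem_univ, true_and]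
      intro i j hij
      exact h.2 (congrArg Fin.val hij)
  · refine Finset.sum_eq_zero fun f hf => if_neg fun hf' => h ⟨fun i => ?_, fun i j hij => ?_⟩
    · rw [(hf' i).2.2]; exact (f i).2.2
    · simp only [colorings, Finset.mem_filter, Finset.mem_univ, true_and] at hf
      apply hf
      refine Fin.ext ?_
      exact (hf' i).2.2.symm.trans (hij.trans (hf' j).2.2)

/-- A closed walk of `k` steps in `G` with distinct labels. -/
def ColorfulWalk {L : ℕ} (G : WeightedLabeledGraph L) (k : ℕ) [NeZero k] : Type :=
  {y : Fin k → Fin G.n // (∀ i, G.graph.Adj (y i) (y (i + 1))) ∧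
    Function.Injective fun i => G.label (y i)}

open Classical in
noncomputable instance {L : ℕ} (G : WeightedLabeledGraph L) (k : ℕ) [NeZero k] :
    Fintype (ColorfulWalk G k) :=
  inferInstanceAs (Fintype (Subtype _))

theorem Represents.adj_eq {L : ℕ} {g : Csr} {G : WeightedLabeledGraph L} {pos : Fin G.n → ℕ}
    (h : Represents g G pos) {u v : Fin G.n} (huv : G.graph.Adj u v) {x y : Fin g.S}
    (hx : pos u = x) (hy : pos v = y) : g.adj x y = G.weight s(u, v) := by
  rw [h.adj, Finset.sum_eq_single u, Finset.sum_eq_single v]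
  · exact if_pos ⟨huv, hx, hy⟩
  · intro v' _ hv'
    refine if_neg fun h' => hv' ?_
    exact h.inj _ _ ⟨_, h'.1.symm⟩ ⟨_, huv.symm⟩ (h'.2.2.trans hy.symm)
  · simp
  · intro u' _ hu'
    refine Finset.sum_eq_zero fun v' _ => if_neg fun h' => hu' ?_
    exact h.inj _ _ ⟨_, h'.1⟩ ⟨_, huv⟩ (h'.2.1.trans hx.symm)
  · simp

theorem Represents.exists_adj {L : ℕ} {g : Csr} {G : WeightedLabeledGraph L} {pos : Fin G.n → ℕ}
    (h : Represents g G pos) {x y : Fin g.S} (hxy : g.adj x y ≠ 0) :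
    ∃ u v, G.graph.Adj u v ∧ pos u = x ∧ pos v = y := by
  rw [h.adj] at hxy
  obtain ⟨u, -, hu⟩ := Finset.exists_ne_zero_of_sum_ne_zero hxy
  obtain ⟨v, -, hv⟩ := Finset.exists_ne_zero_of_sum_ne_zero hu
  by_contra hne
  exact hv (if_neg fun h' => hne ⟨u, v, h'⟩)

open Classical in
/-- The closed walks with distinct labels in a representation of `G` are those in `G`. -/
theorem Represents.sum_walks {L : ℕ} {g : Csr} {G : WeightedLabeledGraph L} {pos : Fin G.n → ℕ}
    (h : Represents g G pos) (k : ℕ) :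
    (∑ x : Fin (k + 1) → Fin g.S,
      if (∀ i, g.lab (x i) < L) ∧ Function.Injective (fun i => g.lab (x i)) then
        ∏ i, g.adj (x i) (x (i + 1)) else 0) =
      ∑ y : ColorfulWalk G (k + 1), ∏ i, G.weight s(y.1 i, y.1 (i + 1)) := by
  symm
  have hN : ∀ (y : ColorfulWalk G (k + 1)) i, NonIsolated G.graph (y.1 i) := fun y i =>
    ⟨_, y.2.1 i⟩
  refine Finset.sum_of_injOn
    (fun y : ColorfulWalk G (k + 1) => fun i => (⟨pos (y.1 i), h.lt _ (hN y i)⟩ : Fin g.S))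
    (fun y _ z _ hyz => ?_) (fun _ _ => Finset.mem_coe.2 (Finset.mem_univ _)) (fun x _ hx => ?_)
    (fun y _ => ?_)
  · refine Subtype.ext (funext fun i => h.inj _ _ (hN y i) (hN z i) ?_)
    exact congrArg Fin.val (congrFun hyz i)
  · by_contra hne
    rw [ite_eq_right_iff, Classical.not_imp] at hne
    obtain ⟨⟨h1, h2⟩, h3⟩ := hne
    have h4 : ∀ i, ∃ u v, G.graph.Adj u v ∧ pos u = x i ∧ pos v = x (i + 1) := fun i =>
      h.exists_adj fun h0 => h3 (Finset.prod_eq_zero (Finset.mem_univ i) h0)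
    choose u v huv hu hv using h4
    have huv' : ∀ i, v i = u (i + 1) := fun i =>
      h.inj _ _ ⟨_, (huv i).symm⟩ ⟨_, huv (i + 1)⟩ ((hv i).trans (hu (i + 1)).symm)
    refine hx ⟨⟨u, fun i => by rw [← huv' i]; exact huv i, fun i j hij => h2 ?_⟩,
      Finset.mem_coe.2 (Finset.mem_univ _), funext fun i => Fin.ext (hu i)⟩
    simp only at hij ⊢
    rw [← hu i, ← hu j, h.lab _ ⟨_, huv i⟩, h.lab _ ⟨_, huv j⟩, hij]
  · have h1 : ∀ i, g.lab (pos (y.1 i)) = G.label (y.1 i) := fun i => h.lab _ (hN y i)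
    refine Eq.trans ?_ (if_pos ⟨fun i => (h1 i).trans_lt (G.label _).2, fun i j hij => ?_⟩).symm
    · exact Finset.prod_congr rfl fun i _ => (h.adj_eq (y.2.1 i) rfl rfl).symm
    · exact y.2.2 (Fin.ext ((h1 i).symm.trans (hij.trans (h1 j))))

/-- The subgraph traversed by an injective map of a graph. -/
def imageSubgraph {W V : Type} {H : SimpleGraph W} {G : SimpleGraph V} (f : H →g G) :
    G.Subgraph where
  verts := Set.range f
  Adj u v := ∃ i j, H.Adj i j ∧ f i = u ∧ f j = v
  adj_sub := by rintro _ _ ⟨i, j, h, rfl, rfl⟩; exact f.map_adj h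
  edge_vert := by rintro _ _ ⟨i, j, h, rfl, rfl⟩; exact ⟨i, rfl⟩
  symm := ⟨by rintro _ _ ⟨i, j, h, rfl, rfl⟩; exact ⟨j, i, h.symm, rfl, rfl⟩⟩

/-- An injective map is an isomorphism onto the subgraph that it traverses. -/
noncomputable def imageIso {W V : Type} {H : SimpleGraph W} {G : SimpleGraph V} (f : H →g G)
    (hf : Function.Injective f) : H ≃g (imageSubgraph f).coe where
  toEquiv := Equiv.ofInjective f hf
  map_rel_iff' := by
    intro i j
    constructor
    · rintro ⟨i', j', h, hi, hj⟩
      rwa [← hf hi, ← hf hj]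
    · intro h
      exact ⟨i, j, h, rfl, rfl⟩

theorem cycleGraph_adj_add_one {k : ℕ} (i : Fin (k + 3)) :
    (SimpleGraph.cycleGraph (k + 3)).Adj i (i + 1) := by
  rw [SimpleGraph.cycleGraph_adj]
  right; simp

/-- A closed walk as a map of the cycle graph. -/
def ColorfulWalk.hom {L : ℕ} {G : WeightedLabeledGraph L} {k : ℕ} (y : ColorfulWalk G (k + 3)) :
    SimpleGraph.cycleGraph (k + 3) →g G.graph where
  toFun := y.1
  map_rel' := by
    intro i j hij
    rw [SimpleGraph.cycleGraph_adj] at hij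
    rcases hij with h | h
    · rw [sub_eq_iff_eq_add'.1 h]; exact (y.2.1 j).symm
    · rw [sub_eq_iff_eq_add'.1 h]; exact y.2.1 i

theorem ColorfulWalk.injective {L : ℕ} {G : WeightedLabeledGraph L} {k : ℕ} [NeZero k]
    (y : ColorfulWalk G k) : Function.Injective y.1 := fun _ _ h =>
  y.2.2 (congrArg G.label h)

theorem ColorfulWalk.isColorfulCopy {L : ℕ} {G : WeightedLabeledGraph L} {k : ℕ}
    (y : ColorfulWalk G (k + 3)) :
    G.IsColorfulCopy (SimpleGraph.cycleGraph (k + 3)) (imageSubgraph y.hom) := by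
  refine ⟨⟨imageIso y.hom y.injective⟩, ?_⟩
  rintro _ ⟨i, rfl⟩ _ ⟨j, rfl⟩ hij
  exact congrArg y.1 (y.2.2 hij)

/-- An isomorphism from the cycle graph onto a colorful copy, as a closed walk. -/
def ColorfulWalk.ofIso {L : ℕ} {G : WeightedLabeledGraph L} {k : ℕ} {T : G.graph.Subgraph}
    (hT : Set.InjOn G.label T.verts) (φ : SimpleGraph.cycleGraph (k + 3) ≃g T.coe) :
    ColorfulWalk G (k + 3) :=
  ⟨fun i => φ i, fun i => T.adj_sub (φ.map_adj_iff.2 (cycleGraph_adj_add_one i)), fun i j hij =>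
    φ.injective (Subtype.ext (hT (φ i).2 (φ j).2 hij))⟩

theorem ColorfulWalk.imageSubgraph_ofIso {L : ℕ} {G : WeightedLabeledGraph L} {k : ℕ}
    {T : G.graph.Subgraph} (hT : Set.InjOn G.label T.verts)
    (φ : SimpleGraph.cycleGraph (k + 3) ≃g T.coe) :
    imageSubgraph (ColorfulWalk.ofIso hT φ).hom = T := by
  refine SimpleGraph.Subgraph.ext ?_ ?_
  · ext v
    constructor
    · rintro ⟨i, rfl⟩; exact (φ i).2
    · intro hv
      exact ⟨φ.symm ⟨v, hv⟩, congrArg Subtype.val (φ.apply_symm_apply ⟨v, hv⟩)⟩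
  · ext u v
    constructor
    · rintro ⟨i, j, h, rfl, rfl⟩
      exact φ.map_adj_iff.2 h
    · intro h
      refine ⟨φ.symm ⟨u, T.edge_vert h⟩, φ.symm ⟨v, T.edge_vert h.symm⟩, φ.symm.map_adj_iff.2 h,
        ?_, ?_⟩
      · exact congrArg Subtype.val (φ.apply_symm_apply ⟨u, _⟩)
      · exact congrArg Subtype.val (φ.apply_symm_apply ⟨v, _⟩)

/-- The edges of the subgraph traversed by a closed walk are the steps of the walk. -/
theorem ColorfulWalk.prod_edges {L : ℕ} {G : WeightedLabeledGraph L} {k : ℕ}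
    (y : ColorfulWalk G (k + 3)) [Fintype (imageSubgraph y.hom).edgeSet] :
    ∏ e ∈ (imageSubgraph y.hom).edgeSet.toFinset, G.weight e =
      ∏ i, G.weight s(y.1 i, y.1 (i + 1)) := by
  symm
  refine Finset.prod_bij (fun i _ => s(y.1 i, y.1 (i + 1))) (fun i _ => ?_)
    (fun i _ j _ hij => ?_) (fun e he => ?_) (fun _ _ => rfl)
  · rw [Set.mem_toFinset]
    exact ⟨i, i + 1, cycleGraph_adj_add_one i, rfl, rfl⟩
  · rcases Sym2.eq_iff.1 hij with ⟨h, -⟩ | ⟨h1, h2⟩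
    · exact y.injective h
    · have h3 := y.injective h1
      have h4 := y.injective h2
      -- on a cycle of length at least three, no two steps are opposite
      exfalso
      rw [h3, add_assoc, add_eq_left] at h4
      have := congrArg Fin.val h4
      simp [Fin.val_add] at this
      rw [Nat.mod_eq_of_lt (by omega)] at this
      omega
  · rw [Set.mem_toFinset] at he
    induction e using Sym2.ind with
    | _ u v =>
      obtain ⟨i, j, h, rfl, rfl⟩ := he
      rw [SimpleGraph.cycleGraph_adj] at h
      rcases h with h | h
      · refine ⟨j, Finset.mem_univ _, ?_⟩
        rw [sub_eq_iff_eq_add'.1 h]; exact Sym2.eq_swap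
      · refine ⟨i, Finset.mem_univ _, ?_⟩
        rw [sub_eq_iff_eq_add'.1 h]; rfl

/-- The number of automorphisms of the cycle of length `k`. -/
noncomputable def autCount (k : ℕ) : ℕ :=
  Nat.card (SimpleGraph.cycleGraph k ≃g SimpleGraph.cycleGraph k)

theorem finite_iso {W V : Type} [Finite W] [Finite V] (H : SimpleGraph W) (G : SimpleGraph V) :
    Finite (H ≃g G) := DFunLike.finite _

theorem autCount_pos (k : ℕ) : 0 < autCount k := by
  have := finite_iso (SimpleGraph.cycleGraph k) (SimpleGraph.cycleGraph k)
  have : Nonempty (SimpleGraph.cycleGraph k ≃g SimpleGraph.cycleGraph k) := ⟨.refl⟩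
  exact Nat.card_pos

open Classical in
/-- Every colorful copy of the cycle is traversed by as many closed walks as the cycle has
automorphisms. -/
theorem sum_colorfulWalk {L : ℕ} (G : WeightedLabeledGraph L) (k : ℕ) :
    (∑ y : ColorfulWalk G (k + 3), ∏ i, G.weight s(y.1 i, y.1 (i + 1))) =
      autCount (k + 3) * G.wSub (SimpleGraph.cycleGraph (k + 3)) := by
  set C := SimpleGraph.cycleGraph (k + 3) with hC
  rw [WeightedLabeledGraph.wSub, Finset.mul_sum, ← Finset.sum_fiberwise_of_maps_to
    (t := Finset.univ.filter fun T => G.IsColorfulCopy C T) (g := fun y => imageSubgraph y.hom)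
    (fun y _ => by simpa using ColorfulWalk.isColorfulCopy y)]
  refine Finset.sum_congr rfl fun T hT => ?_
  obtain ⟨⟨ψ⟩, hinj⟩ := (Finset.mem_filter.1 hT).2
  rw [Finset.sum_congr rfl (g := fun _ => ∏ e ∈ T.edgeSet.toFinset, G.weight e), Finset.sum_const,
    smul_eq_mul]
  · congr 1
    have := finite_iso C T.coe
    have e1 : (C ≃g C) ≃ (C ≃g T.coe) :=
      ⟨fun φ => φ.trans ψ, fun φ => φ.trans ψ.symm, fun φ => by ext; simp, fun φ => by ext; simp⟩
    have := Fintype.ofFinite (C ≃g T.coe)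
    rw [autCount, Nat.card_congr e1, Nat.card_eq_fintype_card, ← Finset.card_univ]
    symm
    refine Finset.card_bij (fun φ _ => ColorfulWalk.ofIso hinj φ) (fun φ _ => ?_)
      (fun φ _ φ' _ h => ?_) fun y hy => ?_
    · exact Finset.mem_filter.2 ⟨Finset.mem_univ _, ColorfulWalk.imageSubgraph_ofIso hinj φ⟩
    · refine RelIso.ext fun i => Subtype.ext ?_
      exact congrFun (congrArg Subtype.val h) i
    · obtain rfl := (Finset.mem_filter.1 hy).2
      exact ⟨imageIso y.hom y.injective, Finset.mem_univ _, rfl⟩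
  · intro y hy
    rw [Finset.mem_filter] at hy
    obtain ⟨-, rfl⟩ := hy
    exact (ColorfulWalk.prod_edges y).symm

/-- The sum computed by the algorithm. -/
theorem Represents.sum_value {L : ℕ} {p : Params} {β : ℕ} (hp : p.Good β)
    {G : WeightedLabeledGraph L} {pos : Fin G.n → ℕ} (h : Represents p.g G pos) (k : ℕ) :
    (((colorings (k + 3) L).toList.map vtxList).map p.value).sum =
      autCount (k + 3) * G.wSub (SimpleGraph.cycleGraph (k + 3)) := by
  rw [Params.sum_value hp (k + 2) L, h.sum_walks (k + 2), sum_colorfulWalk G k]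

open Classical in
theorem Represents.rowLe {L : ℕ} {g : Csr} {G : WeightedLabeledGraph L} {pos : Fin G.n → ℕ}
    (h : Represents g G pos) {N : ℕ} (hw : ∀ e ∈ G.graph.edgeSet, G.weight e ≤ N) :
    RowLe g.adj (G.n * (G.n * N)) := by
  intro x
  simp only [h.adj]
  rw [Finset.sum_comm]
  have h1 : ∀ u : Fin G.n, ∑ y : Fin g.S, ∑ v, (if G.graph.Adj u v ∧ pos u = x ∧ pos v = y then
      G.weight s(u, v) else 0) ≤ G.n * N := by
    intro u
    rw [Finset.sum_comm]
    refine (Finset.sum_le_card_nsmul _ _ N fun v _ => ?_).trans (by simp)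
    by_cases huv : G.graph.Adj u v
    · have hv : pos v < g.S := h.lt v ⟨u, huv.symm⟩
      rw [Finset.sum_eq_single ⟨pos v, hv⟩]
      · split_ifs
        · exact hw _ huv
        · exact Nat.zero_le _
      · intro y _ hy
        exact if_neg fun h' => hy (Fin.ext h'.2.2.symm)
      · simp
    · rw [Finset.sum_eq_zero fun y _ => if_neg fun h' => huv h'.1]
      exact Nat.zero_le _
  exact (Finset.sum_le_card_nsmul _ _ _ fun u _ => h1 u).trans (by simp)

theorem card_colorfulWalk_le {L : ℕ} (G : WeightedLabeledGraph L) (k : ℕ) [NeZero k] :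
    Fintype.card (ColorfulWalk G k) ≤ G.n ^ k := by
  classical
  refine (Fintype.card_le_of_injective (fun y : ColorfulWalk G k => y.1)
    Subtype.val_injective).trans ?_
  simp

theorem autCount_mul_wSub_le {L : ℕ} (G : WeightedLabeledGraph L) {N : ℕ} (hn : G.n ≤ N)
    (hw : ∀ e ∈ G.graph.edgeSet, G.weight e ≤ N) (k : ℕ) :
    autCount (k + 3) * G.wSub (SimpleGraph.cycleGraph (k + 3)) ≤ N ^ (2 * (k + 3)) := by
  rw [← sum_colorfulWalk]
  refine (Finset.sum_le_card_nsmul _ _ (N ^ (k + 3)) fun y _ => ?_).trans ?_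
  · refine (Finset.prod_le_pow_card _ _ N fun i _ => hw _ (y.2.1 i)).trans ?_
    simp
  · rw [smul_eq_mul, two_mul, pow_add N (k + 3) (k + 3), Finset.card_univ]
    exact Nat.mul_le_mul_right _ ((card_colorfulWalk_le G (k + 3)).trans (Nat.pow_le_pow_left hn _))

theorem two_mul_m_le {L : ℕ} (G : WeightedLabeledGraph L) : 2 * G.m ≤ G.n * G.n := by
  classical
  rw [WeightedLabeledGraph.m, Set.ncard_eq_toFinset_card']
  have h := SimpleGraph.card_edgeFinset_le_card_choose_two (G := G.graph)
  rw [SimpleGraph.edgeFinset, Fintype.card_fin, Nat.choose_two_right] at h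
  have : 2 * (G.n * (G.n - 1) / 2) ≤ G.n * (G.n - 1) := Nat.mul_div_le _ _
  have : G.n * (G.n - 1) ≤ G.n * G.n := Nat.mul_le_mul_left _ (Nat.sub_le _ _)
  omega

/-! ### The choice of the degree parameter -/

/-- A multiplication of matrices of size about `2 * M / δ ^ q` takes less time than `M * δ ^ r`, if
`δ` is large enough. -/
theorem mul_time_lt {C ω θ A M δ : ℝ} {q r : ℕ} (hC : 0 ≤ C) (hω : 1 ≤ ω) (hθ : 0 ≤ θ)
    (hA : A = C * 4 ^ ω + 1) (hM : A ≤ M) (hδ : A * M ^ θ ≤ δ) (hr : 1 ≤ r + q * ω)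
    (h : ω - 1 ≤ θ * (r + q * ω)) : C * (2 * M / δ ^ q + 2) ^ ω < M * δ ^ r := by
  have h4 : (0 : ℝ) < 4 ^ ω := by positivity
  have hA1 : 1 ≤ A := by rw [hA]; nlinarith
  have hM1 : 1 ≤ M := hA1.trans hM
  have hM0 : 0 < M := by linarith
  have hMθ : 1 ≤ M ^ θ := Real.one_le_rpow hM1 hθ
  have hδ1 : 1 ≤ δ := by nlinarith
  have hδ0 : 0 < δ := by linarith
  have hq0 : 0 < δ ^ q := pow_pos hδ0 _
  have hCA : C * 4 ^ ω < A := by rw [hA]; linarith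
  have hbase : 0 ≤ 2 * M / δ ^ q + 2 := by positivity
  -- if the matrices have bounded size, the time is bounded, and `M` is large
  rcases le_total (M / δ ^ q) 1 with hx | hx
  · have h1 : (2 * M / δ ^ q + 2) ^ ω ≤ 4 ^ ω := by
      refine Real.rpow_le_rpow hbase ?_ (by linarith)
      rw [mul_div_assoc]; linarith
    calc C * (2 * M / δ ^ q + 2) ^ ω ≤ C * 4 ^ ω := mul_le_mul_of_nonneg_left h1 hC
      _ < M := hCA.trans_le hM
      _ ≤ M * δ ^ r := le_mul_of_one_le_right hM0.le (one_le_pow₀ hδ1)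
  · have h1 : (2 * M / δ ^ q + 2) ^ ω ≤ (4 * (M / δ ^ q)) ^ ω := by
      refine Real.rpow_le_rpow hbase ?_ (by linarith)
      rw [mul_div_assoc]; linarith
    have h2 : (4 * (M / δ ^ q)) ^ ω = 4 ^ ω * (M * M ^ (ω - 1) / δ ^ (q * ω)) := by
      rw [Real.mul_rpow (by norm_num) (by positivity), Real.div_rpow hM0.le hq0.le,
        ← Real.rpow_natCast, ← Real.rpow_mul hδ0.le]
      congr 2
      rw [← Real.rpow_one_add' hM0.le (by linarith)]
      congr 1; ring
    have h3 : A * M ^ (ω - 1) ≤ δ ^ (r + q * ω) := by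
      calc A * M ^ (ω - 1) ≤ A ^ (r + q * ω) * M ^ (θ * (r + q * ω)) := by
            refine mul_le_mul ?_ (Real.rpow_le_rpow_of_exponent_le hM1 h) (by positivity)
              (by positivity)
            calc A = A ^ (1 : ℝ) := (Real.rpow_one A).symm
              _ ≤ _ := Real.rpow_le_rpow_of_exponent_le hA1 hr
        _ = (A * M ^ θ) ^ (r + q * ω) := by
            rw [Real.mul_rpow (by linarith) (by positivity), ← Real.rpow_mul hM0.le]
        _ ≤ _ := Real.rpow_le_rpow (by positivity) hδ (by linarith)
    have h5 : δ ^ (r + q * ω) = δ ^ r * δ ^ (q * ω) := by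
      rw [Real.rpow_add hδ0, Real.rpow_natCast]
    have h6 : 0 < δ ^ (q * ω) := by positivity
    have h7 : C * 4 ^ ω * M ^ (ω - 1) < δ ^ r * δ ^ (q * ω) := by
      rw [← h5]
      exact (mul_lt_mul_of_pos_right hCA (by positivity)).trans_le h3
    calc C * (2 * M / δ ^ q + 2) ^ ω ≤ C * (4 ^ ω * (M * M ^ (ω - 1) / δ ^ (q * ω))) :=
          mul_le_mul_of_nonneg_left (h1.trans_eq h2) hC
      _ = M * (C * 4 ^ ω * M ^ (ω - 1) / δ ^ (q * ω)) := by ring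
      _ < M * δ ^ r := by
          refine mul_lt_mul_of_pos_left ?_ hM0
          rwa [div_lt_iff₀ h6]

/-- A power of two for which every matrix multiplication stays within its time limit. -/
theorem exists_parameter {C ω θ : ℝ} {β : ℕ} (hC : 0 ≤ C) (hω : 2 ≤ ω) (hθ : 0 ≤ θ) (hθ1 : θ ≤ 1)
    (h1 : 1 ≤ θ * (β + 4)) (h2 : ω - 1 ≤ θ * (β + 2 * ω)) (h3 : β = 0 → ω - 1 ≤ θ * (2 + ω)) :
    ∃ K : ℕ, 1 ≤ K ∧ ∀ M S : ℕ, K ≤ M → S ≤ 2 * M → ∃ J : ℕ, 1 ≤ J ∧ M ≤ (2 ^ J) ^ (β + 4) ∧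
      (2 : ℝ) ^ J ≤ K * (M : ℝ) ^ θ ∧ 2 ^ J ≤ K * M ∧
      (∀ D ≤ S / (2 ^ J * 2 ^ J) + 1, C * ((D : ℝ) + 1) ^ ω < (M * (2 ^ J) ^ β : ℕ)) ∧
      (β = 0 → ∀ D ≤ S / 2 ^ J + 1, C * ((D : ℝ) + 1) ^ ω < (M * (2 ^ J) ^ 2 : ℕ)) := by
  -- `2 ^ J` lies between `A * M ^ θ` and twice that number
  obtain ⟨A, hA⟩ : ∃ A : ℝ, A = C * 4 ^ ω + 1 := ⟨_, rfl⟩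
  have h4 : (0 : ℝ) < 4 ^ ω := by positivity
  have hA1 : 1 ≤ A := by rw [hA]; nlinarith
  refine ⟨⌈2 * A⌉₊, Nat.one_le_ceil_iff.2 (by linarith), fun M S hM hS => ?_⟩
  have hK : 2 * A ≤ (⌈2 * A⌉₊ : ℕ) := Nat.le_ceil _
  have hMK : ((⌈2 * A⌉₊ : ℕ) : ℝ) ≤ M := by exact_mod_cast hM
  have hM1 : (1 : ℝ) ≤ M := by linarith
  have hMθ : 1 ≤ (M : ℝ) ^ θ := Real.one_le_rpow hM1 hθ
  obtain ⟨J, hJ1, hJ2⟩ := exists_nat_pow_near (x := A * (M : ℝ) ^ θ) (y := 2) (by nlinarith)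
    (by norm_num)
  have hδ : A * (M : ℝ) ^ θ ≤ 2 ^ (J + 1) := hJ2.le
  have hup : (2 : ℝ) ^ (J + 1) ≤ (⌈2 * A⌉₊ : ℕ) * (M : ℝ) ^ θ := by
    rw [pow_succ]; nlinarith
  have hδ1 : (1 : ℝ) ≤ 2 ^ (J + 1) := one_le_pow₀ (by norm_num)
  have hS' : (S : ℝ) ≤ 2 * M := by exact_mod_cast hS
  have hD : ∀ (q D z : ℕ), (z : ℝ) = (2 ^ (J + 1)) ^ q → D ≤ S / z + 1 →
      C * ((D : ℝ) + 1) ^ ω ≤ C * (2 * M / (2 ^ (J + 1)) ^ q + 2) ^ ω := by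
    intro q D z hz hD
    refine mul_le_mul_of_nonneg_left (Real.rpow_le_rpow (by positivity) ?_ (by linarith)) hC
    have h5 : (D : ℝ) ≤ ((S / z : ℕ) : ℝ) + 1 := by exact_mod_cast hD
    have h6 : ((S / z : ℕ) : ℝ) ≤ S / z := Nat.cast_div_le
    have h7 : (S : ℝ) / z ≤ 2 * M / z := by gcongr
    rw [← hz]
    linarith
  refine ⟨J + 1, by omega, ?_, hup, ?_, fun D h => ?_, fun hβ D h => ?_⟩
  · have : (M : ℝ) ≤ (2 ^ (J + 1)) ^ (β + 4) := by
      calc (M : ℝ) = (M : ℝ) ^ (1 : ℝ) := (Real.rpow_one _).symm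
        _ ≤ (M : ℝ) ^ (θ * ((β + 4 : ℕ) : ℝ)) :=
            Real.rpow_le_rpow_of_exponent_le hM1 (by push_cast; exact h1)
        _ = ((M : ℝ) ^ θ) ^ (β + 4) := by rw [Real.rpow_mul (by linarith), Real.rpow_natCast]
        _ ≤ _ := pow_le_pow_left₀ (by linarith) (by nlinarith) _
    exact_mod_cast this
  · have h5 : (M : ℝ) ^ θ ≤ M := by
      calc (M : ℝ) ^ θ ≤ (M : ℝ) ^ (1 : ℝ) := Real.rpow_le_rpow_of_exponent_le hM1 hθ1
        _ = M := Real.rpow_one _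
    have : (2 : ℝ) ^ (J + 1) ≤ (⌈2 * A⌉₊ : ℕ) * (M : ℝ) :=
      hup.trans (mul_le_mul_of_nonneg_left h5 (by positivity))
    exact_mod_cast this
  · refine (hD 2 D _ (by push_cast; ring) h).trans_lt ?_
    push_cast
    exact mul_time_lt hC (by linarith) hθ hA (by linarith) hδ (by push_cast; nlinarith)
      (by push_cast; linarith)
  · refine (hD 1 D _ (by push_cast; ring) h).trans_lt ?_
    push_cast
    exact mul_time_lt hC (by linarith) hθ hA (by linarith) hδ (by push_cast; linarith)
      (by push_cast; linarith [h3 hβ])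

theorem lt_pow_of_lt {N κ : ℕ} (hN : 2 ≤ N) {x y : ℕ} (hx : x ≤ N ^ y) (hy : y < κ)
    (hb : N ^ κ ≤ 2 ^ b) : x < 2 ^ b :=
  (hx.trans_lt (Nat.pow_lt_pow_right (by omega) hy)).trans_le hb

/-! ### The algorithm -/

/-- The algorithm for cycles of a given length computes the sum over all closed walks, and divides
it by the number of walks of each cycle. -/
def cycleProg (P : Program) (β K : ℕ) (ls : List (List Vtx)) (a : ℕ) : Program :=
  .seq (prepProg K) <| .seq (search P β ls) <| .assign 0 (.op .div (.reg 13) (.const a))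

/-- The conditions on `θ` say that `δ`, if it is of the order `M ^ θ`, is large enough for the
numbers of vertices in the classes and for the time limits of the multiplications. -/
theorem colorfulCyclesInTime_of_plan {k β L : ℕ} {ω θ : ℝ} (hω : MatMulInTime ω) (hk : k ≤ 2)
    (hβ : β ≤ 2) (hplan : ∀ f : Fin (k + 3) → Fin 3, (plan β (List.ofFn f)).isSome = true)
    (hθ : 0 ≤ θ) (hθ1 : θ ≤ 1) (h1 : 1 ≤ θ * (β + 4)) (h2 : ω - 1 ≤ θ * (β + 2 * ω))
    (h3 : β = 0 → ω - 1 ≤ θ * (2 + ω)) : ColorfulCyclesInTime (k + 3) L (1 + 2 * θ) := by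
  have hω2 := two_le_of_matMulInTime hω
  obtain ⟨P, κ, C, hP⟩ := hω
  set C' := max C 0 with hC'
  have hmul : Multiplies P κ fun n => ⌊C' * ((n : ℝ) + 1) ^ ω⌋₊ := by
    intro n N b A B i1 i2 i3 i4 i5 s i6 i7 i8
    obtain ⟨s₁, t, j1, j2, j3⟩ := hP n N b A B i1 i2 i3 i4 i5 s i6 i7 i8
    refine ⟨s₁, t, j1, j2, Nat.le_floor (j3.trans ?_)⟩
    exact mul_le_mul_of_nonneg_right (le_max_left _ _) (by positivity)
  obtain ⟨K, hK, hpar⟩ := exists_parameter (C := C') (le_max_right _ _) hω2 hθ hθ1 h1 h2 h3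
  set a := autCount (k + 3) with ha
  set ls := (colorings (k + 3) L).toList.map vtxList with hls
  -- the entries of the matrices are at most `(N ^ 3) ^ 5`, hence the term `15 * κ`
  refine ⟨cycleProg P β K ls a, 15 * κ + 13 * K + a + L + 50,
    searchFactor P β ls.length * (K * K) * (K : ℝ) ^ (1 + 2 * θ) + 1110,
    fun G N b hN hGN hw hb s hs => ?_⟩
  have hpow : ∀ {x y : ℕ}, x ≤ N ^ y → y < 15 * κ + 13 * K + a + L + 50 → x < 2 ^ b :=
    fun hx hy => lt_pow_of_lt hN hx hy hb
  have hself : ∀ x : ℕ, x ≤ N ^ x := fun x =>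
    (Nat.lt_two_pow_self).le.trans (Nat.pow_le_pow_left hN x)
  have hN1 : 1 ≤ N := by omega
  have hm2 : 2 * G.m ≤ N ^ 2 := by
    rw [pow_two]
    exact (two_mul_m_le G).trans (Nat.mul_le_mul hGN hGN)
  have hMle : G.m + K ≤ N ^ (K + 3) := by
    have e1 : K ≤ N ^ K := hself K
    have e2 : 1 ≤ N ^ K := Nat.one_le_pow _ _ hN1
    have e3 : 1 ≤ N ^ 2 := Nat.one_le_pow _ _ hN1
    rw [pow_add, show N ^ 3 = 2 * N ^ 2 + (N - 2) * N ^ 2 by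
      rw [← add_mul, show 2 + (N - 2) = N by omega]; ring]
    nlinarith [Nat.zero_le (N ^ K * ((N - 2) * N ^ 2))]
  obtain ⟨J, hJ1, hMJ, hJθ, hJM, hD1, hD2⟩ := hpar (G.m + K) (2 * G.m) (by omega) (by omega)
  -- the program halts with the right output
  have main : Tri (cycleProg P β K ls a) s (1100 * (G.m + 1) +
      searchFactor P β ls.length * ((G.m + K) * 4 ^ J) + 4) (fun s' =>
        (s'.reg 0).toNat = G.wSub (SimpleGraph.cycleGraph (k + 3))) := by
    have hm22 : 2 * G.m + 2 < 2 ^ b := by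
      refine hpow (y := 3) ?_ (by omega)
      have : 2 * N ^ 2 ≤ N ^ 3 := by rw [pow_succ N 2, mul_comm]; exact Nat.mul_le_mul_left _ hN
      have : 2 ≤ N ^ 2 := by nlinarith
      omega
    refine (prepProg_spec K G hm22 s hs).seq' (T₂ := searchFactor P β ls.length *
      ((G.m + K) * 4 ^ J) + 4) ?_ (by omega)
    rintro s₁ - ⟨g, pos, δ₀, D, D', hg, hgS, hglab, hrep, hheld⟩
    have hword : ∀ δ ≤ 2 ^ J, (g.params (G.m + K) δ).Word b κ (N ^ 15) (N ^ 3) β := by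
      intro δ hδ
      have hS : (g.params (G.m + K) δ).g.S = 2 * G.m := hgS
      constructor
      · rw [hS]; omega
      · rw [hS]
        refine hpow (y := 4) ?_ (by omega)
        rw [show N ^ 4 = N ^ 2 * N ^ 2 by ring]
        exact Nat.mul_le_mul hm2 hm2
      · exact fun v _ => hglab v
      · calc 2 ≤ N := hN
          _ = N ^ 1 := (pow_one N).symm
          _ ≤ N ^ 15 := Nat.pow_le_pow_right hN1 (by omega)
      · rw [← pow_mul]
        exact (Nat.pow_le_pow_right hN1 (by omega)).trans hb
      · exact hpow le_rfl (by omega)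
      · rw [hS]
        exact hm2.trans (Nat.pow_le_pow_right hN1 (by omega))
      · refine hpow (y := (K + 3) + (K + (K + 3)) * 6) ?_ (by omega)
        rw [pow_add N (K + 3), pow_mul N]
        refine Nat.mul_le_mul hMle ?_
        have e1 : 2 ^ J ≤ N ^ (K + (K + 3)) := by
          rw [pow_add]
          exact hJM.trans (Nat.mul_le_mul (hself K) hMle)
        calc δ ^ (β + 4) ≤ (N ^ (K + (K + 3))) ^ (β + 4) := Nat.pow_le_pow_left (hδ.trans e1) _
          _ ≤ _ := Nat.pow_le_pow_right (Nat.one_le_pow _ _ hN1) (by omega)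
      · rw [hS]
        refine hpow (y := 3) ?_ (by omega)
        rw [pow_succ, mul_comm]
        exact Nat.mul_le_mul hm2 hN
      · exact Nat.one_le_pow _ _ hN1
      · intro x
        refine (hrep.rowLe hw x).trans ?_
        rw [show N ^ 3 = N * (N * N) by ring]
        exact Nat.mul_le_mul hGN (Nat.mul_le_mul_right _ hGN)
      · rw [← pow_mul]
    have hL : L < 2 ^ b := hpow (hself L) (by omega)
    have htot : a * G.wSub (SimpleGraph.cycleGraph (k + 3)) < 2 ^ b :=
      hpow (autCount_mul_wSub_le G hGN hw k) (by omega)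
    refine (search_spec hmul hg (by omega) (by omega) hJ1 hMJ ?_ hword ?_ ls ?_
      (fun δ hp => Represents.sum_value hp hrep k) s₁ hheld).seq' (T₂ := 4) ?_ (by omega)
    · exact hpow hMle (by omega)
    · intro d hd
      cases d with
      | false =>
        refine (Nat.floor_lt (by positivity)).2 (hD1 _ ?_)
        simp only [Params.dim, Csr.params, hgS]
        exact min_le_left _ _
      | true =>
        have hβ0 : β = 0 := by simp [budExp] at hd; omega
        subst hβ0
        refine (Nat.floor_lt (by positivity)).2 (hD2 rfl _ ?_)
        simp only [Params.dim, Csr.params, hgS]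
        exact min_le_left _ _
    · intro vs hvs
      obtain ⟨f, -, rfl⟩ := List.mem_map.1 hvs
      refine ⟨fun v hv => ?_, ?_, ?_⟩
      · obtain ⟨i, rfl⟩ := List.mem_ofFn.1 hv
        exact (f i).2.2.trans hL
      · simp [vtxList]; omega
      · rw [vtxList, List.map_ofFn]
        exact hplan _
    · intro s₂ _ h13
      refine Tri.assign (by simp [Expr.cost]) ?_
      have ha0 : 0 < a := autCount_pos _
      simp only [Expr.eval, Op.eval, h13, State.setReg_reg, if_true]
      rw [ofNat_div_of_lt htot (hpow (hself a) (by omega)), Nat.mul_div_cancel_left _ ha0,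
        BitVec.toNat_ofNat, Nat.mod_eq_of_lt]
      exact lt_of_le_of_lt (Nat.le_mul_of_pos_left _ ha0) htot
  obtain ⟨s', t, hexec, ht, hout⟩ := main
  refine ⟨s', t, hexec, hout, ?_⟩
  have hm0 : (0 : ℝ) ≤ G.m := Nat.cast_nonneg _
  have hK1 : (1 : ℝ) ≤ K := by exact_mod_cast hK
  set X : ℝ := ((G.m : ℝ) + 1) ^ (1 + 2 * θ) with hX
  have hX1 : (G.m : ℝ) + 1 ≤ X := by
    calc (G.m : ℝ) + 1 = ((G.m : ℝ) + 1) ^ (1 : ℝ) := (Real.rpow_one _).symm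
      _ ≤ X := Real.rpow_le_rpow_of_exponent_le (by linarith) (by linarith)
  have hmain : ((G.m + K : ℕ) : ℝ) * 4 ^ J ≤ K * K * ((K : ℝ) ^ (1 + 2 * θ) * X) := by
    have e1 : (0 : ℝ) < ((G.m + K : ℕ) : ℝ) := by push_cast; linarith
    have e2 : (4 : ℝ) ^ J ≤ K * K * ((G.m + K : ℕ) : ℝ) ^ (2 * θ) := by
      calc (4 : ℝ) ^ J = 2 ^ J * 2 ^ J := by rw [← mul_pow]; norm_num
        _ ≤ (K * ((G.m + K : ℕ) : ℝ) ^ θ) * (K * ((G.m + K : ℕ) : ℝ) ^ θ) :=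
            mul_le_mul hJθ hJθ (by positivity) (by positivity)
        _ = K * K * ((G.m + K : ℕ) : ℝ) ^ (2 * θ) := by
            rw [two_mul θ, Real.rpow_add e1]; ring
    have e3 : ((G.m + K : ℕ) : ℝ) ≤ K * ((G.m : ℝ) + 1) := by push_cast; nlinarith
    calc ((G.m + K : ℕ) : ℝ) * 4 ^ J ≤
          ((G.m + K : ℕ) : ℝ) * (K * K * ((G.m + K : ℕ) : ℝ) ^ (2 * θ)) :=
          mul_le_mul_of_nonneg_left e2 e1.le
      _ = K * K * ((G.m + K : ℕ) : ℝ) ^ (1 + 2 * θ) := by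
          rw [Real.rpow_add e1, Real.rpow_one]; ring
      _ ≤ K * K * (K * ((G.m : ℝ) + 1)) ^ (1 + 2 * θ) := by
          gcongr
      _ = _ := by rw [Real.mul_rpow (by linarith) (by linarith)]
  calc (t : ℝ) ≤ 1100 * ((G.m : ℝ) + 1) +
        searchFactor P β ls.length * (((G.m + K : ℕ) : ℝ) * 4 ^ J) + 4 := by exact_mod_cast ht
    _ ≤ 1100 * X + searchFactor P β ls.length * (K * K * ((K : ℝ) ^ (1 + 2 * θ) * X)) + 4 * X := by
        have := mul_le_mul_of_nonneg_left hmain (Nat.cast_nonneg (α := ℝ) (searchFactor P β ls.length))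
        linarith
    _ ≤ _ := by
        have : 0 ≤ X := by linarith
        nlinarith

theorem colorfulCyclesInTime_mono {k L : ℕ} {c d : ℝ} (h : ColorfulCyclesInTime k L c)
    (hcd : c ≤ d) : ColorfulCyclesInTime k L d := by
  obtain ⟨P, κ, C, h⟩ := h
  refine ⟨P, κ, max C 0, fun G N b h1 h2 h3 h4 s h5 => ?_⟩
  obtain ⟨s₁, t, h6, h7, h8⟩ := h G N b h1 h2 h3 h4 s h5
  refine ⟨s₁, t, h6, h7, h8.trans ?_⟩
  have hm : (1 : ℝ) ≤ (G.m : ℝ) + 1 := by linarith [Nat.cast_nonneg (α := ℝ) G.m]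
  exact mul_le_mul (le_max_left _ _) (Real.rpow_le_rpow_of_exponent_le hm hcd) (by positivity)
    (le_max_right _ _)

theorem colorfulTrianglesInTime {ω : ℝ} (h : MatMulInTime ω) (L : ℕ) :
    ColorfulCyclesInTime 3 L (2 * ω / (ω + 1)) := by
  have h2 := two_le_of_matMulInTime h
  have hθ : (ω - 1) / (2 * (ω + 1)) * (2 * (ω + 1)) = ω - 1 := div_mul_cancel₀ _ (by linarith)
  set θ := (ω - 1) / (2 * (ω + 1)) with hθd
  have hθ0 : 0 ≤ θ := div_nonneg (by linarith) (by linarith)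
  have hc : 2 * ω / (ω + 1) = 1 + 2 * θ := by
    rw [div_eq_iff (by linarith)]; linarith
  rw [hc]
  refine colorfulCyclesInTime_of_plan (k := 0) (β := 2) h (by omega) (by omega) plan_three hθ0
    ?_ ?_ ?_ (by omega)
  · rw [hθd, div_le_one (by linarith)]; linarith
  · push_cast
    rw [hθd, div_mul_eq_mul_div, le_div_iff₀ (by linarith)]; linarith
  · push_cast; linarith

theorem colorfulFourCyclesInTime {ω : ℝ} (h : MatMulInTime ω) (L : ℕ) :
    ColorfulCyclesInTime 4 L ((4 * ω - 1) / (2 * ω + 1)) := by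
  have h2 := two_le_of_matMulInTime h
  have hθ : (ω - 1) / (2 * ω + 1) * (2 * ω + 1) = ω - 1 := div_mul_cancel₀ _ (by linarith)
  set θ := (ω - 1) / (2 * ω + 1) with hθd
  have hθ0 : 0 ≤ θ := div_nonneg (by linarith) (by linarith)
  have hc : (4 * ω - 1) / (2 * ω + 1) = 1 + 2 * θ := by
    rw [div_eq_iff (by linarith)]; linarith
  rw [hc]
  refine colorfulCyclesInTime_of_plan (k := 1) (β := 1) h (by omega) (by omega) plan_four hθ0
    ?_ ?_ ?_ (by omega)
  · rw [hθd, div_le_one (by linarith)]; linarith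
  · push_cast
    rw [hθd, div_mul_eq_mul_div, le_div_iff₀ (by linarith)]; linarith
  · push_cast; linarith

theorem colorfulFiveCyclesInTime {ω : ℝ} (h : MatMulInTime ω) (L : ℕ) :
    ColorfulCyclesInTime 5 L (3 * ω / (ω + 2)) := by
  have h2 := two_le_of_matMulInTime h
  have hθ : (ω - 1) / (ω + 2) * (ω + 2) = ω - 1 := div_mul_cancel₀ _ (by linarith)
  set θ := (ω - 1) / (ω + 2) with hθd
  have hθ0 : 0 ≤ θ := div_nonneg (by linarith) (by linarith)
  have hc : 3 * ω / (ω + 2) = 1 + 2 * θ := by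
    rw [div_eq_iff (by linarith)]; linarith
  rw [hc]
  refine colorfulCyclesInTime_of_plan (k := 2) (β := 0) h (by omega) (by omega) plan_five hθ0
    ?_ ?_ ?_ (fun _ => by linarith)
  · rw [hθd, div_le_one (by linarith)]; linarith
  · push_cast
    rw [hθd, div_mul_eq_mul_div, le_div_iff₀ (by linarith)]; linarith
  · push_cast; nlinarith

/-- There are exponents of matrix multiplication arbitrarily close to the infimum. -/
theorem exists_matMulInTime_lt {ε : ℝ} (hε : 0 < ε) :
    ∃ τ, MatMulInTime τ ∧ matMulExponent ≤ τ ∧ τ < matMulExponent + ε := by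
  have hbdd : BddBelow {τ : ℝ | MatMulInTime τ} := ⟨2, fun τ hτ => two_le_of_matMulInTime hτ⟩
  obtain ⟨τ, hτ, hlt⟩ := exists_lt_of_csInf_lt ⟨3, matMulInTime_three⟩
    (show sInf {τ : ℝ | MatMulInTime τ} < matMulExponent + ε by
      rw [matMulExponent]; linarith)
  exact ⟨τ, hτ, csInf_le hbdd hτ, hlt⟩

theorem two_le_matMulExponent : 2 ≤ matMulExponent :=
  le_csInf ⟨3, matMulInTime_three⟩ fun _ hτ => two_le_of_matMulInTime hτ

end WordRAM

/-- The first part is about every exponent `ω` for which matrix multiplication in time `O(n ^ ω)` is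
possible, in particular about the least one if there is one; the second part is about the infimum,
which need not be attained. -/
theorem mainTheorem5 :
    (∀ ω : ℝ, MatMulInTime ω → ∀ L : ℕ,
      ColorfulCyclesInTime 3 L (2 * ω / (ω + 1)) ∧
      ColorfulCyclesInTime 4 L ((4 * ω - 1) / (2 * ω + 1)) ∧
      ColorfulCyclesInTime 5 L (3 * ω / (ω + 2))) ∧
    (∀ ω : ℝ, ω = matMulExponent → ∀ ε : ℝ, 0 < ε → ∀ L : ℕ,
      ColorfulCyclesInTime 3 L (2 * ω / (ω + 1) + ε) ∧
      ColorfulCyclesInTime 4 L ((4 * ω - 1) / (2 * ω + 1) + ε) ∧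
      ColorfulCyclesInTime 5 L (3 * ω / (ω + 2) + ε)) := by
  refine ⟨fun ω h L => ⟨WordRAM.colorfulTrianglesInTime h L, WordRAM.colorfulFourCyclesInTime h L,
    WordRAM.colorfulFiveCyclesInTime h L⟩, ?_⟩
  rintro ω rfl ε hε L
  obtain ⟨τ, hτ, hle, hlt⟩ := WordRAM.exists_matMulInTime_lt hε
  have h2 := WordRAM.two_le_matMulExponent
  set ω := matMulExponent
  -- the three exponents grow at most as fast as the exponent of matrix multiplication
  refine ⟨WordRAM.colorfulCyclesInTime_mono (WordRAM.colorfulTrianglesInTime hτ L) ?_,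
    WordRAM.colorfulCyclesInTime_mono (WordRAM.colorfulFourCyclesInTime hτ L) ?_,
    WordRAM.colorfulCyclesInTime_mono (WordRAM.colorfulFiveCyclesInTime hτ L) ?_⟩
  · have : 2 * τ / (τ + 1) - 2 * ω / (ω + 1) = (τ - ω) * (2 / ((τ + 1) * (ω + 1))) := by
      rw [div_sub_div _ _ (show τ + 1 ≠ 0 by linarith) (show ω + 1 ≠ 0 by linarith), ← mul_div_assoc]
      congr 1
      ring
    have h3 : 2 / ((τ + 1) * (ω + 1)) ≤ 1 := (div_le_one (by nlinarith)).2 (by nlinarith)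
    nlinarith
  · have : (4 * τ - 1) / (2 * τ + 1) - (4 * ω - 1) / (2 * ω + 1) =
        (τ - ω) * (6 / ((2 * τ + 1) * (2 * ω + 1))) := by
      rw [div_sub_div _ _ (show 2 * τ + 1 ≠ 0 by linarith) (show 2 * ω + 1 ≠ 0 by linarith),
        ← mul_div_assoc]
      congr 1
      ring
    have h3 : 6 / ((2 * τ + 1) * (2 * ω + 1)) ≤ 1 := (div_le_one (by nlinarith)).2 (by nlinarith)
    nlinarith
  · have : 3 * τ / (τ + 2) - 3 * ω / (ω + 2) = (τ - ω) * (6 / ((τ + 2) * (ω + 2))) := by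
      rw [div_sub_div _ _ (show τ + 2 ≠ 0 by linarith) (show ω + 2 ≠ 0 by linarith), ← mul_div_assoc]
      congr 1
      ring
    have h3 : 6 / ((τ + 2) * (ω + 2)) ≤ 1 := (div_le_one (by nlinarith)).2 (by nlinarith)
    nlinarith
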